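/- **Theorem 3.1.** Let $m\ge 1$ and $n\ge 0$ be integers. Let $p:X\to Y$ be a proper holomorphic submersion from a connected complex manifold $X$ of dimension $m+n$ to a connected complex manifold $Y$ of dimension $m$ (manifolds are Hausdorff and second countable; $X$ is assumed to be Kähler, which is automatic from condition (2) below, since the curvature form of $(A,h_A)$ is then a Kähler form). For $y\in Y$ put $X_y:=p^{-1}(y)$. A Hermitian holomorphic line bundle is a holomorphic line bundle with a smooth Hermitian metric; it is called semi-positive (resp. positive) if its Chern curvature is, i.e. if $i\partial\bar\partial\varphi\ge 0$ (resp. $>0$) for every local weight $\varphi$, where $|f|_h^2=e^{-\varphi}$ for a local holomorphic frame $f$. For a Hermitian holomorphic line bundle $(M,h_M)$ on $X$, the *relative Bergman kernel metric* on $K_{X/Y}\otimes M$ is the (possibly singular) metric defined as follows. In local holomorphic coordinates $(t,z)\in\mathbb C^m\times\mathbb C^n$ of $X$ in which $p$ is the projection $(t,z)\mapsto t$, and for a local holomorphic frame $\mathbf e$ of $M$, one has $|dz\otimes\mathbf e|^2=e^{-\psi}$ with $$e^{\psi(t,z)}=\sup\Big\{|v(z)|^2:\ u\in H^0(X_t,K_{X_t}\otimes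 M|_{X_t}),\ \int_{X_t}|u|_{h_M}^2\le 1,\ u=v\,dz\otimes\mathbf e\ \text{near } z\Big\},$$ where $|u|^2_{h_M}$ is the measure $|v|^2|\mathbf e|_{h_M}^2\,d\lambda(z)$, with $\lambda$ the Lebesgue measure. It has semi-positive curvature if all its local weights $\psi$ are plurisubharmonic, and it is identically $+\infty$ if all these $\psi$ are identically $-\infty$. Let $(L,h_L)$ be a Hermitian holomorphic line bundle over $X$. Assume that 1. $H^0(X_y,K_{X_y}\otimes L|_{X_y})\ne\{0\}$ for some $y\in Y$; 2. there exists a positive Hermitian holomorphic line bundle $(A,h_A)$ on $X$ with $H^0(X,A)\ne\{0\}$; 3. for every semi-positive Hermitian holomorphic line bundle $(E,h_E)$ on $X$, the relative Bergman kernel metric on $K_{X/Y}\otimes L\otimes E$ (for the metric $h_L\otimes h_E$ on $L\otimes E$) either has semi-positive curvature or is identically $+\infty$. Then the curvature of $(L,h_L)$ is semi-positive. -/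

import Mathlib

open scoped Manifold ContDiff TensorProduct Topology ENNReal
open Bundle

noncomputable section

/-! ### Plurisubharmonic functions and the Levi form on complex vector spaces -/

/-- `u : V → [-∞, ∞]` is plurisubharmonic on `U` (meant for open `U`): it is upper semicontinuous
with values in `[-∞, ∞)`, and it satisfies the sub-mean value inequality on every closed complex
disc `{a + ζ b : |ζ| ≤ 1}` contained in `U`.  The average of `u` over the boundary circle, which
may be `-∞`, is the decreasing limit as `c → -∞` of the averages of the bounded functions
`max u c`; so the inequality is required for all these truncations.  (The function `-∞` is
allowed.) -/
structure IsPSHOn {V : Type*} [NormedAddCommGroup V] [NormedSpace ℂ V]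
    (u : V → EReal) (U : Set V) : Prop where
  usc : UpperSemicontinuousOn u U
  lt_top : ∀ a ∈ U, u a < ⊤
  submean : ∀ a b : V, (∀ ζ : ℂ, ‖ζ‖ ≤ 1 → a + ζ • b ∈ U) → ∀ c : ℝ,
    u a ≤ ((Real.circleAverage (fun ζ : ℂ => (max (u (a + ζ • b)) (c : EReal)).toReal) 0 1 : ℝ) :
      EReal)

/-- The Levi form `∑ ∂²f/∂zⱼ∂z̄ₖ vⱼ v̄ₖ` of a real function at `a`, that is
`(D²f(v, v) + D²f(iv, iv)) / 4`. -/
def leviForm {V : Type*} [NormedAddCommGroup V] [NormedSpace ℂ V] (f : V → ℝ) (a v : V) : ℝ :=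
  (fderiv ℝ (fderiv ℝ f) a v v + fderiv ℝ (fderiv ℝ f) a (Complex.I • v) (Complex.I • v)) / 4

/-! ### Hermitian holomorphic line bundles

A holomorphic line bundle on a complex manifold `X` (modelled on `V`) is an analytic vector bundle
over `X` in the sense of Mathlib, with model fibre `ℂ`. -/

section LineBundle

variable (V : Type*) [NormedAddCommGroup V] [NormedSpace ℂ V]
  {X : Type*} [TopologicalSpace X] [ChartedSpace V X]
  (L : X → Type*) [TopologicalSpace (TotalSpace ℂ L)]
  [∀ x, AddCommGroup (L x)] [∀ x, Module ℂ (L x)] [∀ x, TopologicalSpace (L x)]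
  [FiberBundle ℂ L] [VectorBundle ℂ ℂ L]

/-- `s` is a holomorphic section of `L` over `U`. -/
def IsHolSectionOn (U : Set X) (s : ∀ x, L x) : Prop :=
  ContMDiffOn 𝓘(ℂ, V) (𝓘(ℂ, V).prod 𝓘(ℂ, ℂ)) ω (fun x => (⟨x, s x⟩ : TotalSpace ℂ L)) U

/-- `s` is a holomorphic frame of `L` over the open set `U`. -/
structure IsHolFrame (U : Set X) (s : ∀ x, L x) : Prop where
  isOpen : IsOpen U
  hol : IsHolSectionOn V L U s
  ne_zero : ∀ x ∈ U, s x ≠ 0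

/-- A smooth Hermitian metric on the line bundle `L`, given by `normSq x v = |v|²`.  (On a complex
line, a Hermitian inner product is the same as such a function.) -/
structure HermitianMetric where
  normSq : ∀ x, L x → ℝ
  normSq_smul : ∀ x (c : ℂ) (v : L x), normSq x (c • v) = ‖c‖ ^ 2 * normSq x v
  normSq_pos : ∀ x (v : L x), v ≠ 0 → 0 < normSq x v
  smooth : ∀ (U : Set X) (s : ∀ x, L x), IsHolFrame V L U s →
    ∀ e ∈ IsManifold.maximalAtlas 𝓘(ℂ, V) ω X,
      ContDiffOn ℝ ∞ (fun w => normSq (e.symm w) (s (e.symm w))) (e.target ∩ e.symm ⁻¹' U)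

variable {V L}

/-- The local weight `φ` of the metric in the frame `s`: `|s|² = e^{-φ}`. -/
def HermitianMetric.weight (h : HermitianMetric V L) (s : ∀ x, L x) (x : X) : ℝ :=
  -Real.log (h.normSq x (s x))

/-- The Chern curvature `i∂∂̄φ` is semi-positive, in all local coordinates and frames. -/
def HermitianMetric.IsSemipositive (h : HermitianMetric V L) : Prop :=
  ∀ (U : Set X) (s : ∀ x, L x), IsHolFrame V L U s →
    ∀ e ∈ IsManifold.maximalAtlas 𝓘(ℂ, V) ω X, ∀ w ∈ e.target ∩ e.symm ⁻¹' U, ∀ v : V,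
      0 ≤ leviForm (fun w' => h.weight s (e.symm w')) w v

/-- The Chern curvature `i∂∂̄φ` is positive, in all local coordinates and frames. -/
def HermitianMetric.IsPositive (h : HermitianMetric V L) : Prop :=
  ∀ (U : Set X) (s : ∀ x, L x), IsHolFrame V L U s →
    ∀ e ∈ IsManifold.maximalAtlas 𝓘(ℂ, V) ω X, ∀ w ∈ e.target ∩ e.symm ⁻¹' U, ∀ v : V,
      v ≠ 0 → 0 < leviForm (fun w' => h.weight s (e.symm w')) w v

end LineBundle

/-! ### Tensor products of line bundles

The fibre of `L ⊗ E` at `x` is `L x ⊗[ℂ] E x`.  Its holomorphic structure is given by the local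
frames `s ⊗ t`, for local frames `s` of `L` and `t` of `E`. -/

section Tensor

variable (V : Type*) [NormedAddCommGroup V] [NormedSpace ℂ V]
  {X : Type*} [TopologicalSpace X] [ChartedSpace V X]
  (L : X → Type*) [TopologicalSpace (TotalSpace ℂ L)]
  [∀ x, AddCommGroup (L x)] [∀ x, Module ℂ (L x)] [∀ x, TopologicalSpace (L x)]
  [FiberBundle ℂ L] [VectorBundle ℂ ℂ L]
  (E : X → Type*) [TopologicalSpace (TotalSpace ℂ E)]
  [∀ x, AddCommGroup (E x)] [∀ x, Module ℂ (E x)] [∀ x, TopologicalSpace (E x)]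
  [FiberBundle ℂ E] [VectorBundle ℂ ℂ E]

/-- The frames `s ⊗ t` of `L ⊗ E` over `U`. -/
def IsTensorFrame (U : Set X) (r : ∀ x, L x ⊗[ℂ] E x) : Prop :=
  ∃ (s : ∀ x, L x) (t : ∀ x, E x), IsHolFrame V L U s ∧ IsHolFrame V E U t ∧
    ∀ x, r x = s x ⊗ₜ[ℂ] t x

variable {V L E}

/-- The squared norm of the metric `h ⊗ k` on `L ⊗ E`.  The fibres being lines, each vector is of
the form `l ⊗ e`, and the value is `|l|² |e|²` for any such representation
(see `tensorNormSq_tmul`). -/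
def tensorNormSq (h : HermitianMetric V L) (k : HermitianMetric V E) (x : X)
    (v : L x ⊗[ℂ] E x) : ℝ :=
  sInf {r | ∃ (l : L x) (e : E x), v = l ⊗ₜ[ℂ] e ∧ r = h.normSq x l * k.normSq x e}

theorem tensorNormSq_tmul (h : HermitianMetric V L) (k : HermitianMetric V E) (x : X)
    (l : L x) (e : E x) : tensorNormSq h k x (l ⊗ₜ[ℂ] e) = h.normSq x l * k.normSq x e := by
  -- linear coordinates on the two lines
  have eL : L x ≃ₗ[ℂ] ℂ :=
    ((trivializationAt ℂ L x).continuousLinearEquivAt ℂ x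
      (FiberBundle.mem_baseSet_trivializationAt' x)).toLinearEquiv
  have eE : E x ≃ₗ[ℂ] ℂ :=
    ((trivializationAt ℂ E x).continuousLinearEquivAt ℂ x
      (FiberBundle.mem_baseSet_trivializationAt' x)).toLinearEquiv
  have hLval : ∀ l : L x, h.normSq x l = ‖eL l‖ ^ 2 * h.normSq x (eL.symm 1) := fun l => by
    rw [← h.normSq_smul, ← map_smul]; simp
  have hEval : ∀ e : E x, k.normSq x e = ‖eE e‖ ^ 2 * k.normSq x (eE.symm 1) := fun e => by
    rw [← k.normSq_smul, ← map_smul]; simp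
  have key : ∀ (l' : L x) (e' : E x), l ⊗ₜ[ℂ] e = l' ⊗ₜ[ℂ] e' →
      h.normSq x l' * k.normSq x e' = h.normSq x l * k.normSq x e := fun l' e' H => by
    have H2 : eL l * eE e = eL l' * eE e' := by
      have := congrArg (fun v => TensorProduct.lid ℂ ℂ (TensorProduct.congr eL eE v)) H
      simpa using this
    have H3 : ‖eL l‖ * ‖eE e‖ = ‖eL l'‖ * ‖eE e'‖ := by
      rw [← norm_mul, H2, norm_mul]
    rw [hLval l, hLval l', hEval e, hEval e']
    calc _ = (‖eL l'‖ * ‖eE e'‖) ^ 2 * (h.normSq x (eL.symm 1) * k.normSq x (eE.symm 1)) := by ring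
      _ = _ := by rw [← H3]; ring
  have : {r | ∃ (l' : L x) (e' : E x), l ⊗ₜ[ℂ] e = l' ⊗ₜ[ℂ] e' ∧
      r = h.normSq x l' * k.normSq x e'} = {h.normSq x l * k.normSq x e} := by
    ext r
    constructor
    · rintro ⟨l', e', H, rfl⟩
      exact key l' e' H
    · rintro rfl
      exact ⟨l, e, rfl, rfl⟩
  rw [tensorNormSq, this, csInf_singleton]

end Tensor

/-! ### Fibres of a submersion `p : X → Y`

`X` is modelled on `ℂᵐ × ℂⁿ` and `Y` on `ℂᵐ`.  The tangent space of `X_y = p⁻¹(y)` at `x` is the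
kernel of the differential of `p`. -/

section Fibre

variable {m n : ℕ}
  {X : Type*} [TopologicalSpace X] [ChartedSpace ((Fin m → ℂ) × (Fin n → ℂ)) X]
  {Y : Type*} [TopologicalSpace Y] [ChartedSpace (Fin m → ℂ) Y]

variable (m n) in
/-- The vertical tangent space at `x`, i.e. the tangent space at `x` of the fibre through `x`. -/
abbrev vertical (p : X → Y) (x : X) :
    Submodule ℂ (TangentSpace 𝓘(ℂ, (Fin m → ℂ) × (Fin n → ℂ)) x) :=
  LinearMap.ker (mfderiv 𝓘(ℂ, (Fin m → ℂ) × (Fin n → ℂ)) 𝓘(ℂ, Fin m → ℂ) p x).toLinearMap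

variable (m n) in
/-- A local holomorphic parametrization of the fibre `X_y` (the inverse of a holomorphic chart of
the `n`-dimensional complex manifold `X_y`): an injective holomorphic immersion of an open subset
of `ℂⁿ` into `X` with image in `X_y`. -/
structure FibrePatch (p : X → Y) (y : Y) where
  dom : Set (Fin n → ℂ)
  toFun : (Fin n → ℂ) → X
  isOpen_dom : IsOpen dom
  hol : ContMDiffOn 𝓘(ℂ, Fin n → ℂ) 𝓘(ℂ, (Fin m → ℂ) × (Fin n → ℂ)) ω toFun dom
  injOn : Set.InjOn toFun dom
  immersive : ∀ z ∈ dom, Function.Injective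
    (mfderiv 𝓘(ℂ, Fin n → ℂ) 𝓘(ℂ, (Fin m → ℂ) × (Fin n → ℂ)) toFun z)
  mem_fibre : ∀ z ∈ dom, p (toFun z) = y

/-- The coordinate vector field `∂/∂zᵢ` of a patch, as a tangent vector of `X`. -/
def FibrePatch.coordVec {p : X → Y} {y : Y} (γ : FibrePatch m n p y) (z : Fin n → ℂ) (i : Fin n) :
    TangentSpace 𝓘(ℂ, (Fin m → ℂ) × (Fin n → ℂ)) (γ.toFun z) :=
  mfderiv 𝓘(ℂ, Fin n → ℂ) 𝓘(ℂ, (Fin m → ℂ) × (Fin n → ℂ)) γ.toFun z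
    (Pi.single i 1 : Fin n → ℂ)

theorem FibrePatch.coordVec_mem {p : X → Y} {y : Y} (γ : FibrePatch m n p y) {z : Fin n → ℂ}
    (hz : z ∈ γ.dom) (i : Fin n) : γ.coordVec z i ∈ vertical m n p (γ.toFun z) := by
  rw [LinearMap.mem_ker]
  by_cases hp : MDifferentiableAt 𝓘(ℂ, (Fin m → ℂ) × (Fin n → ℂ)) 𝓘(ℂ, Fin m → ℂ) p (γ.toFun z)
  · have hγ : MDifferentiableAt 𝓘(ℂ, Fin n → ℂ) 𝓘(ℂ, (Fin m → ℂ) × (Fin n → ℂ)) γ.toFun z :=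
      ((γ.hol z hz).contMDiffAt (γ.isOpen_dom.mem_nhds hz)).mdifferentiableAt (by simp)
    have hconst : (p ∘ γ.toFun) =ᶠ[𝓝 z] fun _ => y :=
      Filter.eventually_of_mem (γ.isOpen_dom.mem_nhds hz) fun z' hz' => γ.mem_fibre z' hz'
    have h1 := mfderiv_comp z hp hγ
    rw [hconst.mfderiv_eq, mfderiv_const] at h1
    exact (DFunLike.congr_fun h1 (Pi.single i 1 : Fin n → ℂ)).symm
  · rw [mfderiv_zero_of_not_mdifferentiableAt hp]
    rfl

/-- A section over the fibre `X_y`, not necessarily holomorphic, of `K_{X_y} ⊗ M`: for every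
`x ∈ X_y` an alternating complex `n`-form on the tangent space of `X_y` at `x`, with values in
the line `M x`. -/
abbrev FibreForm (p : X → Y) (y : Y) (M : X → Type*) [∀ x, AddCommGroup (M x)]
    [∀ x, Module ℂ (M x)] :=
  ∀ x : p ⁻¹' {y}, vertical m n p (x : X) [⋀^Fin n]→ₗ[ℂ] M (x : X)

variable {p : X → Y} {y : Y} {M : X → Type*} [∀ x, AddCommGroup (M x)] [∀ x, Module ℂ (M x)]

open Classical in
/-- The coefficient `v` of `u = v dz₁ ∧ ⋯ ∧ dzₙ` in a patch: the value of `u` on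
`∂/∂z₁, …, ∂/∂zₙ` (and `0` outside the domain of the patch). -/
def FibrePatch.coeff (γ : FibrePatch m n p y) (u : FibreForm (m := m) (n := n) p y M)
    (z : Fin n → ℂ) : M (γ.toFun z) :=
  if hz : z ∈ γ.dom then
    u ⟨γ.toFun z, γ.mem_fibre z hz⟩ (fun i => ⟨γ.coordVec z i, γ.coordVec_mem hz i⟩)
  else 0

/-- `u` is a holomorphic section of `K_{X_y} ⊗ M` over `X_y`, where the holomorphic structure of
`M` is given by its local holomorphic frames `Fr`: for every patch and every frame `s`, one has
`u = f dz ⊗ s` with `f` holomorphic. -/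
def IsHolFibreForm (Fr : Set X → (∀ x, M x) → Prop) (u : FibreForm (m := m) (n := n) p y M) :
    Prop :=
  ∀ (γ : FibrePatch m n p y) (U : Set X) (s : ∀ x, M x), Fr U s →
    ∃ f : (Fin n → ℂ) → ℂ, DifferentiableOn ℂ f (γ.dom ∩ γ.toFun ⁻¹' U) ∧
      ∀ z ∈ γ.dom ∩ γ.toFun ⁻¹' U, γ.coeff u z = f z • s (γ.toFun z)

/-- The squared `L²` norm `∫_{X_y} |u|²` of a continuous section of `K_{X_y} ⊗ M`, for the
squared norm `q` on `M`.  In a patch, `|u|²` is the measure `|v|² dλ(z)` for `u = v dz`, where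
`λ` is Lebesgue measure; the integral over `X_y` is the supremum of the integrals over finite
disjoint unions of patches. -/
def fibreNormSq (q : ∀ x, M x → ℝ) (u : FibreForm (m := m) (n := n) p y M) : ℝ≥0∞ :=
  ⨆ (k : ℕ) (γ : Fin k → FibrePatch m n p y)
    (_ : Pairwise fun i j =>
      Disjoint ((γ i).toFun '' (γ i).dom) ((γ j).toFun '' (γ j).dom)),
    ∑ i, ∫⁻ z in (γ i).dom, ENNReal.ofReal (q ((γ i).toFun z) ((γ i).coeff u z))

variable (m n) in
/-- Holomorphic coordinates `(t, z)` on an open subset of `X` and `t` on an open subset of `Y` in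
which `p` is the projection `(t, z) ↦ t`. -/
structure AdaptedChart (p : X → Y) where
  top : OpenPartialHomeomorph X ((Fin m → ℂ) × (Fin n → ℂ))
  base : OpenPartialHomeomorph Y (Fin m → ℂ)
  top_mem : top ∈ IsManifold.maximalAtlas 𝓘(ℂ, (Fin m → ℂ) × (Fin n → ℂ)) ω X
  base_mem : base ∈ IsManifold.maximalAtlas 𝓘(ℂ, Fin m → ℂ) ω Y
  mapsTo : ∀ x ∈ top.source, p x ∈ base.source
  base_apply : ∀ x ∈ top.source, base (p x) = (top x).1

theorem AdaptedChart.slice_hol [IsManifold 𝓘(ℂ, (Fin m → ℂ) × (Fin n → ℂ)) ω X] {p : X → Y}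
    (c : AdaptedChart m n p) (t : Fin m → ℂ) :
    ContMDiffOn 𝓘(ℂ, Fin n → ℂ) 𝓘(ℂ, (Fin m → ℂ) × (Fin n → ℂ)) ω
      (fun z => c.top.symm (t, z)) {z | (t, z) ∈ c.top.target} := by
  have h : ContMDiff 𝓘(ℂ, Fin n → ℂ) 𝓘(ℂ, (Fin m → ℂ) × (Fin n → ℂ)) ω
      (fun z : Fin n → ℂ => (t, z)) :=
    (contDiff_prodMk_right t).contMDiff
  exact (contMDiffOn_symm_of_mem_maximalAtlas c.top_mem).comp h.contMDiffOn fun z hz => hz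

/-- In an adapted chart, `z ↦ (t, z)` is a patch of the fibre over `t`. -/
def AdaptedChart.slice [IsManifold 𝓘(ℂ, (Fin m → ℂ) × (Fin n → ℂ)) ω X]
    (c : AdaptedChart m n p) (t : Fin m → ℂ) :
    FibrePatch m n p (c.base.symm t) where
  dom := {z | (t, z) ∈ c.top.target}
  toFun z := c.top.symm (t, z)
  isOpen_dom := c.top.open_target.preimage (by fun_prop)
  hol := c.slice_hol t
  injOn z hz z' hz' h := by
    have h' := c.top.symm.injOn (show (t, z) ∈ c.top.symm.source from hz)
      (show (t, z') ∈ c.top.symm.source from hz') h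
    exact (Prod.ext_iff.1 h').2
  immersive z hz := by
    have hsymm := ((c.slice_hol t z hz).contMDiffAt
      ((c.top.open_target.preimage (by fun_prop)).mem_nhds hz)).mdifferentiableAt
      (by simp)
    have htop : MDifferentiableAt 𝓘(ℂ, (Fin m → ℂ) × (Fin n → ℂ))
        𝓘(ℂ, (Fin m → ℂ) × (Fin n → ℂ)) c.top (c.top.symm (t, z)) :=
      (contMDiffAt_of_mem_maximalAtlas c.top_mem (c.top.map_target hz)).mdifferentiableAt
        (by simp)
    have hcomp := mfderiv_comp z htop hsymm
    have heq : (c.top ∘ fun z => c.top.symm (t, z)) =ᶠ[𝓝 z] fun z => (t, z) :=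
      Filter.eventually_of_mem ((c.top.open_target.preimage (by fun_prop)).mem_nhds hz)
        fun z' hz' => c.top.right_inv hz'
    rw [heq.mfderiv_eq, mfderiv_eq_fderiv, (hasFDerivAt_prodMk_right t z).fderiv] at hcomp
    intro v v' hv
    have hv' := congrArg (mfderiv 𝓘(ℂ, (Fin m → ℂ) × (Fin n → ℂ))
        𝓘(ℂ, (Fin m → ℂ) × (Fin n → ℂ)) c.top (c.top.symm (t, z))) hv
    have hw := DFunLike.congr_fun hcomp v
    have hw' := DFunLike.congr_fun hcomp v'
    exact (Prod.ext_iff.1 (hw.trans (hv'.trans hw'.symm))).2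
  mem_fibre z hz := by
    have hx := c.top.map_target hz
    have h := c.base_apply _ hx
    rw [c.top.right_inv hz] at h
    change c.base (p (c.top.symm (t, z))) = t at h
    exact (c.base.left_inv (c.mapsTo _ hx)).symm.trans (congrArg c.base.symm h)

/-- The local weight `ψ` of the relative Bergman kernel metric on `K_{X/Y} ⊗ M`, in an adapted
chart and with respect to the frame `dz ⊗ s`:
`e^{ψ(t,z)} = sup {|v(z)|² : u ∈ H⁰(X_t, K_{X_t} ⊗ M), ‖u‖² ≤ 1, u = v dz ⊗ s}`.
The metric itself is given by `|dz ⊗ s|² = e^{-ψ}`. -/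
def bergmanWeight [IsManifold 𝓘(ℂ, (Fin m → ℂ) × (Fin n → ℂ)) ω X]
    (Fr : Set X → (∀ x, M x) → Prop) (q : ∀ x, M x → ℝ) (c : AdaptedChart m n p)
    (s : ∀ x, M x) (w : (Fin m → ℂ) × (Fin n → ℂ)) : EReal :=
  ENNReal.log (sSup {b : ℝ≥0∞ | ∃ u : FibreForm (m := m) (n := n) p (c.base.symm w.1) M,
    IsHolFibreForm Fr u ∧ fibreNormSq q u ≤ 1 ∧
    ∃ a : ℂ, (c.slice w.1).coeff u w.2 = a • s (c.top.symm w) ∧ b = ‖a‖ₑ ^ 2})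

variable (m n) in
/-- The relative Bergman kernel metric on `K_{X/Y} ⊗ M` has semi-positive curvature: all its local
weights are plurisubharmonic. -/
def BergmanSemipositive [IsManifold 𝓘(ℂ, (Fin m → ℂ) × (Fin n → ℂ)) ω X] (p : X → Y)
    (Fr : Set X → (∀ x, M x) → Prop) (q : ∀ x, M x → ℝ) : Prop :=
  ∀ (c : AdaptedChart m n p) (U : Set X) (s : ∀ x, M x), Fr U s →
    IsPSHOn (bergmanWeight Fr q c s) (c.top.target ∩ c.top.symm ⁻¹' U)

variable (m n) in
/-- The relative Bergman kernel metric on `K_{X/Y} ⊗ M` is identically `+∞`: all its local weights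
are identically `-∞`. -/
def BergmanIdenticallyTop [IsManifold 𝓘(ℂ, (Fin m → ℂ) × (Fin n → ℂ)) ω X] (p : X → Y)
    (Fr : Set X → (∀ x, M x) → Prop) (q : ∀ x, M x → ℝ) : Prop :=
  ∀ (c : AdaptedChart m n p) (U : Set X) (s : ∀ x, M x), Fr U s →
    ∀ w ∈ c.top.target ∩ c.top.symm ⁻¹' U, bergmanWeight Fr q c s w = ⊥

end Fibre

end

/-! Argue by contradiction. If `hL` is not semi-positive, the Levi form of its local weight `φ` is
negative at some point `a` of an adapted chart in some direction `b`. Negativity is an open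
condition, so `b` may be taken non-vertical and `a` generic. The average of `φ` over a small circle
in the complex line `a + ℂ b` is then strictly less than `φ a`. The twists by `E` serve to recover
`φ` along this line from Bergman kernels, by making the weight of `E` concentrate on it.

Take `E = A^(k₀ k)` with the metric `h_A^(k₀ k) e^(-kχ)`. A logarithmic well followed by a
regularized maximum gives a `χ` for which the metric stays semi-positive, while its weight in the
frame `s^(k₀ k)`, for the given section `s` of `A`, is exactly `k (m₀ + Q)` near `a`
(`exists_local_modification`, `HermitianMetric.exists_powMetric_modification`). Here `Q` is the
square of a seminorm of `w - a` that vanishes on `a + ℂ b`. On the vertical slice through any point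
of this line it is the same positive definite form, centred at that point, so one Gaussian mass `I`
serves for all the slices.

Let `ψ` be the Bergman weight and `η > 0` small. The mean value property alone gives `ψ ≤ φ + k m₀ -
log I + η` on the circle (`bergmanWeight_le`). At `a`, a section of `K ⊗ L` over the fibre that does
not vanish there, multiplied by `s^(k₀ k)`, is a competitor, and for large `k` it gives `ψ ≥ φ + k
m₀ - log I - 2η` (`fibreNormSq_tensor_le`, `exists_exp_mul_le_gaussMass`). No extension theorem is
needed, since the competitor lives on a single fibre. The lower bound rules out `ψ = -∞`, and the
sub-mean value inequality for `ψ` passes to `φ` up to `3η`, a contradiction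
(`leviForm_weight_nonneg_of_bergman`).

That a fibre section exists at generic points is itself a consequence of the Bergman hypothesis, for
the trivial bundle `A^0`: the set where the weight is `-∞` is the set without such sections, and for
a plurisubharmonic function on a connected manifold its interior is empty or everything
(`interior_not_hasFibreSection`). -/

noncomputable section

set_option linter.unusedSectionVars false

/-! ### Calculus of the Levi form -/

section LeviCalculus

variable {V : Type*} [NormedAddCommGroup V] [NormedSpace ℂ V]
  {W : Type*} [NormedAddCommGroup W] [NormedSpace ℂ W]

/-- The squared modulus `|∂f(v)|²` of the `(1,0)`-differential of a real function. -/
def leviGradSq (f : V → ℝ) (a v : V) : ℝ :=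
  (fderiv ℝ f a v ^ 2 + fderiv ℝ f a (Complex.I • v) ^ 2) / 4

theorem leviGradSq_nonneg (f : V → ℝ) (a v : V) : 0 ≤ leviGradSq f a v := by
  unfold leviGradSq; positivity

theorem ContDiffAt.differentiableAt_fderiv_two {f : V → ℝ} {a : V} (hf : ContDiffAt ℝ 2 f a) :
    DifferentiableAt ℝ (fderiv ℝ f) a :=
  (hf.fderiv_right (m := 1) (by norm_num)).differentiableAt (by norm_num)

theorem ContDiffAt.eventually_differentiableAt_two {f : V → ℝ} {a : V}
    (hf : ContDiffAt ℝ 2 f a) : ∀ᶠ x in 𝓝 a, DifferentiableAt ℝ f x := by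
  filter_upwards [hf.eventually (by norm_num)] with x hx
  exact hx.differentiableAt (by norm_num)

theorem Filter.EventuallyEq.leviForm_eq {f g : V → ℝ} {a : V} (h : f =ᶠ[𝓝 a] g) (v : V) :
    leviForm f a v = leviForm g a v := by
  unfold leviForm
  rw [h.fderiv.fderiv_eq]

theorem leviForm_const (r : ℝ) (a v : V) : leviForm (fun _ : V => r) a v = 0 := by
  unfold leviForm
  simp

theorem leviForm_add {f g : V → ℝ} {a : V} (hf : ContDiffAt ℝ 2 f a) (hg : ContDiffAt ℝ 2 g a)
    (v : V) : leviForm (fun x => f x + g x) a v = leviForm f a v + leviForm g a v := by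
  have h : fderiv ℝ (fun x => f x + g x) =ᶠ[𝓝 a] fun x => fderiv ℝ f x + fderiv ℝ g x := by
    filter_upwards [hf.eventually_differentiableAt_two, hg.eventually_differentiableAt_two]
      with x hx hx'
    exact fderiv_fun_add hx hx'
  unfold leviForm
  rw [h.fderiv_eq, fderiv_fun_add hf.differentiableAt_fderiv_two hg.differentiableAt_fderiv_two]
  simp only [add_apply]
  ring

theorem leviForm_const_mul {f : V → ℝ} {a : V} (hf : ContDiffAt ℝ 2 f a) (r : ℝ)
    (v : V) : leviForm (fun x => r * f x) a v = r * leviForm f a v := by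
  have h : fderiv ℝ (fun x => r * f x) =ᶠ[𝓝 a] fun x => r • fderiv ℝ f x := by
    filter_upwards [hf.eventually_differentiableAt_two] with x hx
    exact fderiv_const_mul hx r
  unfold leviForm
  rw [h.fderiv_eq, fderiv_fun_const_smul hf.differentiableAt_fderiv_two]
  simp only [smul_apply, smul_eq_mul]
  ring

/-- The chain rule for `i∂∂̄`: the second derivative of `F` multiplies `i∂f ∧ ∂̄f`, whose value on
`v` is `leviGradSq`. -/
theorem leviForm_comp_real {F : ℝ → ℝ} {f : V → ℝ} {a : V} (hF : ContDiffAt ℝ 2 F (f a))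
    (hf : ContDiffAt ℝ 2 f a) (v : V) :
    leviForm (fun x => F (f x)) a v =
      deriv F (f a) * leviForm f a v + deriv (deriv F) (f a) * leviGradSq f a v := by
  have h : fderiv ℝ (fun x => F (f x)) =ᶠ[𝓝 a] fun x => deriv F (f x) • fderiv ℝ f x := by
    have hF' : ∀ᶠ x in 𝓝 a, DifferentiableAt ℝ F (f x) :=
      hf.continuousAt.eventually <| by
        filter_upwards [hF.eventually (by norm_num)] with t ht
        exact ht.differentiableAt (by norm_num)
    filter_upwards [hf.eventually_differentiableAt_two, hF'] with x hx hx'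
    exact (hx'.hasDerivAt.comp_hasFDerivAt x hx.hasFDerivAt).fderiv
  have hF2 : DifferentiableAt ℝ (deriv F) (f a) :=
    ((hF.fderiv_right (m := 1) (by norm_num)).differentiableAt (by norm_num)).clm_apply
      (differentiableAt_const 1)
  have h2 := (hF2.hasDerivAt.comp_hasFDerivAt a
    (hf.differentiableAt (by norm_num)).hasFDerivAt).smul hf.differentiableAt_fderiv_two.hasFDerivAt
  unfold leviForm leviGradSq
  rw [h.fderiv_eq]
  erw [h2.fderiv]
  simp
  ring

/-- The extra term `Df(D²H(v, v) + D²H(iv, iv))` cancels because `D²H` is complex bilinear. This is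
why the Levi form has a meaning on complex manifolds. -/
theorem leviForm_comp_hol {f : W → ℝ} {H : V → W} {a : V} (hf : ContDiffAt ℝ 2 f (H a))
    (hH : ContDiffAt ℂ 2 H a) (v : V) :
    leviForm (fun x => f (H x)) a v = leviForm f (H a) (fderiv ℂ H a v) := by
  have hHd : ∀ᶠ x in 𝓝 a, DifferentiableAt ℂ H x := by
    filter_upwards [hH.eventually (by norm_num)] with x hx
    exact hx.differentiableAt (by norm_num)
  have h : fderiv ℝ (fun x => f (H x)) =ᶠ[𝓝 a]
      fun x => (fderiv ℝ f (H x)).comp ((fderiv ℂ H x).restrictScalars ℝ) := by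
    filter_upwards [hH.continuousAt.eventually hf.eventually_differentiableAt_two, hHd]
      with x hx hx'
    exact (hx.hasFDerivAt.comp x (hx'.hasFDerivAt.restrictScalars ℝ)).fderiv
  have hD : DifferentiableAt ℂ (fderiv ℂ H) a :=
    (hH.fderiv_right (m := 1) (by norm_num)).differentiableAt (by norm_num)
  have h1 : HasFDerivAt (fun x => fderiv ℝ f (H x))
      ((fderiv ℝ (fderiv ℝ f) (H a)).comp ((fderiv ℂ H a).restrictScalars ℝ)) a :=
    hf.differentiableAt_fderiv_two.hasFDerivAt.comp a
      ((hH.differentiableAt (by norm_num)).hasFDerivAt.restrictScalars ℝ)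
  have h2 : HasFDerivAt (fun x => (fderiv ℂ H x).restrictScalars ℝ)
      ((ContinuousLinearMap.restrictScalarsL ℂ V W ℝ ℝ).comp
        ((fderiv ℂ (fderiv ℂ H) a).restrictScalars ℝ)) a :=
    (ContinuousLinearMap.restrictScalarsL ℂ V W ℝ ℝ).hasFDerivAt.comp a
      (hD.hasFDerivAt.restrictScalars ℝ)
  unfold leviForm
  rw [h.fderiv_eq, (h1.clm_comp h2).fderiv]
  simp [smul_smul]
  ring

theorem leviForm_re (a v : ℂ) : leviForm (fun z : ℂ => z.re) a v = 0 := by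
  have h : fderiv ℝ (fun z : ℂ => z.re) = fun _ => Complex.reCLM := by
    funext x
    exact Complex.reCLM.hasFDerivAt.fderiv
  unfold leviForm
  rw [h]
  simp

theorem leviForm_re_hol {H : V → ℂ} {a : V} (hH : ContDiffAt ℂ 2 H a) (v : V) :
    leviForm (fun x => (H x).re) a v = 0 := by
  rw [leviForm_comp_hol (f := fun z : ℂ => z.re) Complex.reCLM.contDiff.contDiffAt hH, leviForm_re]

theorem leviForm_log_norm_sq {H : V → ℂ} {a : V} (hH : ContDiffAt ℂ 2 H a) (h0 : H a ≠ 0)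
    (v : V) : leviForm (fun x => Real.log (‖H x‖ ^ 2)) a v = 0 := by
  -- Division by `H a` moves the value at `a` to `1`, where the principal logarithm is holomorphic;
  -- `log ‖H‖²` is then a constant plus the real part of a holomorphic function.
  have hc : ContDiffAt ℂ 2 (fun x => H x / H a) a := hH.div_const _
  have h1 : H a / H a ∈ Complex.slitPlane := by
    rw [div_self h0]; exact Complex.one_mem_slitPlane
  have hl : ContDiffAt ℂ 2 (fun x => Complex.log (H x / H a)) a :=
    ContDiffAt.comp (g := Complex.log) (f := fun x => H x / H a) a (Complex.contDiffAt_log h1) hc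
  have he : (fun x => Real.log (‖H x‖ ^ 2)) =ᶠ[𝓝 a]
      fun x => 2 * (Complex.log (H x / H a)).re + Real.log (‖H a‖ ^ 2) := by
    filter_upwards [hH.continuousAt.eventually_ne h0] with x hx
    rw [Complex.log_re, norm_div, Real.log_div (norm_ne_zero_iff.2 hx) (norm_ne_zero_iff.2 h0),
      Real.log_pow, Real.log_pow]
    push_cast; ring
  have hre : ContDiffAt ℝ 2 (fun x => (Complex.log (H x / H a)).re) a :=
    Complex.reCLM.contDiff.contDiffAt.comp a (hl.restrict_scalars ℝ)
  rw [he.leviForm_eq, leviForm_add (contDiffAt_const.mul hre) contDiffAt_const, leviForm_const,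
    leviForm_const_mul hre, leviForm_re_hol hl]
  simp

variable {E : Type*} [NormedAddCommGroup E] [InnerProductSpace ℂ E]

theorem hasFDerivAt_norm_sq_complex (x : E) :
    HasFDerivAt (fun w : E => ‖w‖ ^ 2)
      ((2 : ℝ) • Complex.reCLM.comp ((innerSL ℂ x).restrictScalars ℝ)) x := by
  let _ : InnerProductSpace ℝ E := InnerProductSpace.rclikeToReal ℂ E
  convert (hasFDerivAt_id x).norm_sq using 1
  · rfl
  · ext v
    simp [real_inner_eq_re_inner ℂ]

theorem fderiv_norm_sq_complex (x v : E) :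
    fderiv ℝ (fun w : E => ‖w‖ ^ 2) x v = 2 * (inner ℂ x v).re := by
  rw [(hasFDerivAt_norm_sq_complex x).fderiv]
  simp

theorem leviForm_norm_sq (x v : E) : leviForm (fun w : E => ‖w‖ ^ 2) x v = ‖v‖ ^ 2 := by
  have hd : DifferentiableAt ℝ (fderiv ℝ (fun w : E => ‖w‖ ^ 2)) x :=
    ContDiffAt.differentiableAt_fderiv_two (contDiff_norm_sq ℂ).contDiffAt
  have key : ∀ v : E, fderiv ℝ (fderiv ℝ (fun w : E => ‖w‖ ^ 2)) x v v = 2 * ‖v‖ ^ 2 := by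
    intro v
    have h1 : HasFDerivAt (fun y => fderiv ℝ (fun w : E => ‖w‖ ^ 2) y v)
        ((fderiv ℝ (fderiv ℝ (fun w : E => ‖w‖ ^ 2)) x).flip v) x := by
      simpa using hd.hasFDerivAt.clm_apply (hasFDerivAt_const v x)
    -- For fixed `v` the first derivative is a real linear function of the point, hence its own
    -- derivative.
    have h2 : (fun y => fderiv ℝ (fun w : E => ‖w‖ ^ 2) y v) =
        ((2 : ℝ) • Complex.reCLM.comp ((innerSL ℂ v).restrictScalars ℝ) : E →L[ℝ] ℝ) := by
      funext y
      rw [fderiv_norm_sq_complex]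
      simpa using inner_re_symm (𝕜 := ℂ) y v
    rw [h2] at h1
    have h3 := (ContinuousLinearMap.hasFDerivAt _).unique h1
    have h4 := DFunLike.congr_fun h3 v
    simp only [ContinuousLinearMap.flip_apply] at h4
    rw [← h4]
    have := inner_self_eq_norm_sq (𝕜 := ℂ) v
    simp at this
    simp [this]
  unfold leviForm
  rw [key, key, norm_smul]
  simp
  ring

/-- The left side is `|⟨x, v⟩|²`, so this is Cauchy–Schwarz. It makes `log (‖x‖² + ε)`
plurisubharmonic. -/
theorem leviGradSq_norm_sq_le (x v : E) :
    leviGradSq (fun w : E => ‖w‖ ^ 2) x v ≤ ‖x‖ ^ 2 * ‖v‖ ^ 2 := by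
  have h : leviGradSq (fun w : E => ‖w‖ ^ 2) x v = ‖inner ℂ x v‖ ^ 2 := by
    unfold leviGradSq
    rw [fderiv_norm_sq_complex, fderiv_norm_sq_complex, inner_smul_right,
      ← Complex.normSq_eq_norm_sq,
      Complex.normSq_apply]
    simp
    ring
  rw [h, ← mul_pow]
  exact pow_le_pow_left₀ (norm_nonneg _) (norm_inner_le_norm x v) 2

theorem leviGradSq_comp_hol {f : W → ℝ} {H : V → W} {a : V} (hf : DifferentiableAt ℝ f (H a))
    (hH : DifferentiableAt ℂ H a) (v : V) :
    leviGradSq (fun x => f (H x)) a v = leviGradSq f (H a) (fderiv ℂ H a v) := by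
  have h : fderiv ℝ (fun x => f (H x)) a =
      (fderiv ℝ f (H a)).comp ((fderiv ℂ H a).restrictScalars ℝ) :=
    (hf.hasFDerivAt.comp a (hH.hasFDerivAt.restrictScalars ℝ)).fderiv
  unfold leviGradSq
  rw [h]
  simp

theorem contDiff_norm_sq_clm (T : V →L[ℂ] E) (b : V) {k : ℕ∞} :
    ContDiff ℝ k (fun w => ‖T (w - b)‖ ^ 2) :=
  (contDiff_norm_sq ℂ).comp
    ((T.restrictScalars ℝ).contDiff.comp (contDiff_id.sub contDiff_const))

theorem fderiv_clm_sub (T : V →L[ℂ] E) (b x : V) : fderiv ℂ (fun w => T (w - b)) x = T :=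
  (T.hasFDerivAt.comp x ((hasFDerivAt_id x).sub_const b)).fderiv

theorem contDiff_clm_sub (T : V →L[ℂ] E) (b : V) {k : WithTop ℕ∞} :
    ContDiff ℂ k (fun w => T (w - b)) :=
  T.contDiff.comp (contDiff_id.sub contDiff_const)

theorem leviForm_norm_sq_clm (T : V →L[ℂ] E) (b x v : V) :
    leviForm (fun w => ‖T (w - b)‖ ^ 2) x v = ‖T v‖ ^ 2 := by
  rw [leviForm_comp_hol (f := fun z : E => ‖z‖ ^ 2) (H := fun w => T (w - b))
    (contDiff_norm_sq ℂ).contDiffAt (contDiff_clm_sub T b).contDiffAt, leviForm_norm_sq,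
    fderiv_clm_sub]

theorem leviGradSq_norm_sq_clm_le (T : V →L[ℂ] E) (b x v : V) :
    leviGradSq (fun w => ‖T (w - b)‖ ^ 2) x v ≤ ‖T (x - b)‖ ^ 2 * ‖T v‖ ^ 2 := by
  rw [leviGradSq_comp_hol (f := fun z : E => ‖z‖ ^ 2) (H := fun w => T (w - b))
    ((contDiff_norm_sq (n := 1) ℂ).contDiffAt.differentiableAt (by norm_num))
    ((contDiff_clm_sub (k := 1) T b).contDiffAt.differentiableAt (by norm_num)), fderiv_clm_sub]
  exact leviGradSq_norm_sq_le _ _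

end LeviCalculus

/-! ### A smooth convex substitute for the positive part -/

section SoftPlus

/-- A smooth convex function on `ℝ` which vanishes for `t ≤ 0` and is equal to
`t - softPlusGap` for `t ≥ 1`. -/
def softPlus (t : ℝ) : ℝ := ∫ x in (0 : ℝ)..t, Real.smoothTransition x

/-- The difference `t - softPlus t` for `t ≥ 1`. -/
def softPlusGap : ℝ := 1 - softPlus 1

theorem hasDerivAt_softPlus (t : ℝ) : HasDerivAt softPlus (Real.smoothTransition t) t :=
  intervalIntegral.integral_hasDerivAt_right
    (Real.smoothTransition.continuous.intervalIntegrable _ _)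
    (Real.smoothTransition.continuous.stronglyMeasurableAtFilter _ _)
    Real.smoothTransition.continuous.continuousAt

theorem deriv_softPlus : deriv softPlus = Real.smoothTransition :=
  funext fun t => (hasDerivAt_softPlus t).deriv

theorem contDiff_softPlus : ContDiff ℝ ∞ softPlus := by
  rw [contDiff_infty_iff_deriv, deriv_softPlus]
  exact ⟨fun t => (hasDerivAt_softPlus t).differentiableAt, Real.smoothTransition.contDiff⟩

theorem monotone_softPlus : Monotone softPlus :=
  monotone_of_deriv_nonneg (fun t => (hasDerivAt_softPlus t).differentiableAt)
    fun t => by rw [deriv_softPlus]; exact Real.smoothTransition.nonneg t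

theorem antitone_softPlus_sub : Antitone fun t => softPlus t - t :=
  antitone_of_deriv_nonpos
    (fun t => ((hasDerivAt_softPlus t).fun_sub (hasDerivAt_id' t)).differentiableAt)
    fun t => by
      have := ((hasDerivAt_softPlus t).fun_sub (hasDerivAt_id' t)).deriv
      rw [this]
      linarith [Real.smoothTransition.le_one t]

theorem softPlus_of_nonpos {t : ℝ} (ht : t ≤ 0) : softPlus t = 0 := by
  unfold softPlus
  rw [intervalIntegral.integral_congr (g := fun _ => (0 : ℝ))]
  · simp
  · intro x hx
    rw [Set.uIcc_of_ge ht] at hx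
    exact Real.smoothTransition.zero_of_nonpos hx.2

theorem softPlus_nonneg (t : ℝ) : 0 ≤ softPlus t := by
  rcases le_total t 0 with h | h
  · rw [softPlus_of_nonpos h]
  · rw [← softPlus_of_nonpos le_rfl]
    exact monotone_softPlus h

theorem softPlus_of_one_le {t : ℝ} (ht : 1 ≤ t) : softPlus t = t - softPlusGap := by
  have h : softPlus t = softPlus 1 + ∫ x in (1 : ℝ)..t, Real.smoothTransition x :=
    (intervalIntegral.integral_add_adjacent_intervals
      (Real.smoothTransition.continuous.intervalIntegrable _ _)
      (Real.smoothTransition.continuous.intervalIntegrable _ _)).symm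
  have h2 : ∫ x in (1 : ℝ)..t, Real.smoothTransition x = t - 1 := by
    rw [intervalIntegral.integral_congr (g := fun _ => (1 : ℝ))]
    · simp
    · intro x hx
      rw [Set.uIcc_of_le ht] at hx
      exact Real.smoothTransition.one_of_one_le hx.1
  rw [h, h2, softPlusGap]
  ring

/-- The function `softPlus t - t` is antitone and constant, equal to `-softPlusGap`, from `t = 1`
on. -/
theorem sub_gap_le_softPlus (t : ℝ) : t - softPlusGap ≤ softPlus t := by
  rcases le_total t 1 with h | h
  · have := antitone_softPlus_sub h
    simp only at this
    unfold softPlusGap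
    linarith
  · exact (softPlus_of_one_le h).ge

theorem softPlusGap_nonneg : 0 ≤ softPlusGap := by
  have := antitone_softPlus_sub (zero_le_one (α := ℝ))
  simp only [softPlus_of_nonpos le_rfl] at this
  unfold softPlusGap
  linarith

theorem softPlusGap_le_one : softPlusGap ≤ 1 := by
  have := softPlus_nonneg 1
  unfold softPlusGap
  linarith

theorem deriv_smoothTransition_nonneg (t : ℝ) : 0 ≤ deriv Real.smoothTransition t :=
  Real.smoothTransition.monotone.deriv_nonneg

/-- The transition is constant on both sides of `[0, 1]`, and its derivative is continuous on this
compact interval. The localization matters as much as the bound: it confines the curvature lost by a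
logarithmic well. -/
theorem exists_deriv_smoothTransition_le :
    ∃ C : ℝ, 0 ≤ C ∧ ∀ t, deriv Real.smoothTransition t ≤ C ∧
      ((t < 0 ∨ 1 < t) → deriv Real.smoothTransition t = 0) := by
  have hc : Continuous (deriv Real.smoothTransition) :=
    (Real.smoothTransition.contDiff (n := 1)).continuous_deriv (by norm_num)
  obtain ⟨C, hC⟩ := (isCompact_Icc (a := (0 : ℝ)) (b := 1)).bddAbove_image hc.continuousOn
  have h0 : ∀ t : ℝ, t < 0 ∨ 1 < t → deriv Real.smoothTransition t = 0 := by
    rintro t (ht | ht)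
    · have : Real.smoothTransition =ᶠ[𝓝 t] fun _ => 0 := by
        filter_upwards [gt_mem_nhds ht] with x hx
        exact Real.smoothTransition.zero_of_nonpos hx.le
      rw [this.deriv_eq, deriv_const]
    · have : Real.smoothTransition =ᶠ[𝓝 t] fun _ => 1 := by
        filter_upwards [lt_mem_nhds ht] with x hx
        exact Real.smoothTransition.one_of_one_le hx.le
      rw [this.deriv_eq, deriv_const]
  refine ⟨max C 0, le_max_right _ _, fun t => ⟨?_, h0 t⟩⟩
  by_cases ht : t < 0 ∨ 1 < t
  · rw [h0 t ht]; exact le_max_right _ _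
  · push Not at ht
    exact (hC ⟨t, ht, rfl⟩).trans (le_max_left _ _)

end SoftPlus

/-! ### Regularized maxima and logarithmic wells -/

section RegMax

variable {V : Type*} [NormedAddCommGroup V] [NormedSpace ℂ V]

/-- The function is a regularized maximum of `f` and `g`. With `θ` the derivative of `softPlus` at
`g - f`, its Levi form is `(1 - θ)` times that of `f` plus `θ` times that of `g`, plus a nonnegative
multiple of `|∂(g - f)|²`, and `0 ≤ θ ≤ 1`. -/
theorem leviForm_softPlus_max_nonneg {f g : V → ℝ} {a v : V} (hf : ContDiffAt ℝ 2 f a)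
    (hg : ContDiffAt ℝ 2 g a) (hf0 : 0 ≤ leviForm f a v) (hg0 : 0 ≤ leviForm g a v) :
    0 ≤ leviForm (fun x => f x + softPlus (g x - f x)) a v := by
  have hρ : ContDiff ℝ 2 softPlus := contDiff_infty.1 contDiff_softPlus 2
  have hd : ContDiffAt ℝ 2 (fun x => g x - f x) a := hg.sub hf
  have hd' : leviForm (fun x => g x - f x) a v = leviForm g a v - leviForm f a v := by
    have := leviForm_add hg (contDiffAt_const.mul hf : ContDiffAt ℝ 2 (fun x => (-1) * f x) a) v
    rw [leviForm_const_mul hf] at this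
    simpa [sub_eq_add_neg] using this
  rw [leviForm_add (g := fun x => softPlus (g x - f x)) hf (hρ.contDiffAt.comp a hd),
    leviForm_comp_real (F := softPlus) hρ.contDiffAt hd, hd', deriv_softPlus]
  have h1 := Real.smoothTransition.nonneg (g a - f a)
  have h2 := Real.smoothTransition.le_one (g a - f a)
  have h3 := mul_nonneg (deriv_smoothTransition_nonneg (g a - f a))
    (leviGradSq_nonneg (fun x => g x - f x) a v)
  nlinarith [mul_nonneg h1 hg0, mul_nonneg (sub_nonneg.2 h2) hf0]

variable {E : Type*} [NormedAddCommGroup E] [InnerProductSpace ℂ E]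

/-- A smooth well centred at `a`, supported in `{‖T (x - a)‖² ≤ σ}` and of depth about
`log (σ / ε)`. -/
def logWell (T : V →L[ℂ] E) (a : V) (σ ε : ℝ) (x : V) : ℝ :=
  -softPlus (-Real.log ((‖T (x - a)‖ ^ 2 + ε) / σ))

theorem logWell_eq_zero {T : V →L[ℂ] E} {a : V} {σ ε : ℝ} (hσ : 0 < σ) (hε : 0 < ε) {x : V}
    (hx : σ ≤ ‖T (x - a)‖ ^ 2) : logWell T a σ ε x = 0 := by
  unfold logWell
  rw [softPlus_of_nonpos, neg_zero]
  rw [neg_nonpos]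
  apply Real.log_nonneg
  rw [le_div_iff₀ hσ]
  linarith

theorem logWell_center_le (T : V →L[ℂ] E) (a : V) (σ ε : ℝ) :
    logWell T a σ ε a ≤ Real.log (ε / σ) + 1 := by
  unfold logWell
  have := sub_gap_le_softPlus (-Real.log ((‖T (a - a)‖ ^ 2 + ε) / σ))
  simp only [sub_self, map_zero, norm_zero] at this ⊢
  norm_num at this ⊢
  linarith [softPlusGap_le_one]

theorem contDiff_logWell (T : V →L[ℂ] E) (a : V) {σ ε : ℝ} (hσ : 0 < σ) (hε : 0 < ε) :
    ContDiff ℝ ∞ (logWell T a σ ε) := by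
  refine (contDiff_softPlus.comp (ContDiff.log ?_ ?_).neg).neg
  · exact ((contDiff_norm_sq_clm T a).add contDiff_const).div_const _
  · intro x
    positivity

/-- The well is `G ∘ u` with `u = log ((‖T(x - a)‖² + ε) / σ)` plurisubharmonic and `G` increasing
and concave. Only `G'' |∂u|²` is negative, and `G''` vanishes where `u < -1`. Elsewhere `‖T(x - a)‖²
+ ε ≥ σ / e`, so that `|∂u|² ≤ e ‖T v‖² / σ`. The bound does not involve `ε`: a well can be deepened
at no further cost in curvature. -/
theorem exists_neg_le_leviForm_logWell :
    ∃ C : ℝ, 0 ≤ C ∧ ∀ (T : V →L[ℂ] E) (a : V) (σ ε : ℝ), 0 < σ → 0 < ε → ∀ x v : V,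
      -(C / σ * ‖T v‖ ^ 2) ≤ leviForm (logWell T a σ ε) x v := by
  obtain ⟨C, hC0, hC⟩ := exists_deriv_smoothTransition_le
  refine ⟨C * Real.exp 1, by positivity, fun T a σ ε hσ hε x v => ?_⟩
  set N : V → ℝ := fun w => ‖T (w - a)‖ ^ 2 with hN
  have hNx : 0 ≤ N x := by positivity
  have hpos : 0 < N x + ε := by positivity
  have hNc : ContDiff ℝ 2 N := contDiff_norm_sq_clm T a
  -- the logarithm
  set u : V → ℝ := fun w => Real.log ((N w + ε) / σ) with hu
  have hF : ContDiffAt ℝ 2 (fun t => Real.log ((t + ε) / σ)) (N x) :=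
    ContDiffAt.log ((contDiffAt_fun_id.add contDiffAt_const).div_const _) (by positivity)
  have hF1 : ∀ t : ℝ, 0 < t + ε → HasDerivAt (fun t => Real.log ((t + ε) / σ)) ((t + ε)⁻¹) t := by
    intro t ht
    have := (((hasDerivAt_id' t).add_const ε).div_const σ).log (by positivity)
    convert this using 1
    field_simp
  have hF2 : deriv (deriv fun t => Real.log ((t + ε) / σ)) (N x) = -((N x + ε) ^ 2)⁻¹ := by
    have he : deriv (fun t => Real.log ((t + ε) / σ)) =ᶠ[𝓝 (N x)] fun t => (t + ε)⁻¹ := by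
      filter_upwards [lt_mem_nhds (show -ε < N x by linarith)] with t ht
      exact (hF1 t (by linarith)).deriv
    rw [he.deriv_eq]
    have := ((hasDerivAt_id' (N x)).add_const ε).fun_inv (by positivity)
    rw [this.deriv]
    field_simp
  have huc : ContDiffAt ℝ 2 u x := hF.comp x hNc.contDiffAt
  have hgN : leviGradSq N x v ≤ N x * ‖T v‖ ^ 2 := leviGradSq_norm_sq_clm_le T a x v
  have hLu : 0 ≤ leviForm u x v := by
    rw [hu, leviForm_comp_real (f := N) hF hNc.contDiffAt, (hF1 _ hpos).deriv, hF2,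
      leviForm_norm_sq_clm]
    have : (N x + ε)⁻¹ * ‖T v‖ ^ 2 + -((N x + ε) ^ 2)⁻¹ * leviGradSq N x v =
        ((N x + ε) * ‖T v‖ ^ 2 - leviGradSq N x v) / (N x + ε) ^ 2 := by
      field_simp
      ring
    rw [this]
    apply div_nonneg _ (by positivity)
    nlinarith [sq_nonneg ‖T v‖]
  have hgu : leviGradSq u x v ≤ ‖T v‖ ^ 2 / (N x + ε) := by
    have hfd : fderiv ℝ u x = (N x + ε)⁻¹ • fderiv ℝ N x :=
      ((hF1 _ hpos).comp_hasFDerivAt x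
        (hNc.contDiffAt.differentiableAt (by norm_num)).hasFDerivAt).fderiv
    have : leviGradSq u x v = leviGradSq N x v / (N x + ε) ^ 2 := by
      unfold leviGradSq
      rw [hfd]
      simp only [smul_apply, smul_eq_mul]
      field_simp
    rw [this, div_le_div_iff₀ (by positivity) hpos]
    have : leviGradSq N x v ≤ (N x + ε) * ‖T v‖ ^ 2 := by nlinarith [sq_nonneg ‖T v‖]
    nlinarith
  -- the cut-off
  have hG : ContDiff ℝ 2 fun t => -softPlus (-t) :=
    ((contDiff_infty.1 contDiff_softPlus 2).comp contDiff_neg).neg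
  have hG1 : deriv (fun t => -softPlus (-t)) = fun t => Real.smoothTransition (-t) := by
    funext t
    have := (HasDerivAt.scomp (h := fun t => -t) t (hasDerivAt_softPlus (-t))
      (hasDerivAt_neg t)).neg.deriv
    simp only [smul_eq_mul, neg_mul, one_mul, neg_neg] at this
    exact this
  have hG2 : deriv (fun t => Real.smoothTransition (-t)) (u x) =
      -deriv Real.smoothTransition (-u x) := by
    rw [deriv_comp_neg]
  have := leviForm_comp_real (F := fun t => -softPlus (-t)) (f := u) hG.contDiffAt huc v
  change _ ≤ leviForm (fun w => -softPlus (-u w)) x v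
  rw [this, hG1, hG2]
  have h1 : 0 ≤ Real.smoothTransition (-u x) * leviForm u x v :=
    mul_nonneg (Real.smoothTransition.nonneg _) hLu
  have h2 : deriv Real.smoothTransition (-u x) * leviGradSq u x v ≤
      C * Real.exp 1 / σ * ‖T v‖ ^ 2 := by
    by_cases hux : 1 < -u x
    · rw [(hC _).2 (Or.inr hux), zero_mul]; positivity
    · have h3 : -1 ≤ Real.log ((N x + ε) / σ) := by
        have : -u x ≤ 1 := not_lt.1 hux
        simp only [hu] at this
        linarith
      rw [Real.le_log_iff_exp_le (by positivity), le_div_iff₀ hσ, Real.exp_neg] at h3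
      calc _ ≤ C * (‖T v‖ ^ 2 / (N x + ε)) :=
            mul_le_mul (hC _).1 hgu (leviGradSq_nonneg _ _ _) hC0
        _ ≤ C * (‖T v‖ ^ 2 / ((Real.exp 1)⁻¹ * σ)) := by gcongr
        _ = _ := by field_simp
  linarith

end RegMax

/-! ### Circle averages and second order expansions -/

section CircleAverage

theorem circleAverage_quadratic (c α β γ δ κ : ℝ) :
    Real.circleAverage (fun ζ : ℂ => c + α * ζ.re + β * ζ.im + γ * ζ.re ^ 2 +
      δ * (ζ.re * ζ.im) + κ * ζ.im ^ 2) 0 1 = c + (γ + κ) / 2 := by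
  have h : ∀ θ : ℝ, (circleMap 0 1 θ).re = Real.cos θ ∧ (circleMap 0 1 θ).im = Real.sin θ := by
    intro θ
    simp [circleMap, Complex.exp_ofReal_mul_I_re, Complex.exp_ofReal_mul_I_im]
  rw [Real.circleAverage_def]
  simp only [(h _).1, (h _).2]
  have key : ∫ θ in (0 : ℝ)..(2 * Real.pi), (c + α * Real.cos θ + β * Real.sin θ +
      γ * Real.cos θ ^ 2 + δ * (Real.cos θ * Real.sin θ) + κ * Real.sin θ ^ 2) =
      2 * Real.pi * (c + (γ + κ) / 2) := by
    have hi : ∀ f : ℝ → ℝ, Continuous f → IntervalIntegrable f MeasureTheory.volume 0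
      (2 * Real.pi) := fun f hf => hf.intervalIntegrable _ _
    rw [intervalIntegral.integral_add (hi _ (by fun_prop)) (hi _ (by fun_prop)),
      intervalIntegral.integral_add (hi _ (by fun_prop)) (hi _ (by fun_prop)),
      intervalIntegral.integral_add (hi _ (by fun_prop)) (hi _ (by fun_prop)),
      intervalIntegral.integral_add (hi _ (by fun_prop)) (hi _ (by fun_prop)),
      intervalIntegral.integral_add (hi _ (by fun_prop)) (hi _ (by fun_prop))]
    have h5 : ∫ θ in (0 : ℝ)..(2 * Real.pi), Real.cos θ * Real.sin θ = 0 := by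
      have := integral_sin_mul_cos₁ (a := 0) (b := 2 * Real.pi)
      simp only [mul_comm (Real.cos _)]
      rw [this]; simp
    simp only [intervalIntegral.integral_const_mul, h5]
    simp [integral_cos_sq, integral_sin_sq]
    ring
  rw [key, smul_eq_mul]
  field_simp

/-- The remainder has derivative `Dg(a + w) - Dg(a) - D²g(a) w = o(‖w‖)`, by symmetry of `D²g(a)`;
the mean value inequality on a ball then gives the quadratic estimate. -/
theorem ContDiffAt.exists_taylor_two {V : Type*} [NormedAddCommGroup V] [NormedSpace ℝ V]
    {g : V → ℝ} {a : V} (hg : ContDiffAt ℝ 2 g a) {η : ℝ} (hη : 0 < η) :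
    ∃ r > 0, ∀ v : V, ‖v‖ < r →
      |g (a + v) - g a - fderiv ℝ g a v - fderiv ℝ (fderiv ℝ g) a v v / 2| ≤ η * ‖v‖ ^ 2 := by
  have hd2 : HasFDerivAt (fderiv ℝ g) (fderiv ℝ (fderiv ℝ g) a) a :=
    ((hg.fderiv_right (m := 1) (by norm_num)).differentiableAt (by norm_num)).hasFDerivAt
  have hsymm : IsSymmSndFDerivAt ℝ g a := hg.isSymmSndFDerivAt (by simp)
  have hev : ∀ᶠ x in 𝓝 a, DifferentiableAt ℝ g x ∧
      ‖fderiv ℝ g x - fderiv ℝ g a - fderiv ℝ (fderiv ℝ g) a (x - a)‖ ≤ η * ‖x - a‖ := by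
    refine Filter.Eventually.and ?_ (hd2.isLittleO.def hη)
    filter_upwards [hg.eventually (by norm_num)] with x hx
    exact hx.differentiableAt (by norm_num)
  obtain ⟨r, hr, hball⟩ := Metric.eventually_nhds_iff_ball.1 hev
  refine ⟨r, hr, fun v hv => ?_⟩
  set R : V → ℝ := fun w => g (a + w) - fderiv ℝ g a w - fderiv ℝ (fderiv ℝ g) a w w / 2 with hR
  have hRd : ∀ w : V, ‖w‖ < r → HasFDerivAt R
      (fderiv ℝ g (a + w) - fderiv ℝ g a - fderiv ℝ (fderiv ℝ g) a w) w := by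
    intro w hw
    have h1 := (hball (a + w) (by simpa using hw)).1.hasFDerivAt
    have h2 : HasFDerivAt (fun w => g (a + w)) (fderiv ℝ g (a + w)) w := by
      exact (h1.comp w ((hasFDerivAt_id w).const_add a)).congr_fderiv (by ext; simp)
    have h3 : HasFDerivAt (fun w => fderiv ℝ (fderiv ℝ g) a w w)
        ((2:ℝ) • fderiv ℝ (fderiv ℝ g) a w) w := by
      refine ((fderiv ℝ (fderiv ℝ g) a).hasFDerivAt.clm_apply (hasFDerivAt_id w)).congr_fderiv ?_
      ext u
      simp [two_mul, hsymm.eq u w]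
    have h4 := (h2.sub (fderiv ℝ g a).hasFDerivAt).sub (h3.mul_const (2⁻¹ : ℝ))
    refine h4.congr_fderiv ?_
    ext u
    simp
  have hconv : Convex ℝ (Metric.closedBall (0 : V) ‖v‖) := convex_closedBall _ _
  have hmain := hconv.norm_image_sub_le_of_norm_hasFDerivWithin_le (f := R) (C := η * ‖v‖)
    (fun w hw => (hRd w (by
      rw [mem_closedBall_zero_iff] at hw; linarith)).hasFDerivWithinAt)
    (fun w hw => by
      rw [mem_closedBall_zero_iff] at hw
      have := (hball (a + w) (by simpa using hw.trans_lt hv)).2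
      simp only [add_sub_cancel_left] at this
      exact this.trans (by gcongr)) (x := 0) (y := v) (by simp) (by simp)
  simp only [hR, add_zero, map_zero, sub_zero, zero_div] at hmain
  rw [← Real.norm_eq_abs]
  refine le_trans (le_of_eq ?_) (hmain.trans (le_of_eq (by ring)))
  congr 1
  ring

theorem eventually_circleAverage_lt {V : Type*} [NormedAddCommGroup V] [NormedSpace ℂ V]
    {f : V → ℝ} {a b : V} (hf : ContDiffAt ℝ 2 f a) (hneg : leviForm f a b < 0) :
    ∀ᶠ r : ℝ in 𝓝[>] 0,
      Real.circleAverage (fun ζ : ℂ => f (a + ζ • (r : ℂ) • b)) 0 1 < f a := by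
  set g : ℂ → ℝ := fun ζ => f (a + ζ • b) with hg
  have hH : ContDiff ℂ 2 (fun ζ : ℂ => a + ζ • b) := by fun_prop
  have hf' : ContDiffAt ℝ 2 f (a + (0 : ℂ) • b) := by simpa using hf
  have hgc : ContDiffAt ℝ 2 g 0 := hf'.comp (0 : ℂ) (hH.restrict_scalars ℝ).contDiffAt
  have hlevi : leviForm g 0 1 = leviForm f a b := by
    rw [hg, leviForm_comp_hol (H := fun ζ : ℂ => a + ζ • b) hf' hH.contDiffAt]
    have : fderiv ℂ (fun ζ : ℂ => a + ζ • b) 0 1 = b := by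
      have h : HasFDerivAt (fun ζ : ℂ => a + ζ • b)
        ((ContinuousLinearMap.id ℂ ℂ).smulRight b) (0 : ℂ) :=
        ((hasFDerivAt_id (𝕜 := ℂ) (0 : ℂ)).smul_const b).const_add a
      rw [h.fderiv]; simp
    rw [this]; simp
  set lam := leviForm g 0 1 with hlam
  have hlam0 : lam < 0 := by rw [hlevi]; exact hneg
  -- The quadratic term averages to `lam * r ^ 2`. Allowing an error of half that size leaves `lam *
  -- r ^ 2 / 2 < 0`.
  obtain ⟨R, hR, hT⟩ := hgc.exists_taylor_two (η := -lam / 2) (by linarith)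
  have hcont : ∀ᶠ ζ in 𝓝 (0 : ℂ), ContinuousAt g ζ := by
    filter_upwards [hgc.eventually (by norm_num)] with x hx
    exact hx.continuousAt
  obtain ⟨R', hR', hball⟩ := Metric.eventually_nhds_iff_ball.1 hcont
  filter_upwards [self_mem_nhdsWithin, mem_nhdsWithin_of_mem_nhds (gt_mem_nhds hR),
    mem_nhdsWithin_of_mem_nhds (gt_mem_nhds hR')] with r hr0 hr hr'
  have hr0 : 0 < r := hr0
  set D := fderiv ℝ g 0
  set B := fderiv ℝ (fderiv ℝ g) 0
  have hsymm : IsSymmSndFDerivAt ℝ g 0 := hgc.isSymmSndFDerivAt (by simp)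
  set P : ℂ → ℝ := fun ζ => (g 0 + -lam / 2 * r ^ 2) + (r * D 1) * ζ.re +
    (r * D Complex.I) * ζ.im + (r ^ 2 / 2 * B 1 1) * ζ.re ^ 2 +
    (r ^ 2 * B 1 Complex.I) * (ζ.re * ζ.im) + (r ^ 2 / 2 * B Complex.I Complex.I) * ζ.im ^ 2
  have hPle : ∀ ζ : ℂ, ‖ζ‖ = 1 → g (ζ * r) ≤ P ζ := by
    intro ζ hζ
    have hz : ζ * r = (r * ζ.re) • (1 : ℂ) + (r * ζ.im) • Complex.I := by
      apply Complex.ext <;> simp [mul_comm]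
    have hn : ‖ζ * r‖ = r := by simp [hζ, abs_of_pos hr0]
    have := (abs_le.1 (hT (ζ * r) (by rw [hn]; exact hr))).2
    rw [hn, zero_add, hz] at this
    simp only [map_add, map_smul, add_apply, smul_apply,
      smul_eq_mul] at this
    have hs : B Complex.I 1 = B 1 Complex.I := hsymm.eq _ _
    change _ - g 0 - (_ * D 1 + _ * D Complex.I) - (_ * (_ * B 1 1 + _ * B Complex.I 1) +
      _ * (_ * B 1 Complex.I + _ * B Complex.I Complex.I)) / 2 ≤ _ at this
    rw [hs] at this
    rw [hz]
    simp only [P]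
    linarith
  have hfun : (fun ζ : ℂ => f (a + ζ • (r : ℂ) • b)) = fun ζ => g (ζ * r) := by
    funext ζ; simp only [hg, smul_smul]
  rw [hfun]
  calc Real.circleAverage (fun ζ : ℂ => g (ζ * r)) 0 1 ≤ Real.circleAverage P 0 1 := by
        apply Real.circleAverage_mono
        · apply ContinuousOn.circleIntegrable (by norm_num)
          intro ζ hζ
          have hζ : ‖ζ‖ = 1 := by simpa using hζ
          apply ContinuousAt.continuousWithinAt
          apply ContinuousAt.comp (g := g) (f := fun ζ : ℂ => ζ * r)
          · exact hball _ (by simpa [hζ, abs_of_pos hr0] using hr')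
          · fun_prop
        · apply ContinuousOn.circleIntegrable (by norm_num)
          apply Continuous.continuousOn
          fun_prop
        · intro ζ hζ
          exact hPle ζ (by simpa using hζ)
    _ = (g 0 + -lam / 2 * r ^ 2) + (r ^ 2 / 2 * B 1 1 + r ^ 2 / 2 * B Complex.I Complex.I) / 2 :=
        circleAverage_quadratic _ _ _ _ _ _
    _ = g 0 + r ^ 2 * lam / 2 := by
        have : lam = (B 1 1 + B Complex.I Complex.I) / 4 := by
          simp [hlam, leviForm, B]
        rw [this]; ring
    _ < f a := by
        have : g 0 = f a := by simp [hg]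
        rw [this]
        nlinarith [pow_pos hr0 2]

end CircleAverage

/-! ### Plurisubharmonic functions: comparison on circles and the value `-∞` -/

section PSH

variable {V : Type*} [NormedAddCommGroup V] [NormedSpace ℂ V] {u : V → EReal} {U : Set V}
  {a b : V}

/-- Truncate `u` at a lower bound of `h` on the circle: the truncation is still below `h`, is
bounded, and is measurable by semicontinuity, so its average can be compared with that of `h`. -/
theorem IsPSHOn.le_circleAverage (hu : IsPSHOn u U) (hd : ∀ ζ : ℂ, ‖ζ‖ ≤ 1 → a + ζ • b ∈ U)
    {h : ℂ → ℝ} (hh : ContinuousOn h (Metric.sphere 0 1))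
    (hle : ∀ ζ : ℂ, ‖ζ‖ = 1 → u (a + ζ • b) ≤ h ζ) :
    u a ≤ (Real.circleAverage h 0 1 : ℝ) := by
  obtain ⟨c, hc⟩ := (isCompact_sphere (0 : ℂ) 1).bddBelow_image hh
  obtain ⟨C, hC⟩ := (isCompact_sphere (0 : ℂ) 1).bddAbove_image hh
  have hc' : ∀ ζ : ℂ, ‖ζ‖ = 1 → c ≤ h ζ := fun ζ hζ => hc ⟨ζ, by simpa using hζ, rfl⟩
  have hC' : ∀ ζ : ℂ, ‖ζ‖ = 1 → h ζ ≤ C := fun ζ hζ => hC ⟨ζ, by simpa using hζ, rfl⟩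
  set F : ℂ → ℝ := fun ζ => (max (u (a + ζ • b)) (c : EReal)).toReal with hF
  have hmax : ∀ ζ : ℂ, ‖ζ‖ = 1 → max (u (a + ζ • b)) (c : EReal) ≤ h ζ := fun ζ hζ =>
    max_le (hle ζ hζ) (by exact_mod_cast hc' ζ hζ)
  have hFle : ∀ ζ : ℂ, ‖ζ‖ = 1 → F ζ ≤ h ζ := fun ζ hζ =>
    EReal.toReal_le_toReal (hmax ζ hζ)
      (ne_of_gt ((EReal.bot_lt_coe c).trans_le (le_max_right _ _))) (EReal.coe_ne_top _)
  have hcF : ∀ ζ : ℂ, ‖ζ‖ = 1 → c ≤ F ζ := fun ζ hζ => by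
    have h1 : max (u (a + ζ • b)) (c : EReal) ≠ ⊤ :=
      ne_of_lt ((hmax ζ hζ).trans_lt (EReal.coe_lt_top _))
    have h2 : max (u (a + ζ • b)) (c : EReal) ≠ ⊥ :=
      ne_of_gt ((EReal.bot_lt_coe c).trans_le (le_max_right _ _))
    rw [← EReal.coe_le_coe_iff, EReal.coe_toReal h1 h2]
    exact le_max_right _ _
  have hnorm : ∀ θ : ℝ, ‖circleMap 0 1 θ‖ = 1 := fun θ => by simp
  have husc : UpperSemicontinuous fun θ : ℝ => u (a + circleMap 0 1 θ • b) := by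
    rw [← upperSemicontinuousOn_univ_iff]
    apply hu.usc.comp (g := fun θ : ℝ => a + circleMap 0 1 θ • b)
    · apply Continuous.continuousOn
      have := continuous_circleMap 0 1
      fun_prop
    · intro θ _
      exact hd _ (hnorm θ).le
  have hmeas : Measurable fun θ : ℝ => F (circleMap 0 1 θ) :=
    (husc.measurable.max measurable_const).ereal_toReal
  have hint : CircleIntegrable F 0 1 := by
    unfold CircleIntegrable
    apply IntervalIntegrable.mono_fun' (g := fun _ => max |c| |C|)
      intervalIntegrable_const hmeas.aestronglyMeasurable
    refine Filter.Eventually.of_forall fun θ => ?_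
    exact abs_le_max_abs_abs (hcF _ (hnorm θ)) ((hFle _ (hnorm θ)).trans (hC' _ (hnorm θ)))
  refine (hu.submean a b hd c).trans ?_
  rw [EReal.coe_le_coe_iff]
  apply Real.circleAverage_mono hint (hh.circleIntegrable (by norm_num))
  intro ζ hζ
  exact hFle ζ (by simpa using hζ)

/-- On the circle `u` is bounded above by some `C`, and it is `-∞` on an arc around `ζ = 1`. So it
lies below `C - K g` for a bump `g` supported on that arc, and the average of this majorant tends to
`-∞` with `K → ∞`. -/
theorem IsPSHOn.eq_bot_of_circle (hu : IsPSHOn u U) (hd : ∀ ζ : ℂ, ‖ζ‖ ≤ 1 → a + ζ • b ∈ U)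
    (hbot : ∀ᶠ x in 𝓝 (a + b), u x = ⊥) : u a = ⊥ := by
  obtain ⟨C, hC⟩ : ∃ C : ℝ, ∀ ζ : ℂ, ‖ζ‖ = 1 → u (a + ζ • b) ≤ C := by
    have husc : UpperSemicontinuousOn (fun ζ : ℂ => u (a + ζ • b)) (Metric.sphere 0 1) :=
      hu.usc.comp (g := fun ζ : ℂ => a + ζ • b) (by fun_prop)
        fun ζ hζ => hd ζ (by simpa using (mem_sphere_zero_iff_norm.1 hζ).le)
    obtain ⟨ζ₀, hζ₀, hmax⟩ := husc.exists_isMaxOn ⟨1, by simp⟩ (isCompact_sphere _ _)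
    have hlt : u (a + ζ₀ • b) < ⊤ := hu.lt_top _ (hd _ (mem_sphere_zero_iff_norm.1 hζ₀).le)
    obtain ⟨C, hC⟩ := EReal.exists_between_coe_real hlt
    exact ⟨C, fun ζ hζ => (hmax (by simpa using hζ)).trans hC.1.le⟩
  have hcont : ContinuousAt (fun ζ : ℂ => a + ζ • b) 1 := by fun_prop
  obtain ⟨τ, hτ, hball⟩ := Metric.eventually_nhds_iff_ball.1
    (hcont.eventually (p := fun x => u x = ⊥) (by simpa using hbot))
  set g : ℂ → ℝ := fun ζ => max 0 (τ - ‖ζ - 1‖) with hg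
  have hgc : Continuous g := by fun_prop
  have hgpos : 0 < Real.circleAverage g 0 1 := by
    rw [Real.circleAverage_def, smul_eq_mul]
    apply mul_pos (by positivity)
    apply intervalIntegral.integral_pos (by positivity)
    · exact (hgc.comp (continuous_circleMap 0 1)).continuousOn
    · intro θ _; exact le_max_left _ _
    · refine ⟨0, ⟨le_rfl, by positivity⟩, ?_⟩
      simp [hg, circleMap, hτ]
  have key : ∀ K : ℝ, 0 ≤ K → u a ≤ ((C - K * Real.circleAverage g 0 1 : ℝ) : EReal) := by
    intro K hK
    have := hu.le_circleAverage hd (h := fun ζ => C - K * g ζ) (by fun_prop) (fun ζ hζ => by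
      by_cases hz : ζ ∈ Metric.ball (1 : ℂ) τ
      · rw [hball ζ hz]; exact bot_le
      · have : g ζ = 0 := by
          rw [Metric.mem_ball, dist_eq_norm, not_lt] at hz
          simp only [hg]
          exact max_eq_left (by linarith)
        rw [this]; simpa using hC ζ hζ)
    have hi : ∀ f : ℂ → ℝ, Continuous f → CircleIntegrable f 0 1 := fun f hf =>
      hf.continuousOn.circleIntegrable (by norm_num)
    rw [Real.circleAverage_fun_sub (hi _ continuous_const) (hi _ (by fun_prop)),
      Real.circleAverage_const] at this
    have h2 : Real.circleAverage (fun ζ => K * g ζ) 0 1 = K * Real.circleAverage g 0 1 :=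
      Real.circleAverage_fun_smul (a := K) (f := g)
    rwa [h2] at this
  rw [EReal.eq_bot_iff_forall_lt]
  intro y
  -- This `K` makes the bound equal to `C - |C - y| - 1`, which is below `y`.
  have h1 := key ((|C - y| + 1) / Real.circleAverage g 0 1) (by positivity)
  refine h1.trans_lt ?_
  rw [div_mul_cancel₀ _ hgpos.ne', EReal.coe_lt_coe_iff]
  linarith [le_abs_self (C - y)]

/-- Every `y` near `x` is the centre of a disc in `U` whose boundary passes through an interior
point of the `-∞` set. -/
theorem IsPSHOn.eventually_eq_bot (hu : IsPSHOn u U) {x : V} (hU : U ∈ 𝓝 x)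
    (hx : x ∈ closure (interior {y | u y = ⊥})) : ∀ᶠ y in 𝓝 x, u y = ⊥ := by
  obtain ⟨R, hR, hball⟩ := Metric.mem_nhds_iff.1 hU
  -- With both `y` and `o` within `R / 3` of `x`, the disc centred at `y` through `o` has radius
  -- below `2R / 3` and stays in the ball of radius `R`.
  have hx' := Metric.mem_closure_iff.1 hx (R / 3) (by positivity)
  obtain ⟨o, ho, hxo⟩ := hx'
  filter_upwards [Metric.ball_mem_nhds x (show 0 < R / 3 by positivity)] with y hy
  rw [Metric.mem_ball, dist_eq_norm] at hy
  rw [dist_eq_norm] at hxo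
  apply hu.eq_bot_of_circle (b := o - y)
  · intro ζ hζ
    apply hball
    rw [Metric.mem_ball, dist_eq_norm]
    calc ‖y + ζ • (o - y) - x‖ = ‖(y - x) + ζ • (o - y)‖ := by congr 1; abel
      _ ≤ ‖y - x‖ + ‖ζ‖ * ‖o - y‖ := (norm_add_le _ _).trans (by rw [norm_smul])
      _ ≤ ‖y - x‖ + 1 * (‖x - o‖ + ‖y - x‖) := by
          gcongr
          calc ‖o - y‖ = ‖(x - o) + (y - x)‖ := by rw [← norm_neg]; congr 1; abel
            _ ≤ _ := norm_add_le _ _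
      _ < R := by linarith
  · rw [add_sub_cancel]
    exact mem_interior_iff_mem_nhds.1 ho

end PSH

/-! ### Mean value inequality for rotation-invariant weights, and Gaussian masses -/

section MeanValue

open MeasureTheory

/-- The mean value property of the holomorphic function `f ^ 2`, followed by the triangle inequality
for integrals. -/
theorem two_pi_mul_enorm_sq_le {f : ℂ → ℂ} (hf : DiffContOnCl ℂ f (Metric.ball 0 1)) :
    ENNReal.ofReal (2 * Real.pi) * ‖f 0‖ₑ ^ 2 ≤
      ∫⁻ θ in Set.Ioc 0 (2 * Real.pi), ‖f (circleMap 0 1 θ)‖ₑ ^ 2 := by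
  have h : DiffContOnCl ℂ (fun z => f z ^ 2) (Metric.ball 0 |1|) := by
    rw [abs_one]
    simpa only [smul_eq_mul, sq] using hf.smul hf
  have h1 := h.circleAverage
  rw [Real.circleAverage_def, intervalIntegral.integral_of_le (by positivity)] at h1
  have h2 : (2 * Real.pi : ℝ) • f 0 ^ 2 =
      ∫ θ in Set.Ioc 0 (2 * Real.pi), f (circleMap 0 1 θ) ^ 2 := by
    rw [← h1, smul_inv_smul₀ (by positivity)]
  calc ENNReal.ofReal (2 * Real.pi) * ‖f 0‖ₑ ^ 2 = ‖(2 * Real.pi : ℝ) • f 0 ^ 2‖ₑ := by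
        rw [enorm_smul, enorm_pow, Real.enorm_of_nonneg (by positivity)]
    _ ≤ ∫⁻ θ in Set.Ioc 0 (2 * Real.pi), ‖f (circleMap 0 1 θ) ^ 2‖ₑ := by
        rw [h2]; exact enorm_integral_le_lintegral_enorm _
    _ = _ := by simp_rw [enorm_pow]

variable {n : ℕ}

theorem measurePreserving_smul_circle {c : ℂ} (hc : ‖c‖ = 1) :
    MeasurePreserving (fun w : Fin n → ℂ => c • w) := by
  have h : MeasurePreserving (fun z : ℂ => c * z) :=
    (rotation ⟨c, by simpa [Submonoid.unitSphere] using hc⟩).measurePreserving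
  exact volume_preserving_pi fun _ => h

/-- The rotations `w ↦ e^{iθ} w` preserve the ball, Lebesgue measure and `W`. So the integral equals
its average over `θ`; after exchanging integrals, the one-variable inequality applies on each disc
`c ↦ z₀ + c w`. -/
theorem enorm_sq_mul_lintegral_le {v : (Fin n → ℂ) → ℂ} {z₀ : Fin n → ℂ} {δ : ℝ}
    (hv : DifferentiableOn ℂ v (Metric.ball z₀ δ)) {W : (Fin n → ℂ) → ℝ≥0∞} (hW : Measurable W)
    (hrot : ∀ (c : ℂ) w, ‖c‖ = 1 → W (c • w) = W w) :
    ‖v z₀‖ₑ ^ 2 * ∫⁻ w in Metric.ball 0 δ, W w ≤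
      ∫⁻ z in Metric.ball z₀ δ, ‖v z‖ₑ ^ 2 * W (z - z₀) := by
  set B : Set (Fin n → ℂ) := Metric.ball 0 δ
  have hB : MeasurableSet B := measurableSet_ball
  set G : (Fin n → ℂ) → ℝ≥0∞ := B.indicator fun w => ‖v (z₀ + w)‖ₑ ^ 2 * W w with hG
  have hmaps : Set.MapsTo (fun w => z₀ + w) B (Metric.ball z₀ δ) := fun w hw => by
    simpa [B] using hw
  have hvc : DifferentiableOn ℂ (fun w => v (z₀ + w)) B :=
    hv.comp (by fun_prop) hmaps
  have hGm : Measurable G := by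
    have h1 : Measurable (B.indicator fun w => ‖v (z₀ + w)‖ₑ ^ 2) := by
      have : ContinuousOn (fun w => ‖v (z₀ + w)‖ₑ ^ 2) B :=
        (ENNReal.continuous_pow 2).comp_continuousOn hvc.continuousOn.enorm
      apply measurable_of_restrict_of_restrict_compl hB
      · have h := this.domRestrict.measurable
        have he : B.domRestrict (B.indicator fun w => ‖v (z₀ + w)‖ₑ ^ 2) =
            B.domRestrict fun w => ‖v (z₀ + w)‖ₑ ^ 2 := by
          funext w
          exact Set.indicator_of_mem w.2 _
        rw [he]
        exact h
      · have he : Bᶜ.domRestrict (B.indicator fun w => ‖v (z₀ + w)‖ₑ ^ 2) = fun _ => 0 := by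
          funext w
          exact Set.indicator_of_notMem w.2 _
        rw [he]
        exact measurable_const
    have h2 : G = fun w => (B.indicator fun w => ‖v (z₀ + w)‖ₑ ^ 2) w * W w := by
      funext w
      by_cases hw : w ∈ B <;> simp [hG, hw]
    rw [h2]
    exact h1.mul hW
  have hR : ∫⁻ z in Metric.ball z₀ δ, ‖v z‖ₑ ^ 2 * W (z - z₀) = ∫⁻ w, G w := by
    rw [hG, lintegral_indicator hB, ← lintegral_indicator measurableSet_ball,
      ← lintegral_indicator hB, ← lintegral_add_left_eq_self _ z₀]
    congr 1
    funext w
    by_cases hw : w ∈ B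
    · rw [Set.indicator_of_mem hw, Set.indicator_of_mem (hmaps hw)]
      simp
    · rw [Set.indicator_of_notMem hw, Set.indicator_of_notMem]
      simpa [B] using hw
  have hinv : ∀ θ : ℝ, ∫⁻ w, G (circleMap 0 1 θ • w) = ∫⁻ w, G w := fun θ =>
    (measurePreserving_smul_circle (by simp)).lintegral_comp hGm
  have hpt : ∀ w ∈ B, ENNReal.ofReal (2 * Real.pi) * (‖v z₀‖ₑ ^ 2 * W w) ≤
      ∫⁻ θ in Set.Ioc 0 (2 * Real.pi), G (circleMap 0 1 θ • w) := by
    intro w hw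
    have hmem : ∀ c : ℂ, ‖c‖ ≤ 1 → c • w ∈ B := fun c hc => by
      simp only [B, mem_ball_zero_iff] at hw ⊢
      rw [norm_smul]
      nlinarith [norm_nonneg w]
    have hd : DiffContOnCl ℂ (fun c : ℂ => v (z₀ + c • w)) (Metric.ball 0 1) := by
      apply DifferentiableOn.diffContOnCl
      rw [closure_ball _ one_ne_zero]
      exact hvc.comp (t := B) (f := fun c : ℂ => c • w) (by fun_prop) fun c hc =>
        hmem c (by simpa using hc)
    have h1 := two_pi_mul_enorm_sq_le hd
    simp only [zero_smul, add_zero] at h1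
    calc _ = (ENNReal.ofReal (2 * Real.pi) * ‖v z₀‖ₑ ^ 2) * W w := by ring
      _ ≤ (∫⁻ θ in Set.Ioc 0 (2 * Real.pi), ‖v (z₀ + circleMap 0 1 θ • w)‖ₑ ^ 2) * W w := by
          gcongr
      _ ≤ ∫⁻ θ in Set.Ioc 0 (2 * Real.pi), ‖v (z₀ + circleMap 0 1 θ • w)‖ₑ ^ 2 * W w :=
          lintegral_mul_const_le _ _
      _ = _ := by
          congr 1
          funext θ
          rw [hG, Set.indicator_of_mem (hmem _ (by simp)), hrot _ _ (by simp)]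
  have hpi : ENNReal.ofReal (2 * Real.pi) ≠ 0 := by
    rw [Ne, ENNReal.ofReal_eq_zero, not_le]; positivity
  rw [hR]
  refine (ENNReal.mul_le_mul_iff_right hpi ENNReal.ofReal_ne_top).1 ?_
  calc ENNReal.ofReal (2 * Real.pi) * (‖v z₀‖ₑ ^ 2 * ∫⁻ w in B, W w)
      = ∫⁻ w in B, ENNReal.ofReal (2 * Real.pi) * (‖v z₀‖ₑ ^ 2 * W w) := by
        rw [lintegral_const_mul _ (hW.const_mul _), lintegral_const_mul _ hW]
    _ ≤ ∫⁻ w in B, ∫⁻ θ in Set.Ioc 0 (2 * Real.pi), G (circleMap 0 1 θ • w) :=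
        setLIntegral_mono' hB hpt
    _ ≤ ∫⁻ w, ∫⁻ θ in Set.Ioc 0 (2 * Real.pi), G (circleMap 0 1 θ • w) :=
        setLIntegral_le_lintegral _ _
    _ = ∫⁻ θ in Set.Ioc 0 (2 * Real.pi), ∫⁻ w, G (circleMap 0 1 θ • w) := by
        rw [lintegral_lintegral_swap]
        apply Measurable.aemeasurable
        have hc := continuous_circleMap 0 1
        have : Continuous fun q : (Fin n → ℂ) × ℝ => circleMap 0 1 q.2 • q.1 := by fun_prop
        exact hGm.comp this.measurable
    _ = ENNReal.ofReal (2 * Real.pi) * ∫⁻ w, G w := by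
        simp_rw [hinv]
        rw [lintegral_const, Measure.restrict_apply_univ, Real.volume_Ioc, sub_zero, mul_comm]

variable {E : Type*} [NormedAddCommGroup E] [InnerProductSpace ℂ E]

/-- The mass of the Gaussian weight `exp (-k ‖T w‖²)` on the ball of radius `δ`. -/
def gaussMass (T : (Fin n → ℂ) →L[ℂ] E) (δ k : ℝ) : ℝ≥0∞ :=
  ∫⁻ w in Metric.ball 0 δ, ENNReal.ofReal (Real.exp (-(k * ‖T w‖ ^ 2)))

theorem gaussMass_lt_top (T : (Fin n → ℂ) →L[ℂ] E) (δ : ℝ) {k : ℝ} (hk : 0 ≤ k) :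
    gaussMass T δ k < ⊤ := by
  refine (setLIntegral_mono' (g := fun _ => 1) measurableSet_ball fun w _ => ?_).trans_lt ?_
  · rw [ENNReal.ofReal_le_one, Real.exp_le_one_iff, neg_nonpos]
    positivity
  · rw [setLIntegral_one]
    exact measure_ball_lt_top

/-- Keep only a small ball on which `‖T w‖² < τ`. Since `τ` is arbitrary, the mass decays more
slowly than any exponential in `k`. -/
theorem exists_le_gaussMass (T : (Fin n → ℂ) →L[ℂ] E) {δ τ : ℝ} (hδ : 0 < δ) (hτ : 0 < τ) :
    ∃ c : ℝ, 0 < c ∧ ∀ k : ℝ, 0 ≤ k → ENNReal.ofReal (c * Real.exp (-(k * τ))) ≤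
      gaussMass T δ k := by
  have hcont : ContinuousAt (fun w => ‖T w‖ ^ 2) 0 := by fun_prop
  obtain ⟨r, hr, hball⟩ := Metric.eventually_nhds_iff_ball.1
    (hcont.eventually (gt_mem_nhds (show ‖T 0‖ ^ 2 < τ by simpa using hτ)))
  set s := min r δ
  have hs : 0 < s := lt_min hr hδ
  have hfin : volume (Metric.ball (0 : Fin n → ℂ) s) ≠ ⊤ := measure_ball_lt_top.ne
  refine ⟨(volume (Metric.ball (0 : Fin n → ℂ) s)).toReal,
    ENNReal.toReal_pos (Metric.measure_ball_pos _ _ hs).ne' hfin, fun k hk => ?_⟩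
  rw [ENNReal.ofReal_mul ENNReal.toReal_nonneg, ENNReal.ofReal_toReal hfin]
  calc _ = ∫⁻ _ in Metric.ball (0 : Fin n → ℂ) s, ENNReal.ofReal (Real.exp (-(k * τ))) := by
        rw [setLIntegral_const, mul_comm]
    _ ≤ ∫⁻ w in Metric.ball (0 : Fin n → ℂ) s, ENNReal.ofReal (Real.exp (-(k * ‖T w‖ ^ 2))) := by
        refine setLIntegral_mono' measurableSet_ball fun w hw => ?_
        gcongr
        exact (hball w (Metric.ball_subset_ball (min_le_left _ _) hw)).le
    _ ≤ _ := lintegral_mono_set (Metric.ball_subset_ball (min_le_right _ _))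

end MeanValue

/-! ### Change of holomorphic charts -/

section Charts

variable {V : Type*} [NormedAddCommGroup V] [NormedSpace ℂ V]
  {X : Type*} [TopologicalSpace X] [ChartedSpace V X] [IsManifold 𝓘(ℂ, V) ω X]
  {W : Type*} [NormedAddCommGroup W] [NormedSpace ℂ W]

theorem ContMDiffOn.contDiffOn_comp_chart_symm {g : X → W} {U : Set X}
    (hg : ContMDiffOn 𝓘(ℂ, V) 𝓘(ℂ, W) ω g U) {e : OpenPartialHomeomorph X V}
    (he : e ∈ IsManifold.maximalAtlas 𝓘(ℂ, V) ω X) :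
    ContDiffOn ℂ ω (fun w => g (e.symm w)) (e.target ∩ e.symm ⁻¹' U) := by
  rw [← contMDiffOn_iff_contDiffOn]
  exact hg.comp ((contMDiffOn_symm_of_mem_maximalAtlas he).mono Set.inter_subset_left)
    fun w hw => hw.2

theorem isOpen_chart_preimage {U : Set X} (hU : IsOpen U) (e : OpenPartialHomeomorph X V) :
    IsOpen (e.target ∩ e.symm ⁻¹' U) :=
  e.symm.isOpen_inter_preimage hU

theorem contDiffAt_transition {e e' : OpenPartialHomeomorph X V}
    (he : e ∈ IsManifold.maximalAtlas 𝓘(ℂ, V) ω X)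
    (he' : e' ∈ IsManifold.maximalAtlas 𝓘(ℂ, V) ω X) {w : V} (hw : w ∈ e.target)
    (hw' : e.symm w ∈ e'.source) : ContDiffAt ℂ ω (fun w => e' (e.symm w)) w :=
  ((contMDiffOn_of_mem_maximalAtlas he').contDiffOn_comp_chart_symm he).contDiffAt
    ((isOpen_chart_preimage e'.open_source e).mem_nhds ⟨hw, hw'⟩)

theorem eventually_comp_transition {β : Type*} {e e' : OpenPartialHomeomorph X V} (F : X → β)
    {w : V} (hw : w ∈ e.target) (hw' : e.symm w ∈ e'.source) :
    (fun w => F (e.symm w)) =ᶠ[𝓝 w] fun w => (fun z => F (e'.symm z)) (e' (e.symm w)) := by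
  filter_upwards [(isOpen_chart_preimage e'.open_source e).mem_nhds ⟨hw, hw'⟩] with z hz
  simp only [e'.left_inv hz.2]

theorem contDiffAt_comp_chart_symm_of {F : X → ℝ} {e e' : OpenPartialHomeomorph X V}
    (he : e ∈ IsManifold.maximalAtlas 𝓘(ℂ, V) ω X)
    (he' : e' ∈ IsManifold.maximalAtlas 𝓘(ℂ, V) ω X) {w : V} (hw : w ∈ e.target)
    (hw' : e.symm w ∈ e'.source) {k : ℕ∞}
    (hF : ContDiffAt ℝ k (fun z => F (e'.symm z)) (e' (e.symm w))) :
    ContDiffAt ℝ k (fun z => F (e.symm z)) w := by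
  refine ContDiffAt.congr_of_eventuallyEq ?_ (eventually_comp_transition F hw hw')
  exact ContDiffAt.comp (g := fun z => F (e'.symm z)) w hF
    (((contDiffAt_transition he he' hw hw').of_le le_top).restrict_scalars ℝ)

theorem leviForm_comp_chart_symm {F : X → ℝ} {e e' : OpenPartialHomeomorph X V}
    (he : e ∈ IsManifold.maximalAtlas 𝓘(ℂ, V) ω X)
    (he' : e' ∈ IsManifold.maximalAtlas 𝓘(ℂ, V) ω X) {w : V} (hw : w ∈ e.target)
    (hw' : e.symm w ∈ e'.source)
    (hF : ContDiffAt ℝ 2 (fun z => F (e'.symm z)) (e' (e.symm w))) (v : V) :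
    leviForm (fun z => F (e.symm z)) w v =
      leviForm (fun z => F (e'.symm z)) (e' (e.symm w))
        (fderiv ℂ (fun w => e' (e.symm w)) w v) := by
  rw [(eventually_comp_transition F hw hw').leviForm_eq]
  exact leviForm_comp_hol (f := fun z => F (e'.symm z)) (H := fun w => e' (e.symm w)) hF
    ((contDiffAt_transition he he' hw hw').of_le le_top) v

end Charts

/-! ### Fibre coordinates, frames and ratios in a line bundle -/

section LineBundles

variable {V : Type*} [NormedAddCommGroup V] [NormedSpace ℂ V]
  {X : Type*} [TopologicalSpace X] [ChartedSpace V X]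
  (L : X → Type*) [TopologicalSpace (TotalSpace ℂ L)]
  [∀ x, AddCommGroup (L x)] [∀ x, Module ℂ (L x)] [∀ x, TopologicalSpace (L x)]
  [FiberBundle ℂ L] [VectorBundle ℂ ℂ L]

/-- The fibre coordinate on a line bundle given by the preferred trivialization at `i`. -/
def lineCoord (i x : X) : L x →ₗ[ℂ] ℂ := (trivializationAt ℂ L i).linearMapAt ℂ x

/-- The frame of a line bundle given by the preferred trivialization at `i`. -/
def lineFrame (i x : X) : L x := (trivializationAt ℂ L i).symmₗ ℂ x 1

variable {L}

theorem lineCoord_apply {i x : X} (hx : x ∈ (trivializationAt ℂ L i).baseSet) (v : L x) :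
    lineCoord L i x v = (trivializationAt ℂ L i ⟨x, v⟩).2 := by
  rw [lineCoord, Trivialization.coe_linearMapAt_of_mem _ hx]

theorem lineCoord_lineFrame {i x : X} (hx : x ∈ (trivializationAt ℂ L i).baseSet) :
    lineCoord L i x (lineFrame L i x) = 1 :=
  (trivializationAt ℂ L i).linearMapAt_symmₗ hx 1

theorem lineCoord_smul_lineFrame {i x : X} (hx : x ∈ (trivializationAt ℂ L i).baseSet) (v : L x) :
    lineCoord L i x v • lineFrame L i x = v := by
  rw [lineFrame, ← map_smul, smul_eq_mul, mul_one]
  exact (trivializationAt ℂ L i).symmₗ_linearMapAt hx v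

theorem lineFrame_ne_zero {i x : X} (hx : x ∈ (trivializationAt ℂ L i).baseSet) :
    lineFrame L i x ≠ 0 := fun h => by
  have := lineCoord_lineFrame hx
  rw [h, map_zero] at this
  exact zero_ne_one this

theorem lineCoord_ne_zero {i x : X} (hx : x ∈ (trivializationAt ℂ L i).baseSet) {v : L x}
    (hv : v ≠ 0) : lineCoord L i x v ≠ 0 := fun h => hv <| by
  rw [← lineCoord_smul_lineFrame hx v, h, zero_smul]

theorem mem_baseSet_self (x : X) : x ∈ (trivializationAt ℂ L x).baseSet :=
  FiberBundle.mem_baseSet_trivializationAt' x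

/-- The scalar `c` with `v = c • f` for a nonzero element `f` of a fibre of a line bundle. -/
def lineRatio {x : X} (v f : L x) : ℂ := lineCoord L x x v / lineCoord L x x f

theorem lineRatio_smul {x : X} (v : L x) {f : L x} (hf : f ≠ 0) : lineRatio v f • f = v := by
  have h := lineCoord_ne_zero (mem_baseSet_self x) hf
  rw [← lineCoord_smul_lineFrame (mem_baseSet_self x) f, lineRatio, smul_smul]
  simp only [map_smul, lineCoord_lineFrame (mem_baseSet_self x), smul_eq_mul, mul_one]
  rw [div_mul_cancel₀ _ h, lineCoord_smul_lineFrame (mem_baseSet_self x) v]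

/-- The ratio does not depend on the trivialization, so its holomorphy can be checked locally in a
fixed one. -/
theorem lineRatio_eq {i x : X} (hx : x ∈ (trivializationAt ℂ L i).baseSet) (v : L x) {f : L x}
    (hf : f ≠ 0) : lineRatio v f = lineCoord L i x v / lineCoord L i x f := by
  have h := congrArg (lineCoord L i x) (lineRatio_smul v hf)
  rw [map_smul, smul_eq_mul] at h
  rw [← h, mul_div_cancel_right₀ _ (lineCoord_ne_zero hx hf)]

theorem lineRatio_ne_zero {x : X} {v f : L x} (hv : v ≠ 0) (hf : f ≠ 0) : lineRatio v f ≠ 0 :=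
  fun h => hv (by rw [← lineRatio_smul v hf, h, zero_smul])

variable [ContMDiffVectorBundle ω ℂ L 𝓘(ℂ, V)]

theorem isHolSectionOn_iff_lineCoord {U : Set X} (hU : IsOpen U) {i : X}
    (hi : U ⊆ (trivializationAt ℂ L i).baseSet) (s : ∀ x, L x) :
    IsHolSectionOn V L U s ↔
      ContMDiffOn 𝓘(ℂ, V) 𝓘(ℂ, ℂ) ω (fun x => lineCoord L i x (s x)) U := by
  rw [IsHolSectionOn]
  refine ((trivializationAt ℂ L i).contMDiffOn_section_iff (IB := 𝓘(ℂ, V)) hU hi).trans ?_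
  exact contMDiffOn_congr fun x hx => (lineCoord_apply (hi hx) (s x)).symm

theorem IsHolSectionOn.mono {U U' : Set X} {s : ∀ x, L x} (h : IsHolSectionOn V L U s)
    (hU : U' ⊆ U) : IsHolSectionOn V L U' s :=
  ContMDiffOn.mono h hU

theorem IsHolFrame.mono {U U' : Set X} {s : ∀ x, L x} (h : IsHolFrame V L U s)
    (hU' : IsOpen U') (hU : U' ⊆ U) : IsHolFrame V L U' s :=
  ⟨hU', h.hol.mono hU, fun x hx => h.ne_zero x (hU hx)⟩

variable (V L) in
theorem isHolFrame_lineFrame (i : X) :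
    IsHolFrame V L (trivializationAt ℂ L i).baseSet (lineFrame L i) where
  isOpen := (trivializationAt ℂ L i).open_baseSet
  hol := by
    rw [isHolSectionOn_iff_lineCoord (trivializationAt ℂ L i).open_baseSet subset_rfl]
    exact contMDiffOn_const.congr fun x hx => lineCoord_lineFrame hx
  ne_zero x hx := lineFrame_ne_zero hx

theorem IsHolSectionOn.contMDiffOn_lineRatio {U U' : Set X} {s f : ∀ x, L x}
    (hU : IsOpen U) (hs : IsHolSectionOn V L U s) (hf : IsHolFrame V L U' f) :
    ContMDiffOn 𝓘(ℂ, V) 𝓘(ℂ, ℂ) ω (fun x => lineRatio (s x) (f x)) (U ∩ U') := by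
  intro x hx
  set B := (trivializationAt ℂ L x).baseSet
  have hB : IsOpen B := (trivializationAt ℂ L x).open_baseSet
  have hO : IsOpen (U ∩ U' ∩ B) := (hU.inter hf.isOpen).inter hB
  have hxB : x ∈ U ∩ U' ∩ B := ⟨hx, mem_baseSet_self x⟩
  have h1 := (isHolSectionOn_iff_lineCoord hO (i := x) Set.inter_subset_right s).1
    (hs.mono fun y hy => hy.1.1)
  have h2 := (isHolSectionOn_iff_lineCoord hO (i := x) Set.inter_subset_right f).1
    (hf.hol.mono fun y hy => hy.1.2)
  have h3 : ContMDiffOn 𝓘(ℂ, V) 𝓘(ℂ, ℂ) ω (fun x => lineRatio (s x) (f x)) (U ∩ U' ∩ B) :=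
    (h1.div₀ h2 fun y hy => lineCoord_ne_zero hy.2 (hf.ne_zero y hy.1.2)).congr
      fun y hy => lineRatio_eq hy.2 _ (hf.ne_zero y hy.1.2)
  exact (h3.contMDiffAt (hO.mem_nhds hxB)).contMDiffWithinAt

end LineBundles

/-! ### Local weights of Hermitian metrics -/

section HermitianMetrics

variable {V : Type*} [NormedAddCommGroup V] [NormedSpace ℂ V]
  {X : Type*} [TopologicalSpace X] [ChartedSpace V X] [IsManifold 𝓘(ℂ, V) ω X]
  {L : X → Type*} [TopologicalSpace (TotalSpace ℂ L)]
  [∀ x, AddCommGroup (L x)] [∀ x, Module ℂ (L x)] [∀ x, TopologicalSpace (L x)]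
  [FiberBundle ℂ L] [VectorBundle ℂ ℂ L]

namespace HermitianMetric

variable (h : HermitianMetric V L)

theorem normSq_zero (x : X) : h.normSq x 0 = 0 := by
  have := h.normSq_smul x 0 0
  simpa using this

theorem normSq_nonneg (x : X) (v : L x) : 0 ≤ h.normSq x v := by
  by_cases hv : v = 0
  · rw [hv, h.normSq_zero]
  · exact (h.normSq_pos x v hv).le

theorem normSq_eq_exp_weight {s : ∀ x, L x} {x : X} (hs : s x ≠ 0) :
    h.normSq x (s x) = Real.exp (-h.weight s x) := by
  rw [weight, neg_neg, Real.exp_log (h.normSq_pos x _ hs)]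

theorem contDiffAt_weight {U : Set X} {s : ∀ x, L x} (hs : IsHolFrame V L U s)
    {e : OpenPartialHomeomorph X V} (he : e ∈ IsManifold.maximalAtlas 𝓘(ℂ, V) ω X) {w : V}
    (hw : w ∈ e.target) (hwU : e.symm w ∈ U) :
    ContDiffAt ℝ ∞ (fun w => h.weight s (e.symm w)) w := by
  have h1 := (h.smooth U s hs e he).contDiffAt
    ((isOpen_chart_preimage hs.isOpen e).mem_nhds ⟨hw, hwU⟩)
  exact (h1.log (h.normSq_pos _ _ (hs.ne_zero _ hwU)).ne').neg

theorem continuousOn_normSq_frame {U : Set X} {s : ∀ x, L x} (hs : IsHolFrame V L U s) :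
    ContinuousOn (fun x => h.normSq x (s x)) U := by
  intro x hx
  apply ContinuousAt.continuousWithinAt
  have he := IsManifold.chart_mem_maximalAtlas (I := 𝓘(ℂ, V)) (n := ω) x
  have hxs : x ∈ (chartAt V x).source := mem_chart_source V x
  have h1 : ContinuousAt (fun w => h.normSq ((chartAt V x).symm w) (s ((chartAt V x).symm w)))
      (chartAt V x x) :=
    ((h.smooth U s hs _ he).contDiffAt ((isOpen_chart_preimage hs.isOpen _).mem_nhds
      ⟨(chartAt V x).map_source hxs, by
        simpa [(chartAt V x).left_inv hxs] using hx⟩)).continuousAt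
  have h2 := h1.comp ((chartAt V x).continuousAt hxs)
  refine h2.congr ?_
  filter_upwards [(chartAt V x).open_source.mem_nhds hxs] with y hy
  simp only [Function.comp_apply]
  rw [(chartAt V x).left_inv hy]

theorem normSq_eq_lineRatio {x : X} (v : L x) {f : L x} (hf : f ≠ 0) :
    h.normSq x v = ‖lineRatio v f‖ ^ 2 * h.normSq x f := by
  rw [← h.normSq_smul, lineRatio_smul v hf]

theorem continuousOn_normSq [ContMDiffVectorBundle ω ℂ L 𝓘(ℂ, V)] {U : Set X} (hU : IsOpen U)
    {s : ∀ x, L x} (hs : IsHolSectionOn V L U s) :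
    ContinuousOn (fun x => h.normSq x (s x)) U := by
  intro x hx
  have hf := isHolFrame_lineFrame V L x
  have hO : IsOpen (U ∩ (trivializationAt ℂ L x).baseSet) := hU.inter hf.isOpen
  have h1 := (hs.contMDiffOn_lineRatio hU hf).continuousOn
  have h2 : ContinuousOn (fun x => h.normSq x (s x)) (U ∩ (trivializationAt ℂ L x).baseSet) :=
    ((h1.norm.pow 2).mul ((h.continuousOn_normSq_frame hf).mono Set.inter_subset_right)).congr
      fun y hy => h.normSq_eq_lineRatio _ (hf.ne_zero y hy.2)
  exact (h2.continuousAt (hO.mem_nhds ⟨hx, mem_baseSet_self x⟩)).continuousWithinAt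

/-- Two weights of the same metric differ by a pluriharmonic function. -/
theorem leviForm_weight_frame [ContMDiffVectorBundle ω ℂ L 𝓘(ℂ, V)] {U U' : Set X}
    {s f : ∀ x, L x} (hs : IsHolFrame V L U s) (hf : IsHolFrame V L U' f)
    {e : OpenPartialHomeomorph X V} (he : e ∈ IsManifold.maximalAtlas 𝓘(ℂ, V) ω X) {w : V}
    (hw : w ∈ e.target) (hwU : e.symm w ∈ U) (hwU' : e.symm w ∈ U') (v : V) :
    leviForm (fun z => h.weight s (e.symm z)) w v =
      leviForm (fun z => h.weight f (e.symm z)) w v := by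
  have hg := ((hs.hol.contMDiffOn_lineRatio hs.isOpen hf).contDiffOn_comp_chart_symm he).contDiffAt
    ((isOpen_chart_preimage (hs.isOpen.inter hf.isOpen) e).mem_nhds ⟨hw, hwU, hwU'⟩)
  have hg2 := hg.of_le (m := 2) le_top
  set g : V → ℂ := fun z => lineRatio (s (e.symm z)) (f (e.symm z)) with hgdef
  have hg0 : g w ≠ 0 := lineRatio_ne_zero (hs.ne_zero _ hwU) (hf.ne_zero _ hwU')
  have hlog : ContDiffAt ℝ 2 (fun z => Real.log (‖g z‖ ^ 2)) w :=
    ((hg2.restrict_scalars ℝ).norm_sq ℂ).log (by positivity)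
  have heq : (fun z => h.weight s (e.symm z)) =ᶠ[𝓝 w]
      fun z => h.weight f (e.symm z) + (-1) * Real.log (‖g z‖ ^ 2) := by
    filter_upwards [(isOpen_chart_preimage (hs.isOpen.inter hf.isOpen) e).mem_nhds
      ⟨hw, hwU, hwU'⟩] with z hz
    have hfz := hf.ne_zero _ hz.2.2
    have hgz : g z ≠ 0 := lineRatio_ne_zero (hs.ne_zero _ hz.2.1) hfz
    simp only [weight]
    rw [h.normSq_eq_lineRatio (s (e.symm z)) hfz,
      Real.log_mul (pow_ne_zero 2 (norm_ne_zero_iff.2 hgz))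
      (h.normSq_pos _ _ hfz).ne']
    ring
  rw [heq.leviForm_eq, leviForm_add
    (contDiffAt_infty.1 (h.contDiffAt_weight hf he hw hwU') 2)
    (contDiffAt_const.mul hlog), leviForm_const_mul hlog, leviForm_log_norm_sq hg2 hg0]
  ring

end HermitianMetric

end HermitianMetrics

/-! ### Tensor powers of a line bundle -/

section Powers

variable {V : Type*} [NormedAddCommGroup V] [NormedSpace ℂ V]
  {X : Type*} [TopologicalSpace X] [ChartedSpace V X]
  (A : X → Type*) [TopologicalSpace (TotalSpace ℂ A)]
  [∀ x, AddCommGroup (A x)] [∀ x, Module ℂ (A x)] [∀ x, TopologicalSpace (A x)]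
  [FiberBundle ℂ A] [VectorBundle ℂ ℂ A]

theorem lineCoord_lineFrame_cocycle {i j x : X} (hi : x ∈ (trivializationAt ℂ A i).baseSet)
    (v : A x) :
    lineCoord A j x (lineFrame A i x) * lineCoord A i x v = lineCoord A j x v := by
  rw [mul_comm, ← smul_eq_mul, ← map_smul, lineCoord_smul_lineFrame hi]

theorem continuousOn_lineCoord_lineFrame (i j : X) :
    ContinuousOn (fun x => lineCoord A j x (lineFrame A i x))
      ((trivializationAt ℂ A i).baseSet ∩ (trivializationAt ℂ A j).baseSet) := by
  have h := VectorBundle.continuousOn_coordChange' (R := ℂ) (trivializationAt ℂ A i)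
    (trivializationAt ℂ A j)
  refine (h.clm_apply (continuousOn_const (c := (1 : ℂ)))).congr fun x hx => ?_
  rw [lineCoord_apply hx.2, lineFrame, Trivialization.coe_symmₗ _ hx.1]
  exact (Trivialization.coordChangeL_apply _ _ hx 1).symm

/-- The `k`-th tensor power of a line bundle, given by its transition functions. -/
def powerCore (k : ℕ) : VectorBundleCore ℂ X ℂ X where
  baseSet i := (trivializationAt ℂ A i).baseSet
  isOpen_baseSet i := (trivializationAt ℂ A i).open_baseSet
  indexAt x := x
  mem_baseSet_at x := mem_baseSet_self x
  coordChange i j x := (lineCoord A j x (lineFrame A i x)) ^ k • ContinuousLinearMap.id ℂ ℂ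
  coordChange_self i x hx v := by simp [lineCoord_lineFrame hx]
  continuousOn_coordChange i j :=
    ((continuousOn_lineCoord_lineFrame A i j).pow k).smul continuousOn_const
  coordChange_comp i j k' x hx v := by
    simp only [smul_apply, ContinuousLinearMap.id_apply, smul_eq_mul]
    rw [← mul_assoc, ← mul_pow, lineCoord_lineFrame_cocycle A hx.1.2]

/-- The fibres of the `k`-th tensor power of a line bundle. -/
abbrev LinePower (k : ℕ) : X → Type := (powerCore A k).Fiber

instance powerCore_isContMDiff [ContMDiffVectorBundle ω ℂ A 𝓘(ℂ, V)] (k : ℕ) :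
    (powerCore A k).IsContMDiff 𝓘(ℂ, V) ω where
  contMDiffOn_coordChange i j := by
    have hi := isHolFrame_lineFrame V A i
    have hO : IsOpen ((trivializationAt ℂ A i).baseSet ∩ (trivializationAt ℂ A j).baseSet) :=
      (trivializationAt ℂ A i).open_baseSet.inter (trivializationAt ℂ A j).open_baseSet
    have h := (isHolSectionOn_iff_lineCoord hO Set.inter_subset_right (lineFrame A i)).1
      (hi.hol.mono Set.inter_subset_left)
    have hc : ContDiff ℂ ω fun z : ℂ => z ^ k • ContinuousLinearMap.id ℂ ℂ := by fun_prop
    exact hc.contMDiff.comp_contMDiffOn h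

variable {A} {k : ℕ}

/-- The `k`-th tensor power `v ⊗ ⋯ ⊗ v` of an element of a line bundle. -/
def linePow (k : ℕ) {x : X} (v : A x) : LinePower A k x :=
  lineCoord A x x v ^ k • lineFrame (LinePower A k) x x

/-- An element of the fibre at `x` is a complex number, read in the trivialization indexed by `x`
itself; passing to the index `i` multiplies it by the power of the transition function. -/
theorem lineCoord_linePower {i x : X} (hx : x ∈ (trivializationAt ℂ A i).baseSet)
    (v : LinePower A k x) : lineCoord (LinePower A k) i x v =
      lineCoord A i x (lineFrame A x x) ^ k * lineCoord (LinePower A k) x x v := by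
  have h1 : ∀ j, x ∈ (trivializationAt ℂ A j).baseSet → lineCoord (LinePower A k) j x v =
      (powerCore A k).coordChange x j x v := fun j hj => by
    rw [lineCoord_apply (L := LinePower A k) hj]
    rfl
  have h2 : lineCoord (LinePower A k) x x v = v :=
    (h1 x (mem_baseSet_self x)).trans
      ((powerCore A k).coordChange_self x x (mem_baseSet_self x) v)
  exact (h1 i hx).trans
    (congrArg (fun z => lineCoord A i x (lineFrame A x x) ^ k * z) h2.symm)

theorem lineCoord_linePow {i x : X} (hx : x ∈ (trivializationAt ℂ A i).baseSet) (v : A x) :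
    lineCoord (LinePower A k) i x (linePow k v) = lineCoord A i x v ^ k := by
  rw [lineCoord_linePower hx, linePow, map_smul,
    lineCoord_lineFrame (mem_baseSet_self (L := LinePower A k) x), smul_eq_mul, mul_one, ← mul_pow,
    lineCoord_lineFrame_cocycle A (mem_baseSet_self x)]

theorem linePow_ne_zero {x : X} {v : A x} (hv : v ≠ 0) : linePow k v ≠ 0 := by
  intro h
  have := lineCoord_linePow (k := k) (mem_baseSet_self x) v
  rw [h, map_zero] at this
  exact pow_ne_zero k (lineCoord_ne_zero (mem_baseSet_self x) hv) this.symm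

variable [ContMDiffVectorBundle ω ℂ A 𝓘(ℂ, V)]

theorem IsHolSectionOn.linePow {U : Set X} (hU : IsOpen U) {s : ∀ x, A x}
    (hs : IsHolSectionOn V A U s) (k : ℕ) :
    IsHolSectionOn V (LinePower A k) U fun x => linePow k (s x) := by
  intro x hx
  have hO : IsOpen (U ∩ (trivializationAt ℂ A x).baseSet) :=
    hU.inter (trivializationAt ℂ A x).open_baseSet
  have h1 := (isHolSectionOn_iff_lineCoord hO (i := x) Set.inter_subset_right s).1
    (hs.mono Set.inter_subset_left)
  have hc : ContDiff ℂ ω fun z : ℂ => z ^ k := by fun_prop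
  have h2 := (isHolSectionOn_iff_lineCoord (V := V) (L := LinePower A k) hO (i := x)
    Set.inter_subset_right fun x => _root_.linePow k (s x)).2
    ((hc.contMDiff.comp_contMDiffOn h1).congr fun y hy => lineCoord_linePow hy.2 _)
  exact (ContMDiffOn.contMDiffAt h2 (hO.mem_nhds ⟨hx, mem_baseSet_self x⟩)).contMDiffWithinAt

theorem IsHolFrame.linePow {U : Set X} {s : ∀ x, A x} (hs : IsHolFrame V A U s) (k : ℕ) :
    IsHolFrame V (LinePower A k) U fun x => linePow k (s x) :=
  ⟨hs.isOpen, hs.hol.linePow hs.isOpen k, fun x hx => linePow_ne_zero (hs.ne_zero x hx)⟩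

end Powers

/-! ### The metrics `h^k e^{-χ}`, and the identity theorem for sections -/

section PowerMetric

variable {V : Type*} [NormedAddCommGroup V] [NormedSpace ℂ V]
  {X : Type*} [TopologicalSpace X] [ChartedSpace V X] [IsManifold 𝓘(ℂ, V) ω X]
  {A : X → Type*} [TopologicalSpace (TotalSpace ℂ A)]
  [∀ x, AddCommGroup (A x)] [∀ x, Module ℂ (A x)] [∀ x, TopologicalSpace (A x)]
  [FiberBundle ℂ A] [VectorBundle ℂ ℂ A] [ContMDiffVectorBundle ω ℂ A 𝓘(ℂ, V)]

variable (V) in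
/-- A real function on a complex manifold which is smooth in all holomorphic charts. -/
def IsChartSmooth (χ : X → ℝ) : Prop :=
  ∀ e ∈ IsManifold.maximalAtlas 𝓘(ℂ, V) ω X, ∀ w ∈ e.target,
    ContDiffAt ℝ ∞ (fun w => χ (e.symm w)) w

theorem isChartSmooth_of_forall_exists {χ : X → ℝ}
    (h : ∀ x, ∃ e ∈ IsManifold.maximalAtlas 𝓘(ℂ, V) ω X, x ∈ e.source ∧
      ContDiffAt ℝ ∞ (fun w => χ (e.symm w)) (e x)) : IsChartSmooth V χ := by
  intro e he w hw
  obtain ⟨e', he', hx, hs⟩ := h (e.symm w)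
  exact contDiffAt_comp_chart_symm_of he he' hw hx hs

theorem isChartSmooth_const (r : ℝ) : IsChartSmooth V fun _ : X => r :=
  fun _ _ _ _ => contDiffAt_const

theorem IsChartSmooth.const_mul {χ : X → ℝ} (h : IsChartSmooth V χ) (r : ℝ) :
    IsChartSmooth V fun x => r * χ x :=
  fun e he w hw => contDiffAt_const.mul (h e he w hw)

namespace HermitianMetric

/-- The squared norm of the metric `h^k e^{-χ}` on the `k`-th power of a line bundle. -/
def powNormSq (h : HermitianMetric V A) (k : ℕ) (χ : X → ℝ) (x : X) (v : LinePower A k x) : ℝ :=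
  ‖lineCoord (LinePower A k) x x v‖ ^ 2 *
    (h.normSq x (lineFrame A x x) ^ k * Real.exp (-χ x))

theorem powNormSq_smul (h : HermitianMetric V A) (k : ℕ) (χ : X → ℝ) (x : X) (c : ℂ)
    (v : LinePower A k x) : h.powNormSq k χ x (c • v) = ‖c‖ ^ 2 * h.powNormSq k χ x v := by
  simp only [powNormSq, map_smul, smul_eq_mul, norm_mul]
  ring

theorem powNormSq_linePow (h : HermitianMetric V A) (k : ℕ) (χ : X → ℝ) (x : X) (v : A x) :
    h.powNormSq k χ x (linePow k v) = h.normSq x v ^ k * Real.exp (-χ x) := by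
  have h1 : h.normSq x v = ‖lineCoord A x x v‖ ^ 2 * h.normSq x (lineFrame A x x) := by
    rw [← h.normSq_smul, lineCoord_smul_lineFrame (mem_baseSet_self x)]
  rw [powNormSq, lineCoord_linePow (mem_baseSet_self x), h1, norm_pow]
  ring

/-- The metric `h^k e^{-χ}` on the `k`-th power of a line bundle. -/
def powMetric (h : HermitianMetric V A) (k : ℕ) {χ : X → ℝ} (hχ : IsChartSmooth V χ) :
    HermitianMetric V (LinePower A k) where
  normSq := h.powNormSq k χ
  normSq_smul := h.powNormSq_smul k χ
  normSq_pos x v hv := by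
    have h1 := lineCoord_ne_zero (L := LinePower A k) (mem_baseSet_self x) hv
    have h2 := h.normSq_pos x _ (lineFrame_ne_zero (L := A) (mem_baseSet_self x))
    unfold powNormSq
    positivity
  smooth U S hS e he := by
    intro w hw
    apply ContDiffAt.contDiffWithinAt
    have ha := isHolFrame_lineFrame V A (e.symm w)
    have hO : IsOpen (U ∩ (trivializationAt ℂ A (e.symm w)).baseSet) := hS.isOpen.inter ha.isOpen
    have hwO : e.symm w ∈ U ∩ (trivializationAt ℂ A (e.symm w)).baseSet :=
      ⟨hw.2, mem_baseSet_self _⟩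
    -- An arbitrary frame of the power is a holomorphic multiple of the power of a local frame of
    -- `A`, for which the norm is explicit.
    have hr := (((hS.hol.contMDiffOn_lineRatio hS.isOpen (ha.linePow k)).contDiffOn_comp_chart_symm
      he).contDiffAt ((isOpen_chart_preimage hO e).mem_nhds ⟨hw.1, hwO⟩)).of_le (m := ∞) le_top
    have hn := (h.smooth _ _ ha e he).contDiffAt
      ((isOpen_chart_preimage ha.isOpen e).mem_nhds ⟨hw.1, hwO.2⟩)
    have hmain := ((hr.restrict_scalars ℝ).norm_sq ℂ).mul ((hn.pow k).mul (hχ e he w hw.1).neg.exp)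
    refine hmain.congr_of_eventuallyEq ?_
    filter_upwards [(isOpen_chart_preimage hO e).mem_nhds ⟨hw.1, hwO⟩] with z hz
    rw [← h.powNormSq_linePow, ← h.powNormSq_smul,
      lineRatio_smul _ ((ha.linePow k).ne_zero _ hz.2.2)]

variable (h : HermitianMetric V A) (k : ℕ) {χ : X → ℝ} (hχ : IsChartSmooth V χ)

theorem powMetric_normSq_linePow (x : X) (v : A x) :
    (h.powMetric k hχ).normSq x (linePow k v) = h.normSq x v ^ k * Real.exp (-χ x) :=
  h.powNormSq_linePow k χ x v

theorem weight_powMetric {s : ∀ x, A x} {x : X} (hs : s x ≠ 0) :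
    (h.powMetric k hχ).weight (fun x => linePow k (s x)) x = k * h.weight s x + χ x := by
  have := h.normSq_pos x _ hs
  rw [weight, powMetric_normSq_linePow, Real.log_mul (by positivity) (by positivity), Real.log_pow,
    Real.log_exp, weight]
  ring

/-- Weights in two frames differ by a pluriharmonic function, so at each point a single frame of `A`
is enough to test the curvature. -/
theorem isSemipositive_powMetric
    (hlevi : ∀ e ∈ IsManifold.maximalAtlas 𝓘(ℂ, V) ω X, ∀ w ∈ e.target,
      ∃ (U : Set X) (f : ∀ x, A x), IsHolFrame V A U f ∧ e.symm w ∈ U ∧ ∀ v,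
        0 ≤ leviForm (fun z => k * h.weight f (e.symm z) + χ (e.symm z)) w v) :
    (h.powMetric k hχ).IsSemipositive := by
  intro U S hS e he w hw v
  obtain ⟨U', f, hf, hwU', hpos⟩ := hlevi e he w hw.1
  rw [leviForm_weight_frame _ hS (hf.linePow k) he hw.1 hw.2 hwU']
  refine (hpos v).trans_eq (Filter.EventuallyEq.leviForm_eq ?_ v)
  filter_upwards [(isOpen_chart_preimage hf.isOpen e).mem_nhds ⟨hw.1, hwU'⟩] with z hz
  exact (h.weight_powMetric k hχ (hf.ne_zero _ hz.2)).symm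

end HermitianMetric

/-- The identity theorem for the coefficient of `s` on a ball in a chart around `x`, which meets the
interior of the zero set. -/
theorem IsHolSectionOn.eventually_eq_zero {s : ∀ x, A x} (hs : IsHolSectionOn V A Set.univ s)
    {x : X} (hx : x ∈ closure (interior {y | s y = 0})) : ∀ᶠ y in 𝓝 x, s y = 0 := by
  set e := chartAt V x
  have he : e ∈ IsManifold.maximalAtlas 𝓘(ℂ, V) ω X := IsManifold.chart_mem_maximalAtlas x
  have hxe : x ∈ e.source := mem_chart_source V x
  have ha := isHolFrame_lineFrame V A x
  set B := (trivializationAt ℂ A x).baseSet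
  have hg := (hs.contMDiffOn_lineRatio isOpen_univ ha).contDiffOn_comp_chart_symm he
  rw [Set.univ_inter] at hg
  set g : V → ℂ := fun w => lineRatio (s (e.symm w)) (lineFrame A x (e.symm w))
  have hO : IsOpen (e.target ∩ e.symm ⁻¹' B) := isOpen_chart_preimage ha.isOpen e
  have hxO : e x ∈ e.target ∩ e.symm ⁻¹' B :=
    ⟨e.map_source hxe, by
      simp only [Set.mem_preimage, e.left_inv hxe]; exact mem_baseSet_self x⟩
  obtain ⟨r, hr, hball⟩ := Metric.isOpen_iff.1 hO _ hxO
  have han : AnalyticOnNhd ℂ g (Metric.ball (e x) r) := fun w hw =>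
    (hg.contDiffAt (hO.mem_nhds (hball hw))).analyticAt
  have hN : e.source ∩ e ⁻¹' Metric.ball (e x) r ∈ 𝓝 x :=
    (e.isOpen_inter_preimage Metric.isOpen_ball).mem_nhds ⟨hxe, Metric.mem_ball_self hr⟩
  obtain ⟨y, hy, hyZ⟩ := mem_closure_iff_nhds.1 hx _ hN
  have hz : g =ᶠ[𝓝 (e y)] 0 := by
    have hc : Filter.Tendsto e.symm (𝓝 (e y)) (𝓝 y) := by
      have := e.continuousAt_symm (e.map_source hy.1)
      rwa [ContinuousAt, e.left_inv hy.1] at this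
    filter_upwards [hc.eventually (mem_interior_iff_mem_nhds.1 hyZ)] with w hw
    have hw : s (e.symm w) = 0 := hw
    simp [g, lineRatio, hw]
  have hzero := han.eqOn_zero_of_preconnected_of_eventuallyEq_zero
    (convex_ball _ _).isPreconnected hy.2 hz
  filter_upwards [hN] with z hz'
  have h1 := hzero hz'.2
  simp only [g, Pi.zero_apply] at h1
  rw [e.left_inv hz'.1] at h1
  have hzB : z ∈ B := by
    have := (hball hz'.2).2
    rwa [Set.mem_preimage, e.left_inv hz'.1] at this
  rw [← lineRatio_smul (s z) (ha.ne_zero z hzB), h1, zero_smul]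

/-- The hypothesis makes the interior of `Z` closed as well as open. This serves both for zeros of
sections and for points without fibre sections. -/
theorem interior_eq_empty_of_closure_subset {Z : Set X} [PreconnectedSpace X]
    (hZ : ∀ x ∈ closure (interior Z), Z ∈ 𝓝 x) (hne : ∃ x, x ∉ Z) : interior Z = ∅ := by
  have hcl : IsClopen (interior Z) := by
    refine ⟨?_, isOpen_interior⟩
    exact isClosed_of_closure_subset fun x hx => mem_interior_iff_mem_nhds.2 (hZ x hx)
  rcases isClopen_iff.1 hcl with h | h
  · exact h
  · obtain ⟨x, hx⟩ := hne
    exact absurd (interior_subset (h ▸ Set.mem_univ x)) hx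

theorem IsHolSectionOn.interior_zeros_eq_empty [PreconnectedSpace X] {s : ∀ x, A x}
    (hs : IsHolSectionOn V A Set.univ s) (hne : ∃ x, s x ≠ 0) : interior {x | s x = 0} = ∅ :=
  interior_eq_empty_of_closure_subset (fun _ hx => hs.eventually_eq_zero hx) hne

end PowerMetric

/-! ### Alternating forms of top degree -/

section AlternatingDet

variable {n : ℕ} {M : Type*} [AddCommGroup M] [Module ℂ M]

/-- An alternating `n`-form on `ℂⁿ` is its value on the standard basis times the determinant. -/
theorem AlternatingMap.apply_linearMap_comp_single (f : (Fin n → ℂ) [⋀^Fin n]→ₗ[ℂ] M)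
    (T : (Fin n → ℂ) →ₗ[ℂ] (Fin n → ℂ)) :
    f (fun i => T (Pi.single i 1)) = LinearMap.det T • f (fun i => Pi.single i 1) := by
  set e := Pi.basisFun ℂ (Fin n)
  have he : (fun i => Pi.single i 1 : Fin n → Fin n → ℂ) = e := by
    funext i; simp [e]
  have hf : f = (LinearMap.toSpanSingleton ℂ M (f e)).compAlternatingMap e.det := by
    refine Module.Basis.ext_alternating e fun i h => ?_
    let σ : Equiv.Perm (Fin n) := Equiv.ofBijective i (Finite.injective_iff_bijective.1 h)
    change f (e ∘ σ) = (LinearMap.toSpanSingleton ℂ M (f e)).compAlternatingMap e.det (e ∘ σ)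
    simp [AlternatingMap.map_perm, Module.Basis.det_self]
  have h1 : (fun i => T (Pi.single i 1)) = T ∘ e := by
    funext i; simp [e]
  rw [h1, he]
  conv_lhs => rw [hf]
  simp [Module.Basis.det_self]

theorem AlternatingMap.eq_zero_of_single {f : (Fin n → ℂ) [⋀^Fin n]→ₗ[ℂ] M}
    (hf : f (fun i => Pi.single i 1) = 0) : f = 0 := by
  ext v
  have h := f.apply_linearMap_comp_single ((Pi.basisFun ℂ (Fin n)).constr ℂ v)
  have h2 : (fun i => (Pi.basisFun ℂ (Fin n)).constr ℂ v (Pi.single i 1)) = v := by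
    funext i
    have := (Pi.basisFun ℂ (Fin n)).constr_basis ℂ v i
    rwa [Pi.basisFun_apply] at this
  rw [h2, hf, smul_zero] at h
  simpa using h

end AlternatingDet

/-! ### Adapted charts and patches of the fibres -/

section Submersion

variable {m n : ℕ}
  {X : Type*} [TopologicalSpace X] [ChartedSpace ((Fin m → ℂ) × (Fin n → ℂ)) X]
  [IsManifold 𝓘(ℂ, (Fin m → ℂ) × (Fin n → ℂ)) ω X]
  {Y : Type*} [TopologicalSpace Y] [ChartedSpace (Fin m → ℂ) Y]
  {p : X → Y}

/-- The normal form of a submersion is a projection from `ℂᵐ` times some complement. Counting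
dimensions, the complement is isomorphic to `ℂⁿ`, and the chart is composed with that isomorphism.
-/
theorem exists_adaptedChart
    (hp : Manifold.IsSubmersion 𝓘(ℂ, (Fin m → ℂ) × (Fin n → ℂ)) 𝓘(ℂ, Fin m → ℂ) ω p) (x : X) :
    ∃ c : AdaptedChart m n p, x ∈ c.top.source := by
  have h := hp.isSubmersionAt x
  have hfin : FiniteDimensional ℂ ((Fin m → ℂ) × h.complement) :=
    h.equiv.toLinearEquiv.finiteDimensional
  have hfinC : FiniteDimensional ℂ h.complement :=
    FiniteDimensional.of_surjective (LinearMap.snd ℂ (Fin m → ℂ) h.complement)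
      LinearMap.snd_surjective
  have hrank : Module.finrank ℂ h.complement = n := by
    have h1 := h.equiv.toLinearEquiv.finrank_eq
    rw [Module.finrank_prod, Module.finrank_prod] at h1
    simp at h1
    omega
  have hrank' : Module.finrank ℂ h.complement = Module.finrank ℂ (Fin n → ℂ) := by
    rw [hrank]; simp
  let F : h.complement ≃L[ℂ] (Fin n → ℂ) := ContinuousLinearEquiv.ofFinrankEq hrank'
  let G : ((Fin m → ℂ) × (Fin n → ℂ)) ≃L[ℂ] ((Fin m → ℂ) × (Fin n → ℂ)) :=
    h.equiv.trans ((ContinuousLinearEquiv.refl ℂ (Fin m → ℂ)).prodCongr F)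
  refine ⟨⟨h.domChart.trans G.toHomeomorph.toOpenPartialHomeomorph, h.codChart, ?_,
    h.codChart_mem_maximalAtlas, ?_, ?_⟩, ?_⟩
  · apply OpenPartialHomeomorph.mem_maximalAtlas_of_contMDiffOn
    · have h1 := contMDiffOn_of_mem_maximalAtlas h.domChart_mem_maximalAtlas
      exact (G.contDiff.contMDiff.comp_contMDiffOn h1).mono (by simp)
    · have h1 := contMDiffOn_symm_of_mem_maximalAtlas h.domChart_mem_maximalAtlas
      exact h1.comp G.symm.contDiff.contMDiff.contMDiffOn (by
        intro w hw
        simpa using hw)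
  · intro y hy
    exact h.source_subset_preimage_source (by simpa using hy)
  · intro y hy
    have hy : y ∈ h.domChart.source := by simpa using hy
    have hmem : h.domChart y ∈ (h.domChart.extend 𝓘(ℂ, (Fin m → ℂ) × (Fin n → ℂ))).target := by
      simpa using h.domChart.map_source hy
    have := h.writtenInCharts hmem
    simp [h.domChart.left_inv hy] at this
    simp [G, this]
  · simpa using h.mem_domChart_source

/-- The patch `z ↦ (t, z)` of the fibre over `y`, where `t` is the coordinate of `y`. -/
def AdaptedChart.patch (c : AdaptedChart m n p) {y : Y} (hy : y ∈ c.base.source) :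
    FibrePatch m n p y where
  dom := {z | (c.base y, z) ∈ c.top.target}
  toFun z := c.top.symm (c.base y, z)
  isOpen_dom := (c.slice (c.base y)).isOpen_dom
  hol := (c.slice (c.base y)).hol
  injOn := (c.slice (c.base y)).injOn
  immersive := (c.slice (c.base y)).immersive
  mem_fibre z hz := ((c.slice (c.base y)).mem_fibre z hz).trans (c.base.left_inv hy)

theorem AdaptedChart.slice_eq_patch (c : AdaptedChart m n p) {t : Fin m → ℂ}
    (ht : t ∈ c.base.target) : c.slice t = c.patch (c.base.map_target ht) := by
  unfold AdaptedChart.slice AdaptedChart.patch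
  have h := c.base.right_inv ht
  congr 1
  · rw [h]
  · rw [h]

theorem AdaptedChart.fst_mem_target (c : AdaptedChart m n p) {w : (Fin m → ℂ) × (Fin n → ℂ)}
    (hw : w ∈ c.top.target) : w.1 ∈ c.base.target := by
  have hx := c.top.map_target hw
  have h := c.base_apply _ hx
  rw [c.top.right_inv hw] at h
  rw [← h]
  exact c.base.map_source (c.mapsTo _ hx)

theorem AdaptedChart.proj_symm (c : AdaptedChart m n p) {w : (Fin m → ℂ) × (Fin n → ℂ)}
    (hw : w ∈ c.top.target) : p (c.top.symm w) = c.base.symm w.1 := by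
  have hx := c.top.map_target hw
  have h := c.base_apply _ hx
  rw [c.top.right_inv hw] at h
  rw [← h, c.base.left_inv (c.mapsTo _ hx)]

theorem FibrePatch.mfderiv_mem_vertical {y : Y} (γ : FibrePatch m n p y) {z : Fin n → ℂ}
    (hz : z ∈ γ.dom) (v : Fin n → ℂ) :
    mfderiv 𝓘(ℂ, Fin n → ℂ) 𝓘(ℂ, (Fin m → ℂ) × (Fin n → ℂ)) γ.toFun z v ∈
      vertical m n p (γ.toFun z) := by
  rw [LinearMap.mem_ker]
  by_cases hp : MDifferentiableAt 𝓘(ℂ, (Fin m → ℂ) × (Fin n → ℂ)) 𝓘(ℂ, Fin m → ℂ) p (γ.toFun z)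
  · have hγ : MDifferentiableAt 𝓘(ℂ, Fin n → ℂ) 𝓘(ℂ, (Fin m → ℂ) × (Fin n → ℂ)) γ.toFun z :=
      ((γ.hol z hz).contMDiffAt (γ.isOpen_dom.mem_nhds hz)).mdifferentiableAt (by simp)
    have hconst : (p ∘ γ.toFun) =ᶠ[𝓝 z] fun _ => y :=
      Filter.eventually_of_mem (γ.isOpen_dom.mem_nhds hz) fun z' hz' => γ.mem_fibre z' hz'
    have h1 := mfderiv_comp z hp hγ
    rw [hconst.mfderiv_eq, mfderiv_const] at h1
    exact (DFunLike.congr_fun h1 v).symm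
  · rw [mfderiv_zero_of_not_mdifferentiableAt hp]
    rfl

/-- The differential of a patch, with values in the vertical tangent space. -/
def FibrePatch.lin {y : Y} (γ : FibrePatch m n p y) {z : Fin n → ℂ} (hz : z ∈ γ.dom) :
    (Fin n → ℂ) →ₗ[ℂ] vertical m n p (γ.toFun z) where
  toFun v := ⟨_, γ.mfderiv_mem_vertical hz v⟩
  map_add' v v' := Subtype.ext (map_add _ v v')
  map_smul' r v := Subtype.ext (map_smul _ r v)

theorem FibrePatch.coeff_eq {y : Y} {M : X → Type*} [∀ x, AddCommGroup (M x)]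
    [∀ x, Module ℂ (M x)] (γ : FibrePatch m n p y) (u : FibreForm (m := m) (n := n) p y M)
    {z : Fin n → ℂ} (hz : z ∈ γ.dom) :
    γ.coeff u z = u ⟨γ.toFun z, γ.mem_fibre z hz⟩ fun i => γ.lin hz (Pi.single i 1) := by
  rw [FibrePatch.coeff, dif_pos hz]
  rfl

/-- The value of a form in a frame transforms by the squared modulus of a determinant. -/
theorem FibreForm.sq_apply_eq {y : Y} {M : X → Type*} [∀ x, AddCommGroup (M x)]
    [∀ x, Module ℂ (M x)] {q : ∀ x, M x → ℝ}
    (hq : ∀ x (r : ℂ) (v : M x), q x (r • v) = ‖r‖ ^ 2 * q x v)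
    (u : FibreForm (m := m) (n := n) p y M) {x x' : p ⁻¹' {y}} (hx : x = x')
    (B : (Fin n → ℂ) →ₗ[ℂ] vertical m n p (x : X))
    (B' : (Fin n → ℂ) →ₗ[ℂ] vertical m n p (x' : X)) (T : (Fin n → ℂ) →ₗ[ℂ] (Fin n → ℂ))
    (hB : ∀ v, ((B v : TangentSpace 𝓘(ℂ, (Fin m → ℂ) × (Fin n → ℂ)) (x : X)) :
      (Fin m → ℂ) × (Fin n → ℂ)) =
      (B' (T v) : TangentSpace 𝓘(ℂ, (Fin m → ℂ) × (Fin n → ℂ)) (x' : X))) :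
    q x (u x fun i => B (Pi.single i 1)) =
      ‖LinearMap.det T‖ ^ 2 * q x' (u x' fun i => B' (Pi.single i 1)) := by
  subst hx
  have h : B = B' ∘ₗ T := LinearMap.ext fun v => Subtype.ext (hB v)
  have h2 := ((u x).compLinearMap B').apply_linearMap_comp_single T
  rw [← hq, h]
  exact congrArg _ h2

/-- The fibre coordinate of an adapted chart, in a patch. -/
def AdaptedChart.trans (c : AdaptedChart m n p) {y : Y} (γ : FibrePatch m n p y)
    (z : Fin n → ℂ) : Fin n → ℂ :=
  (c.top (γ.toFun z)).2

/-- The points of a patch which an adapted chart maps into `S`. -/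
def AdaptedChart.transDom (c : AdaptedChart m n p) {y : Y} (γ : FibrePatch m n p y)
    (S : Set (Fin n → ℂ)) : Set (Fin n → ℂ) :=
  {z | z ∈ γ.dom ∧ γ.toFun z ∈ c.top.source ∧ c.trans γ z ∈ S}

section Trans

variable (c : AdaptedChart m n p) {y : Y} (γ : FibrePatch m n p y)

theorem AdaptedChart.top_eq {z : Fin n → ℂ} (hz : z ∈ γ.dom) (hc : γ.toFun z ∈ c.top.source) :
    c.top (γ.toFun z) = (c.base y, c.trans γ z) := by
  refine Prod.ext ?_ rfl
  rw [← c.base_apply _ hc, γ.mem_fibre z hz]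

theorem AdaptedChart.toFun_eq {z : Fin n → ℂ} (hz : z ∈ γ.dom) (hc : γ.toFun z ∈ c.top.source) :
    γ.toFun z = c.top.symm (c.base y, c.trans γ z) := by
  rw [← c.top_eq γ hz hc, c.top.left_inv hc]

theorem AdaptedChart.trans_mem_dom {z : Fin n → ℂ} (hz : z ∈ γ.dom)
    (hc : γ.toFun z ∈ c.top.source) (hy : y ∈ c.base.source) :
    c.trans γ z ∈ (c.patch hy).dom := by
  change (c.base y, c.trans γ z) ∈ c.top.target
  rw [← c.top_eq γ hz hc]
  exact c.top.map_source hc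

theorem AdaptedChart.isOpen_transDom_univ : IsOpen {z | z ∈ γ.dom ∧ γ.toFun z ∈ c.top.source} :=
  γ.hol.continuousOn.isOpen_inter_preimage γ.isOpen_dom c.top.open_source

theorem AdaptedChart.differentiableOn_trans :
    DifferentiableOn ℂ (c.trans γ) {z | z ∈ γ.dom ∧ γ.toFun z ∈ c.top.source} := by
  have h : ContMDiffOn 𝓘(ℂ, Fin n → ℂ) 𝓘(ℂ, (Fin m → ℂ) × (Fin n → ℂ)) ω
      (c.top ∘ γ.toFun) {z | z ∈ γ.dom ∧ γ.toFun z ∈ c.top.source} :=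
    (contMDiffOn_of_mem_maximalAtlas c.top_mem).comp (γ.hol.mono fun z hz => hz.1)
      fun z hz => hz.2
  exact (contDiff_snd.comp_contDiffOn (contMDiffOn_iff_contDiffOn.1 h)).differentiableOn (by simp)

theorem AdaptedChart.isOpen_transDom {S : Set (Fin n → ℂ)} (hS : IsOpen S) :
    IsOpen (c.transDom γ S) := by
  have := (c.differentiableOn_trans γ).continuousOn.isOpen_inter_preimage
    (c.isOpen_transDom_univ γ) hS
  convert this using 1
  ext z
  exact and_assoc.symm

theorem AdaptedChart.injOn_trans :
    Set.InjOn (c.trans γ) {z | z ∈ γ.dom ∧ γ.toFun z ∈ c.top.source} := fun z hz z' hz' h => by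
  refine γ.injOn hz.1 hz'.1 ?_
  rw [c.toFun_eq γ hz.1 hz.2, c.toFun_eq γ hz'.1 hz'.2, h]

theorem AdaptedChart.mfderiv_eq {z : Fin n → ℂ} (hz : z ∈ γ.dom)
    (hc : γ.toFun z ∈ c.top.source) (hy : y ∈ c.base.source) (v : Fin n → ℂ) :
    (mfderiv 𝓘(ℂ, Fin n → ℂ) 𝓘(ℂ, (Fin m → ℂ) × (Fin n → ℂ)) γ.toFun z v :
      (Fin m → ℂ) × (Fin n → ℂ)) =
    (mfderiv 𝓘(ℂ, Fin n → ℂ) 𝓘(ℂ, (Fin m → ℂ) × (Fin n → ℂ)) (c.patch hy).toFun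
      (c.trans γ z) (fderiv ℂ (c.trans γ) z v) : (Fin m → ℂ) × (Fin n → ℂ)) := by
  have hU := c.isOpen_transDom_univ γ
  have heq : γ.toFun =ᶠ[𝓝 z] (c.patch hy).toFun ∘ c.trans γ :=
    Filter.eventually_of_mem (hU.mem_nhds ⟨hz, hc⟩) fun z' hz' => c.toFun_eq γ hz'.1 hz'.2
  have hd := ((c.differentiableOn_trans γ).differentiableAt
    (hU.mem_nhds ⟨hz, hc⟩)).mdifferentiableAt
  have hm := c.trans_mem_dom γ hz hc hy
  have hp : MDifferentiableAt 𝓘(ℂ, Fin n → ℂ) 𝓘(ℂ, (Fin m → ℂ) × (Fin n → ℂ))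
      (c.patch hy).toFun (c.trans γ z) :=
    (((c.patch hy).hol _ hm).contMDiffAt ((c.patch hy).isOpen_dom.mem_nhds hm)).mdifferentiableAt
      (by simp)
  have h1 := mfderiv_comp z hp hd
  rw [← heq.mfderiv_eq, mfderiv_eq_fderiv] at h1
  exact DFunLike.congr_fun h1 v

theorem AdaptedChart.sq_coeff_eq {M : X → Type*} [∀ x, AddCommGroup (M x)]
    [∀ x, Module ℂ (M x)] {q : ∀ x, M x → ℝ}
    (hq : ∀ x (r : ℂ) (v : M x), q x (r • v) = ‖r‖ ^ 2 * q x v)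
    (u : FibreForm (m := m) (n := n) p y M) {z : Fin n → ℂ} (hz : z ∈ γ.dom)
    (hc : γ.toFun z ∈ c.top.source) (hy : y ∈ c.base.source) :
    q (γ.toFun z) (γ.coeff u z) = ‖(fderiv ℂ (c.trans γ) z).det‖ ^ 2 *
      q ((c.patch hy).toFun (c.trans γ z)) ((c.patch hy).coeff u (c.trans γ z)) := by
  have hm := c.trans_mem_dom γ hz hc hy
  rw [γ.coeff_eq u hz, (c.patch hy).coeff_eq u hm]
  have h := FibreForm.sq_apply_eq hq u (x := ⟨γ.toFun z, γ.mem_fibre z hz⟩)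
    (x' := ⟨(c.patch hy).toFun (c.trans γ z), (c.patch hy).mem_fibre _ hm⟩)
    (Subtype.ext (c.toFun_eq γ hz hc)) (γ.lin hz) ((c.patch hy).lin hm)
    (fderiv ℂ (c.trans γ) z).toLinearMap fun v => c.mfderiv_eq γ hz hc hy v
  rw [ContinuousLinearMap.det]
  exact h

end Trans

end Submersion

/-! ### Change of variables and comparison of `L²` norms on fibres -/

section FibreIntegral

open MeasureTheory

theorem ContinuousLinearMap.abs_det_restrictScalars {n : ℕ}
    (T : (Fin n → ℂ) →L[ℂ] (Fin n → ℂ)) : |(T.restrictScalars ℝ).det| = ‖T.det‖ ^ 2 := by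
  have h := LinearMap.det_restrictScalars (R := ℝ) (f := T.toLinearMap)
  rw [Algebra.norm_complex_apply, Complex.normSq_eq_norm_sq] at h
  change |LinearMap.det (T.toLinearMap.restrictScalars ℝ)| = _
  rw [h, abs_of_nonneg (by positivity)]

variable {m n : ℕ}
  {X : Type*} [TopologicalSpace X] [ChartedSpace ((Fin m → ℂ) × (Fin n → ℂ)) X]
  [IsManifold 𝓘(ℂ, (Fin m → ℂ) × (Fin n → ℂ)) ω X]
  {Y : Type*} [TopologicalSpace Y] [ChartedSpace (Fin m → ℂ) Y]
  {p : X → Y} {M : X → Type*} [∀ x, AddCommGroup (M x)] [∀ x, Module ℂ (M x)]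
  {y : Y}

theorem AdaptedChart.measurableSet_image_transDom (c : AdaptedChart m n p)
    (γ : FibrePatch m n p y) {S : Set (Fin n → ℂ)} (hS : IsOpen S) :
    MeasurableSet (c.trans γ '' c.transDom γ S) := by
  have hsub : c.transDom γ S ⊆ {z | z ∈ γ.dom ∧ γ.toFun z ∈ c.top.source} :=
    fun z hz => ⟨hz.1, hz.2.1⟩
  exact (c.isOpen_transDom γ hS).measurableSet.image_of_continuousOn_injOn
    ((c.differentiableOn_trans γ).continuousOn.mono hsub) ((c.injOn_trans γ).mono hsub)

/-- The squared modulus of the complex Jacobian, by which `|u|²` transforms, is the real Jacobian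
determinant of the change of variables. -/
theorem AdaptedChart.lintegral_transDom_eq {q : ∀ x, M x → ℝ}
    (hq : ∀ x (r : ℂ) (v : M x), q x (r • v) = ‖r‖ ^ 2 * q x v)
    (u : FibreForm (m := m) (n := n) p y M) (c : AdaptedChart m n p) (hy : y ∈ c.base.source)
    (γ : FibrePatch m n p y) {S : Set (Fin n → ℂ)} (hS : IsOpen S) :
    ∫⁻ z in c.transDom γ S, ENNReal.ofReal (q (γ.toFun z) (γ.coeff u z)) =
      ∫⁻ w in c.trans γ '' c.transDom γ S,
        ENNReal.ofReal (q ((c.patch hy).toFun w) ((c.patch hy).coeff u w)) := by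
  have hsub : c.transDom γ S ⊆ {z | z ∈ γ.dom ∧ γ.toFun z ∈ c.top.source} :=
    fun z hz => ⟨hz.1, hz.2.1⟩
  have hmeas := (c.isOpen_transDom γ hS).measurableSet
  rw [lintegral_image_eq_lintegral_abs_det_fderiv_mul volume hmeas
    (f' := fun z => (fderiv ℂ (c.trans γ) z).restrictScalars ℝ) ?_ ((c.injOn_trans γ).mono hsub)]
  · refine setLIntegral_congr_fun hmeas fun z hz => ?_
    rw [ContinuousLinearMap.abs_det_restrictScalars, ← ENNReal.ofReal_mul (by positivity)]
    exact congrArg _ (c.sq_coeff_eq γ hq u hz.1 hz.2.1 hy)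
  · intro z hz
    exact ((((c.differentiableOn_trans γ).differentiableAt
      ((c.isOpen_transDom_univ γ).mem_nhds
        (hsub hz))).hasFDerivAt).restrictScalars ℝ).hasFDerivWithinAt

/-- Disjoint patches have disjoint images in the fibre coordinate of the chart, and all of these lie
in `S`. -/
theorem AdaptedChart.sum_lintegral_transDom_le {q : ∀ x, M x → ℝ}
    (hq : ∀ x (r : ℂ) (v : M x), q x (r • v) = ‖r‖ ^ 2 * q x v)
    (u : FibreForm (m := m) (n := n) p y M) (c : AdaptedChart m n p) (hy : y ∈ c.base.source)
    {k : ℕ} {γ : Fin k → FibrePatch m n p y}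
    (hγ : Pairwise fun i j =>
      Disjoint ((γ i).toFun '' (γ i).dom) ((γ j).toFun '' (γ j).dom))
    {S : Set (Fin n → ℂ)} (hS : IsOpen S) :
    ∑ i, ∫⁻ z in c.transDom (γ i) S, ENNReal.ofReal (q ((γ i).toFun z) ((γ i).coeff u z)) ≤
      ∫⁻ w in S, ENNReal.ofReal (q ((c.patch hy).toFun w) ((c.patch hy).coeff u w)) := by
  simp_rw [c.lintegral_transDom_eq hq u hy _ hS]
  rw [← lintegral_biUnion_finset]
  · refine lintegral_mono_set ?_
    simp only [Finset.mem_univ, Set.iUnion_true, Set.iUnion_subset_iff]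
    rintro i _ ⟨z, hz, rfl⟩
    exact hz.2.2
  · intro i _ j _ hij
    refine Set.disjoint_left.2 ?_
    rintro _ ⟨z, hz, rfl⟩ ⟨z', hz', h⟩
    refine Set.disjoint_left.1 (hγ hij) ⟨z, hz.1, rfl⟩ ⟨z', hz'.1, ?_⟩
    rw [c.toFun_eq _ hz.1 hz.2.1, c.toFun_eq _ hz'.1 hz'.2.1, h]
  · exact fun i _ => c.measurableSet_image_transDom (γ i) hS

theorem lintegral_le_fibreNormSq (q : ∀ x, M x → ℝ) (u : FibreForm (m := m) (n := n) p y M)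
    (γ : FibrePatch m n p y) :
    ∫⁻ z in γ.dom, ENNReal.ofReal (q (γ.toFun z) (γ.coeff u z)) ≤ fibreNormSq q u := by
  have h : Pairwise fun i j : Fin 1 =>
      Disjoint (((fun _ => γ) i).toFun '' ((fun _ => γ) i).dom)
        (((fun _ => γ) j).toFun '' ((fun _ => γ) j).dom) :=
    fun i j hij => absurd (Subsingleton.elim i j) hij
  refine le_trans ?_ (le_iSup_of_le 1 (le_iSup₂_of_le (fun _ => γ) h le_rfl))
  simp

/-- Comparison of two `L²` norms, outside a piece `S` of a slice. -/
theorem fibreNormSq_le_add {M' : X → Type*} [∀ x, AddCommGroup (M' x)] [∀ x, Module ℂ (M' x)]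
    {q : ∀ x, M x → ℝ} (hq : ∀ x (r : ℂ) (v : M x), q x (r • v) = ‖r‖ ^ 2 * q x v)
    (u : FibreForm (m := m) (n := n) p y M)
    (q' : ∀ x, M' x → ℝ) (u' : FibreForm (m := m) (n := n) p y M')
    (c : AdaptedChart m n p) (hy : y ∈ c.base.source) {S : Set (Fin n → ℂ)} (hS : IsOpen S)
    {C : ℝ≥0∞} (hC : ∀ (γ : FibrePatch m n p y), ∀ z ∈ γ.dom, z ∉ c.transDom γ S →
      ENNReal.ofReal (q (γ.toFun z) (γ.coeff u z)) ≤
        C * ENNReal.ofReal (q' (γ.toFun z) (γ.coeff u' z)))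
    (hCtop : C ≠ ⊤) :
    fibreNormSq q u ≤
      (∫⁻ w in S, ENNReal.ofReal (q ((c.patch hy).toFun w) ((c.patch hy).coeff u w))) +
        C * fibreNormSq q' u' := by
  refine iSup_le fun k => iSup₂_le fun γ hγ => ?_
  calc ∑ i, ∫⁻ z in (γ i).dom, ENNReal.ofReal (q ((γ i).toFun z) ((γ i).coeff u z))
      ≤ ∑ i, ((∫⁻ z in c.transDom (γ i) S,
            ENNReal.ofReal (q ((γ i).toFun z) ((γ i).coeff u z))) +
          C * ∫⁻ z in (γ i).dom, ENNReal.ofReal (q' ((γ i).toFun z) ((γ i).coeff u' z))) := by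
        refine Finset.sum_le_sum fun i _ => ?_
        have h1 : (γ i).dom ⊆ c.transDom (γ i) S ∪ ((γ i).dom \ c.transDom (γ i) S) := by
          intro z hz
          by_cases h : z ∈ c.transDom (γ i) S
          exacts [Or.inl h, Or.inr ⟨hz, h⟩]
        refine (lintegral_mono_set h1).trans ((lintegral_union_le _ _ _).trans ?_)
        gcongr
        rw [← lintegral_const_mul' _ _ hCtop]
        refine (setLIntegral_mono' ((γ i).isOpen_dom.measurableSet.diff
          (c.isOpen_transDom (γ i) hS).measurableSet) fun z hz =>
            hC (γ i) z hz.1 hz.2).trans ?_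
        exact lintegral_mono_set Set.sdiff_subset
    _ ≤ _ := by
        rw [Finset.sum_add_distrib, ← Finset.mul_sum]
        gcongr
        · exact c.sum_lintegral_transDom_le hq u hy hγ hS
        · exact le_iSup_of_le k (le_iSup₂_of_le γ hγ le_rfl)

theorem fibreNormSq_le_mul {M' : X → Type*} [∀ x, AddCommGroup (M' x)] [∀ x, Module ℂ (M' x)]
    {q : ∀ x, M x → ℝ} (u : FibreForm (m := m) (n := n) p y M)
    (q' : ∀ x, M' x → ℝ) (u' : FibreForm (m := m) (n := n) p y M')
    {C : ℝ≥0∞} (hC : ∀ (γ : FibrePatch m n p y), ∀ z ∈ γ.dom,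
      ENNReal.ofReal (q (γ.toFun z) (γ.coeff u z)) ≤
        C * ENNReal.ofReal (q' (γ.toFun z) (γ.coeff u' z)))
    (hCtop : C ≠ ⊤) : fibreNormSq q u ≤ C * fibreNormSq q' u' := by
  refine iSup_le fun k => iSup₂_le fun γ hγ => ?_
  refine le_trans ?_ (mul_le_mul_right (le_iSup_of_le k (le_iSup₂_of_le γ hγ le_rfl)) C)
  rw [Finset.mul_sum]
  refine Finset.sum_le_sum fun i _ => ?_
  rw [← lintegral_const_mul' _ _ hCtop]
  exact setLIntegral_mono' (γ i).isOpen_dom.measurableSet fun z hz => hC (γ i) z hz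

/-- The `L²` norm is at most the sum of the integrals over slices that cover the fibre. -/
theorem fibreNormSq_le_sum {q : ∀ x, M x → ℝ}
    (hq : ∀ x (r : ℂ) (v : M x), q x (r • v) = ‖r‖ ^ 2 * q x v)
    (u : FibreForm (m := m) (n := n) p y M) {ι : Type*} (J : Finset ι)
    (c : ι → AdaptedChart m n p) (hy : ∀ j, y ∈ (c j).base.source) (S : ι → Set (Fin n → ℂ))
    (hS : ∀ j, IsOpen (S j))
    (hcov : ∀ x, p x = y → ∃ j ∈ J, x ∈ (c j).top.source ∧ ((c j).top x).2 ∈ S j) :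
    fibreNormSq q u ≤ ∑ j ∈ J, ∫⁻ w in S j,
      ENNReal.ofReal (q (((c j).patch (hy j)).toFun w) (((c j).patch (hy j)).coeff u w)) := by
  refine iSup_le fun k => iSup₂_le fun γ hγ => ?_
  calc ∑ i, ∫⁻ z in (γ i).dom, ENNReal.ofReal (q ((γ i).toFun z) ((γ i).coeff u z))
      ≤ ∑ i, ∑ j ∈ J, ∫⁻ z in (c j).transDom (γ i) (S j),
            ENNReal.ofReal (q ((γ i).toFun z) ((γ i).coeff u z)) := by
        refine Finset.sum_le_sum fun i _ => ?_
        have h1 : (γ i).dom ⊆ ⋃ j ∈ (J : Set ι), (c j).transDom (γ i) (S j) := by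
          intro z hz
          obtain ⟨j, hj, hx, hw⟩ := hcov _ ((γ i).mem_fibre z hz)
          exact Set.mem_biUnion (show j ∈ (J : Set ι) from hj) ⟨hz, hx, hw⟩
        refine (lintegral_mono_set h1).trans ?_
        rw [show (⋃ j ∈ (J : Set ι), (c j).transDom (γ i) (S j)) =
          ⋃ j : J, (c j).transDom (γ i) (S j) from Set.biUnion_eq_iUnion _ _]
        refine (lintegral_iUnion_le _ _).trans ?_
        rw [tsum_fintype, Finset.sum_coe_sort J fun j => ∫⁻ z in (c j).transDom (γ i) (S j),
            ENNReal.ofReal (q ((γ i).toFun z) ((γ i).coeff u z))]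
    _ ≤ _ := by
        rw [Finset.sum_comm]
        exact Finset.sum_le_sum fun j _ => (c j).sum_lintegral_transDom_le hq u (hy j) hγ (hS j)

end FibreIntegral

/-! ### Coefficients of forms in a patch -/

section Forms

open MeasureTheory

variable {m n : ℕ}
  {X : Type*} [TopologicalSpace X] [ChartedSpace ((Fin m → ℂ) × (Fin n → ℂ)) X]
  [IsManifold 𝓘(ℂ, (Fin m → ℂ) × (Fin n → ℂ)) ω X]
  {Y : Type*} [TopologicalSpace Y] [ChartedSpace (Fin m → ℂ) Y]
  {p : X → Y} {y : Y}

section Algebra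

variable {M : X → Type*} [∀ x, AddCommGroup (M x)] [∀ x, Module ℂ (M x)]
  {N : X → Type*} [∀ x, AddCommGroup (N x)] [∀ x, Module ℂ (N x)]

/-- The image of a form under a homomorphism of the coefficients. -/
def FibreForm.map (F : ∀ x, M x →ₗ[ℂ] N x) (u : FibreForm (m := m) (n := n) p y M) :
    FibreForm (m := m) (n := n) p y N :=
  fun x => (F x).compAlternatingMap (u x)

theorem FibrePatch.coeff_map (F : ∀ x, M x →ₗ[ℂ] N x) (u : FibreForm (m := m) (n := n) p y M)
    (γ : FibrePatch m n p y) (z : Fin n → ℂ) :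
    γ.coeff (u.map F) z = F (γ.toFun z) (γ.coeff u z) := by
  by_cases hz : z ∈ γ.dom
  · rw [FibrePatch.coeff, FibrePatch.coeff, dif_pos hz, dif_pos hz]
    rfl
  · rw [FibrePatch.coeff, FibrePatch.coeff, dif_neg hz, dif_neg hz, map_zero]

/-- In an adapted chart `p` is the first projection, so a vertical vector has vanishing first
component and is the image of its second one. -/
theorem AdaptedChart.patch_lin_surjective
    (hp : ContMDiff 𝓘(ℂ, (Fin m → ℂ) × (Fin n → ℂ)) 𝓘(ℂ, Fin m → ℂ) ω p)
    (c : AdaptedChart m n p) (hy : y ∈ c.base.source)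
    {z : Fin n → ℂ} (hz : z ∈ (c.patch hy).dom) :
    Function.Surjective ((c.patch hy).lin hz) := by
  rintro ⟨v, hv⟩
  let x := (c.patch hy).toFun z
  have hzt : (c.base y, z) ∈ c.top.target := hz
  have hxs : x ∈ c.top.source := c.top.map_target hzt
  have hcx : c.top x = (c.base y, z) := c.top.right_inv hzt
  have htop : MDifferentiableAt 𝓘(ℂ, (Fin m → ℂ) × (Fin n → ℂ))
      𝓘(ℂ, (Fin m → ℂ) × (Fin n → ℂ)) c.top x :=
    (contMDiffAt_of_mem_maximalAtlas c.top_mem hxs).mdifferentiableAt (by simp)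
  have hsymm : MDifferentiableAt 𝓘(ℂ, (Fin m → ℂ) × (Fin n → ℂ))
      𝓘(ℂ, (Fin m → ℂ) × (Fin n → ℂ)) c.top.symm (c.top x) :=
    ((contMDiffOn_symm_of_mem_maximalAtlas c.top_mem _ (c.top.map_source hxs)).contMDiffAt
      (c.top.open_target.mem_nhds (c.top.map_source hxs))).mdifferentiableAt (by simp)
  have hpx : MDifferentiableAt 𝓘(ℂ, (Fin m → ℂ) × (Fin n → ℂ)) 𝓘(ℂ, Fin m → ℂ) p x :=
    (hp x).mdifferentiableAt (by simp)
  have hpxs := c.mapsTo x hxs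
  have hbase : MDifferentiableAt 𝓘(ℂ, Fin m → ℂ) 𝓘(ℂ, Fin m → ℂ) c.base (p x) :=
    (contMDiffAt_of_mem_maximalAtlas c.base_mem hpxs).mdifferentiableAt (by simp)
  have hfst : MDifferentiableAt 𝓘(ℂ, (Fin m → ℂ) × (Fin n → ℂ)) 𝓘(ℂ, Fin m → ℂ)
      (Prod.fst : (Fin m → ℂ) × (Fin n → ℂ) → (Fin m → ℂ)) (c.top x) :=
    differentiableAt_fst.mdifferentiableAt
  let w : (Fin m → ℂ) × (Fin n → ℂ) := mfderiv 𝓘(ℂ, (Fin m → ℂ) × (Fin n → ℂ))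
    𝓘(ℂ, (Fin m → ℂ) × (Fin n → ℂ)) c.top x v
  have hw1 : w.1 = 0 := by
    have h1 := mfderiv_comp x hbase hpx
    have h2 := mfderiv_comp x hfst htop
    have heq : c.base ∘ p =ᶠ[𝓝 x] Prod.fst ∘ c.top :=
      Filter.eventually_of_mem (c.top.open_source.mem_nhds hxs) fun x' hx' => c.base_apply x' hx'
    rw [heq.mfderiv_eq, h2, mfderiv_eq_fderiv, fderiv_fst] at h1
    have h3 := DFunLike.congr_fun h1 v
    refine Eq.trans h3 ?_
    have hv' : mfderiv 𝓘(ℂ, (Fin m → ℂ) × (Fin n → ℂ)) 𝓘(ℂ, Fin m → ℂ) p x v = 0 := hv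
    change mfderiv 𝓘(ℂ, Fin m → ℂ) 𝓘(ℂ, Fin m → ℂ) c.base (p x)
      (mfderiv 𝓘(ℂ, (Fin m → ℂ) × (Fin n → ℂ)) 𝓘(ℂ, Fin m → ℂ) p x v) = 0
    rw [hv', map_zero]
  have hvw : (v : (Fin m → ℂ) × (Fin n → ℂ)) = mfderiv 𝓘(ℂ, (Fin m → ℂ) × (Fin n → ℂ))
      𝓘(ℂ, (Fin m → ℂ) × (Fin n → ℂ)) c.top.symm (c.top x) w := by
    have h1 := mfderiv_comp x hsymm htop
    have heq : c.top.symm ∘ c.top =ᶠ[𝓝 x] id :=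
      Filter.eventually_of_mem (c.top.open_source.mem_nhds hxs) fun x' hx' => c.top.left_inv hx'
    rw [heq.mfderiv_eq, mfderiv_id] at h1
    exact DFunLike.congr_fun h1 v
  refine ⟨w.2, Subtype.ext ?_⟩
  have hin : MDifferentiableAt 𝓘(ℂ, Fin n → ℂ) 𝓘(ℂ, (Fin m → ℂ) × (Fin n → ℂ))
      (fun z : Fin n → ℂ => (c.base y, z)) z :=
    (hasFDerivAt_prodMk_right (c.base y) z).differentiableAt.mdifferentiableAt
  have hsymm' : MDifferentiableAt 𝓘(ℂ, (Fin m → ℂ) × (Fin n → ℂ))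
      𝓘(ℂ, (Fin m → ℂ) × (Fin n → ℂ)) c.top.symm ((fun z : Fin n → ℂ => (c.base y, z)) z) := by
    rw [hcx] at hsymm
    exact hsymm
  have h1 := mfderiv_comp z hsymm' hin
  rw [mfderiv_eq_fderiv, (hasFDerivAt_prodMk_right (c.base y) z).fderiv] at h1
  have h2 := DFunLike.congr_fun h1 w.2
  refine Eq.trans h2 ?_
  have hw : w = (0, w.2) := Prod.ext hw1 rfl
  rw [hcx, hw] at hvw
  exact hvw.symm

theorem AdaptedChart.coeff_patch_ne_zero
    (hp : ContMDiff 𝓘(ℂ, (Fin m → ℂ) × (Fin n → ℂ)) 𝓘(ℂ, Fin m → ℂ) ω p)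
    (c : AdaptedChart m n p) (hy : y ∈ c.base.source)
    {z : Fin n → ℂ} (hz : z ∈ (c.patch hy).dom) (u : FibreForm (m := m) (n := n) p y M)
    (hu : u ⟨_, (c.patch hy).mem_fibre z hz⟩ ≠ 0) : (c.patch hy).coeff u z ≠ 0 := by
  intro h
  rw [(c.patch hy).coeff_eq u hz] at h
  have h2 : (u ⟨_, (c.patch hy).mem_fibre z hz⟩).compLinearMap ((c.patch hy).lin hz) = 0 :=
    AlternatingMap.eq_zero_of_single h
  refine hu (AlternatingMap.ext fun v => ?_)
  choose v' hv' using fun i => c.patch_lin_surjective hp hy hz (v i)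
  have h3 := DFunLike.congr_fun h2 v'
  rw [← funext hv']
  exact h3

end Algebra

end Forms

/-! ### The tensor product of two lines -/

section TensorLines

variable {V : Type*} [NormedAddCommGroup V] [NormedSpace ℂ V]
  {X : Type*} [TopologicalSpace X] [ChartedSpace V X]
  {L : X → Type*} [TopologicalSpace (TotalSpace ℂ L)]
  [∀ x, AddCommGroup (L x)] [∀ x, Module ℂ (L x)] [∀ x, TopologicalSpace (L x)]
  [FiberBundle ℂ L] [VectorBundle ℂ ℂ L]
  {E : X → Type*} [TopologicalSpace (TotalSpace ℂ E)]
  [∀ x, AddCommGroup (E x)] [∀ x, Module ℂ (E x)] [∀ x, TopologicalSpace (E x)]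
  [FiberBundle ℂ E] [VectorBundle ℂ ℂ E]

theorem exists_eq_tmul {x : X} (v : L x ⊗[ℂ] E x) : ∃ (l : L x) (e : E x), v = l ⊗ₜ[ℂ] e := by
  suffices h : ∃ r : ℂ, v = r • (lineFrame L x x ⊗ₜ[ℂ] lineFrame E x x) by
    obtain ⟨r, rfl⟩ := h
    exact ⟨_, _, TensorProduct.smul_tmul' _ _ _⟩
  induction v using TensorProduct.induction_on with
  | zero => exact ⟨0, by rw [zero_smul]⟩
  | tmul l e =>
    refine ⟨lineCoord L x x l * lineCoord E x x e, ?_⟩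
    conv_lhs => rw [← lineCoord_smul_lineFrame (mem_baseSet_self x) l,
      ← lineCoord_smul_lineFrame (mem_baseSet_self x) e]
    rw [TensorProduct.smul_tmul_smul]
  | add v w hv hw =>
    obtain ⟨r, rfl⟩ := hv
    obtain ⟨r', rfl⟩ := hw
    exact ⟨r + r', by rw [add_smul]⟩

theorem tensorNormSq_smul (h : HermitianMetric V L) (k : HermitianMetric V E) (x : X) (r : ℂ)
    (v : L x ⊗[ℂ] E x) : tensorNormSq h k x (r • v) = ‖r‖ ^ 2 * tensorNormSq h k x v := by
  obtain ⟨l, e, rfl⟩ := exists_eq_tmul v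
  rw [TensorProduct.smul_tmul', tensorNormSq_tmul, tensorNormSq_tmul, h.normSq_smul, mul_assoc]

/-- The contraction of the second factor of `L ⊗ E` with the dual of `e`. -/
def contractLine {x : X} (e : E x) : L x ⊗[ℂ] E x →ₗ[ℂ] L x :=
  (TensorProduct.rid ℂ (L x)).toLinearMap ∘ₗ
    ((lineCoord E x x e)⁻¹ • lineCoord E x x).lTensor (L x)

theorem contractLine_tmul {x : X} {e : E x} (he : e ≠ 0) (l : L x) :
    contractLine e (l ⊗ₜ[ℂ] e) = l := by
  have h := lineCoord_ne_zero (mem_baseSet_self x) he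
  simp [contractLine, h]

end TensorLines

/-! ### Holomorphic forms on fibres: twisting and finiteness of the `L²` norm -/

section HolForms

open MeasureTheory

variable {m n : ℕ}
  {X : Type*} [TopologicalSpace X] [ChartedSpace ((Fin m → ℂ) × (Fin n → ℂ)) X]
  [IsManifold 𝓘(ℂ, (Fin m → ℂ) × (Fin n → ℂ)) ω X]
  {Y : Type*} [TopologicalSpace Y] [ChartedSpace (Fin m → ℂ) Y]
  {p : X → Y} {y : Y}

section General

variable {M : X → Type*} [∀ x, AddCommGroup (M x)] [∀ x, Module ℂ (M x)]
  {Fr : Set X → (∀ x, M x) → Prop} {q : ∀ x, M x → ℝ}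

theorem log_le_bergmanWeight (hq : ∀ x (r : ℂ) (v : M x), q x (r • v) = ‖r‖ ^ 2 * q x v)
    (c : AdaptedChart m n p) (s : ∀ x, M x) (w : (Fin m → ℂ) × (Fin n → ℂ))
    {u : FibreForm (m := m) (n := n) p (c.base.symm w.1) M} (hu : IsHolFibreForm Fr u)
    {B : ℝ} (hB0 : 0 < B) (hB : fibreNormSq q u ≤ ENNReal.ofReal B) {a : ℂ}
    (ha : (c.slice w.1).coeff u w.2 = a • s (c.top.symm w)) :
    ENNReal.log (‖a‖ₑ ^ 2 / ENNReal.ofReal B) ≤ bergmanWeight Fr q c s w := by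
  -- Rescaling `u` by `B ^ (-1/2)` makes it a competitor of norm at most `1`.
  set r : ℂ := (((Real.sqrt B)⁻¹ : ℝ) : ℂ)
  have hr : ‖r‖ ^ 2 = B⁻¹ := by
    rw [Complex.norm_real, Real.norm_eq_abs, sq_abs, inv_pow, Real.sq_sqrt hB0.le]
  have hre : ‖r‖ₑ ^ 2 = (ENNReal.ofReal B)⁻¹ := by
    rw [← ofReal_norm, ← ENNReal.ofReal_pow (norm_nonneg _), hr,
      ENNReal.ofReal_inv_of_pos hB0]
  refine ENNReal.log_monotone (le_sSup ⟨u.map fun x => r • LinearMap.id, ?_, ?_, r * a, ?_, ?_⟩)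
  · intro γ U f hf
    obtain ⟨g, hg, hgu⟩ := hu γ U f hf
    refine ⟨fun z => r * g z, hg.const_mul r, fun z hz => ?_⟩
    rw [FibrePatch.coeff_map, hgu z hz, LinearMap.smul_apply, LinearMap.id_apply, smul_smul]
  · refine (fibreNormSq_le_mul (C := ENNReal.ofReal B⁻¹) _ q u (fun γ z hz => ?_)
      ENNReal.ofReal_ne_top).trans ?_
    · rw [FibrePatch.coeff_map, LinearMap.smul_apply, LinearMap.id_apply, hq, hr,
        ENNReal.ofReal_mul (by positivity)]
    · refine (mul_le_mul_right hB _).trans_eq ?_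
      rw [← ENNReal.ofReal_mul (by positivity), inv_mul_cancel₀ hB0.ne', ENNReal.ofReal_one]
  · rw [FibrePatch.coeff_map, ha]
    exact smul_smul r a (s (c.top.symm w))
  · rw [enorm_mul, mul_pow, hre, div_eq_mul_inv, mul_comm]

end General

section Bundles

variable {L : X → Type*} [TopologicalSpace (TotalSpace ℂ L)]
  [∀ x, AddCommGroup (L x)] [∀ x, Module ℂ (L x)] [∀ x, TopologicalSpace (L x)]
  [FiberBundle ℂ L] [VectorBundle ℂ ℂ L]
  {E : X → Type*} [TopologicalSpace (TotalSpace ℂ E)]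
  [∀ x, AddCommGroup (E x)] [∀ x, Module ℂ (E x)] [∀ x, TopologicalSpace (E x)]
  [FiberBundle ℂ E] [VectorBundle ℂ ℂ E]

/-- The product of a form with values in `L` and a section of `E`. -/
def FibreForm.tensor (u : FibreForm (m := m) (n := n) p y L) (S : ∀ x, E x) :
    FibreForm (m := m) (n := n) p y fun x => L x ⊗[ℂ] E x :=
  u.map fun x => (TensorProduct.mk ℂ (L x) (E x)).flip (S x)

theorem FibrePatch.coeff_tensor (γ : FibrePatch m n p y)
    (u : FibreForm (m := m) (n := n) p y L) (S : ∀ x, E x) (z : Fin n → ℂ) :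
    γ.coeff (u.tensor S) z = γ.coeff u z ⊗ₜ[ℂ] S (γ.toFun z) :=
  γ.coeff_map _ u z

theorem IsHolFibreForm.tensor [ContMDiffVectorBundle ω ℂ E 𝓘(ℂ, (Fin m → ℂ) × (Fin n → ℂ))]
    {u : FibreForm (m := m) (n := n) p y L}
    (hu : IsHolFibreForm (IsHolFrame ((Fin m → ℂ) × (Fin n → ℂ)) L) u)
    {S : ∀ x, E x} (hS : IsHolSectionOn ((Fin m → ℂ) × (Fin n → ℂ)) E Set.univ S) :
    IsHolFibreForm (IsTensorFrame ((Fin m → ℂ) × (Fin n → ℂ)) L E) (u.tensor S) := by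
  rintro γ U r ⟨s, t, hs, ht, hr⟩
  obtain ⟨f, hf, hfu⟩ := hu γ U s hs
  have hg := hS.contMDiffOn_lineRatio isOpen_univ ht
  rw [Set.univ_inter] at hg
  have hgγ : ContMDiffOn 𝓘(ℂ, Fin n → ℂ) 𝓘(ℂ, ℂ) ω
      (fun z => lineRatio (S (γ.toFun z)) (t (γ.toFun z))) (γ.dom ∩ γ.toFun ⁻¹' U) :=
    hg.comp (γ.hol.mono Set.inter_subset_left) fun z hz => hz.2
  refine ⟨fun z => f z * lineRatio (S (γ.toFun z)) (t (γ.toFun z)),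
    hf.mul ((contMDiffOn_iff_contDiffOn.1 hgγ).differentiableOn (by simp)), fun z hz => ?_⟩
  rw [FibrePatch.coeff_tensor, hfu z hz, hr]
  conv_lhs => rw [← lineRatio_smul (S (γ.toFun z)) (ht.ne_zero _ hz.2)]
  rw [TensorProduct.smul_tmul_smul]

theorem IsHolFibreForm.contract {t : ∀ x, E x}
    (ht : IsHolFrame ((Fin m → ℂ) × (Fin n → ℂ)) E Set.univ t)
    {u : FibreForm (m := m) (n := n) p y fun x => L x ⊗[ℂ] E x}
    (hu : IsHolFibreForm (IsTensorFrame ((Fin m → ℂ) × (Fin n → ℂ)) L E) u) :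
    IsHolFibreForm (IsHolFrame ((Fin m → ℂ) × (Fin n → ℂ)) L)
      (u.map fun x => contractLine (t x)) := by
  intro γ U s hs
  obtain ⟨f, hf, hfu⟩ := hu γ U (fun x => s x ⊗ₜ[ℂ] t x)
    ⟨s, t, hs, ⟨hs.isOpen, ContMDiffOn.mono ht.hol (Set.subset_univ _),
      fun x _ => ht.ne_zero x trivial⟩, fun x => rfl⟩
  refine ⟨f, hf, fun z hz => ?_⟩
  rw [FibrePatch.coeff_map, hfu z hz, map_smul, contractLine_tmul (ht.ne_zero _ trivial)]

variable [ContMDiffVectorBundle ω ℂ L 𝓘(ℂ, (Fin m → ℂ) × (Fin n → ℂ))]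

theorem IsHolFibreForm.continuousOn_normSq_coeff
    (hL : HermitianMetric ((Fin m → ℂ) × (Fin n → ℂ)) L)
    {u : FibreForm (m := m) (n := n) p y L}
    (hu : IsHolFibreForm (IsHolFrame ((Fin m → ℂ) × (Fin n → ℂ)) L) u)
    (γ : FibrePatch m n p y) :
    ContinuousOn (fun z => hL.normSq (γ.toFun z) (γ.coeff u z)) γ.dom := by
  intro z₀ hz₀
  set x := γ.toFun z₀ with hx
  have hs := isHolFrame_lineFrame ((Fin m → ℂ) × (Fin n → ℂ)) L x
  obtain ⟨f, hf, hfu⟩ := hu γ _ _ hs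
  have hO : IsOpen (γ.dom ∩ γ.toFun ⁻¹' (trivializationAt ℂ L x).baseSet) :=
    γ.hol.continuousOn.isOpen_inter_preimage γ.isOpen_dom hs.isOpen
  have h1 : ContinuousOn (fun z => ‖f z‖ ^ 2 *
      hL.normSq (γ.toFun z) (lineFrame L x (γ.toFun z)))
      (γ.dom ∩ γ.toFun ⁻¹' (trivializationAt ℂ L x).baseSet) :=
    (hf.continuousOn.norm.pow 2).mul ((hL.continuousOn_normSq_frame hs).comp
      (γ.hol.continuousOn.mono Set.inter_subset_left) fun z hz => hz.2)
  refine ((h1.congr fun z hz => ?_).continuousAt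
    (hO.mem_nhds ⟨hz₀, mem_baseSet_self x⟩)).continuousWithinAt
  rw [hfu z hz, hL.normSq_smul]

theorem exists_lintegral_ball_lt_top (hL : HermitianMetric ((Fin m → ℂ) × (Fin n → ℂ)) L)
    {u : FibreForm (m := m) (n := n) p y L}
    (hu : IsHolFibreForm (IsHolFrame ((Fin m → ℂ) × (Fin n → ℂ)) L) u)
    (γ : FibrePatch m n p y) {z₀ : Fin n → ℂ} (hz₀ : z₀ ∈ γ.dom) :
    ∃ r > 0, ∫⁻ z in Metric.ball z₀ r,
      ENNReal.ofReal (hL.normSq (γ.toFun z) (γ.coeff u z)) < ⊤ := by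
  obtain ⟨r, hr, hball⟩ := Metric.nhds_basis_closedBall.mem_iff.1 (γ.isOpen_dom.mem_nhds hz₀)
  have hint := ((hu.continuousOn_normSq_coeff hL γ).mono hball).integrableOn_compact
    (isCompact_closedBall z₀ r) (μ := volume)
  exact ⟨r, hr, (lintegral_mono_set Metric.ball_subset_closedBall).trans_lt hint.lintegral_lt_top⟩

/-- By properness the fibre is compact, hence covered by finitely many coordinate balls on each of
which the continuous density has finite integral. -/
theorem fibreNormSq_lt_top [T1Space Y] (hp_proper : IsProperMap p)
    (hp : Manifold.IsSubmersion 𝓘(ℂ, (Fin m → ℂ) × (Fin n → ℂ)) 𝓘(ℂ, Fin m → ℂ) ω p)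
    (hL : HermitianMetric ((Fin m → ℂ) × (Fin n → ℂ)) L)
    {u : FibreForm (m := m) (n := n) p y L}
    (hu : IsHolFibreForm (IsHolFrame ((Fin m → ℂ) × (Fin n → ℂ)) L) u) :
    fibreNormSq hL.normSq u < ⊤ := by
  have hK : IsCompact (p ⁻¹' {y}) := hp_proper.isCompact_preimage isCompact_singleton
  choose c hc using fun x : p ⁻¹' {y} => exists_adaptedChart hp x
  have hyc : ∀ x : p ⁻¹' {y}, y ∈ (c x).base.source := fun x => by
    have := (c x).mapsTo x (hc x)
    rwa [show p x = y from x.2] at this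
  have hbase : ∀ x : p ⁻¹' {y}, (c x).top x = ((c x).base y, ((c x).top x).2) := fun x => by
    refine Prod.ext ?_ rfl
    rw [← (c x).base_apply _ (hc x), show p x = y from x.2]
  have hdom : ∀ x : p ⁻¹' {y}, ((c x).top x).2 ∈ ((c x).patch (hyc x)).dom := fun x => by
    change ((c x).base y, ((c x).top x).2) ∈ (c x).top.target
    rw [← hbase x]
    exact (c x).top.map_source (hc x)
  choose r hr hint using fun x : p ⁻¹' {y} =>
    exists_lintegral_ball_lt_top hL hu ((c x).patch (hyc x)) (hdom x)
  obtain ⟨J, hJ⟩ := hK.elim_nhds_subcover'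
    (fun x hx => (c ⟨x, hx⟩).top.source ∩ (c ⟨x, hx⟩).top ⁻¹'
      (Prod.snd ⁻¹' Metric.ball ((c ⟨x, hx⟩).top x).2 (r ⟨x, hx⟩)))
    (fun x hx => ((c ⟨x, hx⟩).top.isOpen_inter_preimage
      (Metric.isOpen_ball.preimage continuous_snd)).mem_nhds
        ⟨hc ⟨x, hx⟩, Metric.mem_ball_self (hr ⟨x, hx⟩)⟩)
  refine (fibreNormSq_le_sum hL.normSq_smul u J c hyc
    (fun x => Metric.ball ((c x).top x).2 (r x)) (fun _ => Metric.isOpen_ball) ?_).trans_lt ?_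
  · intro x hx
    obtain ⟨j, hj, hxj⟩ := Set.mem_iUnion₂.1 (hJ (show x ∈ p ⁻¹' {y} from hx))
    exact ⟨j, hj, hxj.1, hxj.2⟩
  · exact ENNReal.sum_lt_top.2 fun j _ => hint j

end Bundles

end HolForms

/-! ### Existence of fibre sections at generic points -/

section FibreSections

variable {m n : ℕ}
  {X : Type*} [TopologicalSpace X] [ChartedSpace ((Fin m → ℂ) × (Fin n → ℂ)) X]
  [IsManifold 𝓘(ℂ, (Fin m → ℂ) × (Fin n → ℂ)) ω X]
  {Y : Type*} [TopologicalSpace Y] [ChartedSpace (Fin m → ℂ) Y]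
  {p : X → Y}
  {L : X → Type*} [TopologicalSpace (TotalSpace ℂ L)]
  [∀ x, AddCommGroup (L x)] [∀ x, Module ℂ (L x)] [∀ x, TopologicalSpace (L x)]
  [FiberBundle ℂ L] [VectorBundle ℂ ℂ L]

variable (p L) in
/-- Some holomorphic section of `K_{X_y} ⊗ L` over the fibre through `x` does not vanish at `x`. -/
def HasFibreSection (x : X) : Prop :=
  ∃ (y : Y) (hx : p x = y) (u : FibreForm (m := m) (n := n) p y L),
    IsHolFibreForm (IsHolFrame ((Fin m → ℂ) × (Fin n → ℂ)) L) u ∧ u ⟨x, hx⟩ ≠ 0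

theorem AdaptedChart.coeff_slice_ne_zero
    (hp : ContMDiff 𝓘(ℂ, (Fin m → ℂ) × (Fin n → ℂ)) 𝓘(ℂ, Fin m → ℂ) ω p)
    (c : AdaptedChart m n p) {w : (Fin m → ℂ) × (Fin n → ℂ)} (hw : w ∈ c.top.target)
    (u : FibreForm (m := m) (n := n) p (c.base.symm w.1) L)
    (hu : u ⟨c.top.symm w, c.proj_symm hw⟩ ≠ 0) : (c.slice w.1).coeff u w.2 ≠ 0 := by
  have ht := c.fst_mem_target hw
  have h0 : (c.base (c.base.symm w.1), w.2) = w := Prod.ext (c.base.right_inv ht) rfl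
  have hz : w.2 ∈ (c.patch (c.base.map_target ht)).dom := by
    change (c.base (c.base.symm w.1), w.2) ∈ c.top.target
    rwa [h0]
  rw [c.slice_eq_patch ht]
  refine c.coeff_patch_ne_zero hp _ hz u ?_
  have h1 : ∀ x x', x = x' → u x ≠ 0 → u x' ≠ 0 := by
    rintro _ _ rfl
    exact id
  refine h1 _ _ (Subtype.ext ?_) hu
  exact congrArg c.top.symm h0.symm

theorem FibrePatch.apply_ne_zero {y : Y} {M : X → Type*} [∀ x, AddCommGroup (M x)]
    [∀ x, Module ℂ (M x)] (γ : FibrePatch m n p y) (u : FibreForm (m := m) (n := n) p y M)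
    {z : Fin n → ℂ} (hz : z ∈ γ.dom) (h : γ.coeff u z ≠ 0) :
    u ⟨γ.toFun z, γ.mem_fibre z hz⟩ ≠ 0 := by
  intro h0
  rw [γ.coeff_eq u hz, h0] at h
  exact h rfl

variable {E : X → Type*} [TopologicalSpace (TotalSpace ℂ E)]
  [∀ x, AddCommGroup (E x)] [∀ x, Module ℂ (E x)] [∀ x, TopologicalSpace (E x)]
  [FiberBundle ℂ E] [VectorBundle ℂ ℂ E]

theorem AdaptedChart.coeff_slice_tensor (c : AdaptedChart m n p)
    {w : (Fin m → ℂ) × (Fin n → ℂ)} (u : FibreForm (m := m) (n := n) p (c.base.symm w.1) L)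
    (t : ∀ x, E x) (s : ∀ x, L x) {a : ℂ}
    (ha : (c.slice w.1).coeff u w.2 = a • s (c.top.symm w)) :
    (c.slice w.1).coeff (u.tensor t) w.2 =
      a • (s (c.top.symm w) ⊗ₜ[ℂ] t (c.top.symm w)) := by
  -- The coefficient lives in the fibre over `c.top.symm (w.1, w.2)`, which is `c.top.symm w` only
  -- up to unfolding; a general `l` avoids rewriting in dependent types.
  have h : ∀ l : L (c.top.symm w), l = a • s (c.top.symm w) →
      l ⊗ₜ[ℂ] t (c.top.symm w) = a • (s (c.top.symm w) ⊗ₜ[ℂ] t (c.top.symm w)) := by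
    rintro _ rfl
    exact (TensorProduct.smul_tmul' a _ _).symm
  exact ((c.slice w.1).coeff_tensor u t w.2).trans (h _ ha)

variable [ContMDiffVectorBundle ω ℂ L 𝓘(ℂ, (Fin m → ℂ) × (Fin n → ℂ))]
  [ContMDiffVectorBundle ω ℂ E 𝓘(ℂ, (Fin m → ℂ) × (Fin n → ℂ))]

/-- Multiplication by the global unit frame `t` preserves norms, and contraction with it goes back,
so sections of `K ⊗ L ⊗ E` and of `K ⊗ L` over a fibre correspond. Norms being finite by
compactness, a section not vanishing at the point can be normalized and makes the supremum positive.
-/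
theorem bergmanWeight_eq_bot_iff [T1Space Y] (hp_proper : IsProperMap p)
    (hp : Manifold.IsSubmersion 𝓘(ℂ, (Fin m → ℂ) × (Fin n → ℂ)) 𝓘(ℂ, Fin m → ℂ) ω p)
    (hL : HermitianMetric ((Fin m → ℂ) × (Fin n → ℂ)) L)
    (hE : HermitianMetric ((Fin m → ℂ) × (Fin n → ℂ)) E) {t : ∀ x, E x}
    (ht : IsHolFrame ((Fin m → ℂ) × (Fin n → ℂ)) E Set.univ t)
    (ht1 : ∀ x, hE.normSq x (t x) = 1) {U : Set X} {s : ∀ x, L x}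
    (hs : IsHolFrame ((Fin m → ℂ) × (Fin n → ℂ)) L U s)
    (c : AdaptedChart m n p) {w : (Fin m → ℂ) × (Fin n → ℂ)} (hw : w ∈ c.top.target)
    (hwU : c.top.symm w ∈ U) :
    bergmanWeight (IsTensorFrame ((Fin m → ℂ) × (Fin n → ℂ)) L E) (tensorNormSq hL hE) c
      (fun x => s x ⊗ₜ[ℂ] t x) w = ⊥ ↔ ¬ HasFibreSection (m := m) (n := n) p L (c.top.symm w) := by
  constructor
  · rintro hbot ⟨y, hx, u, hu, hux⟩
    obtain rfl : y = c.base.symm w.1 := hx.symm.trans (c.proj_symm hw)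
    have hcoeff := c.coeff_slice_ne_zero hp.contMDiff hw u hux
    set a : ℂ := lineRatio (L := L) (x := c.top.symm w) ((c.slice w.1).coeff u w.2)
      (s (c.top.symm w)) with ha
    have ha' : (c.slice w.1).coeff u w.2 = a • s (c.top.symm w) :=
      (lineRatio_smul (L := L) (x := c.top.symm w) _ (hs.ne_zero _ hwU)).symm
    have ha0 : a ≠ 0 := lineRatio_ne_zero (L := L) hcoeff (hs.ne_zero _ hwU)
    have hfin := fibreNormSq_lt_top hp_proper hp hL hu
    have hle : fibreNormSq (tensorNormSq hL hE) (u.tensor t) ≤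
        1 * fibreNormSq hL.normSq u := by
      refine fibreNormSq_le_mul _ _ _ (fun γ z hz => ?_) ENNReal.one_ne_top
      rw [FibrePatch.coeff_tensor, tensorNormSq_tmul, ht1, mul_one, one_mul]
    have hB : fibreNormSq (tensorNormSq hL hE) (u.tensor t) ≤
        ENNReal.ofReal ((fibreNormSq hL.normSq u).toReal + 1) := by
      rw [one_mul] at hle
      refine hle.trans ?_
      rw [ENNReal.le_ofReal_iff_toReal_le hfin.ne (by positivity)]
      linarith
    have h := log_le_bergmanWeight (tensorNormSq_smul hL hE) c (fun x => s x ⊗ₜ[ℂ] t x) w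
      (hu.tensor ht.hol) (by positivity) hB (c.coeff_slice_tensor u t s ha')
    rw [hbot, le_bot_iff, ENNReal.log_eq_bot_iff, ENNReal.div_eq_zero_iff] at h
    rcases h with h | h
    · exact ha0 (by simpa using h)
    · exact ENNReal.ofReal_ne_top h
  · intro hno
    by_contra hne
    obtain ⟨b, ⟨u, hu, -, a, ha, rfl⟩, hb⟩ := not_forall₂.1 fun hall =>
      hne (ENNReal.log_eq_bot_iff.2 (sSup_eq_bot.2 hall))
    have ha0 : a ≠ 0 := by
      rintro rfl
      simp at hb
    refine hno ⟨_, c.proj_symm hw, u.map fun x => contractLine (t x), hu.contract ht, ?_⟩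
    refine (c.slice w.1).apply_ne_zero _ hw ?_
    rw [FibrePatch.coeff_map, ha]
    have h2 : contractLine (t (c.top.symm w)) (a • (s (c.top.symm w) ⊗ₜ[ℂ] t (c.top.symm w))) =
        a • s (c.top.symm w) := by
      rw [map_smul, contractLine_tmul (ht.ne_zero _ trivial)]
    intro h0
    have h3 := h2.symm.trans h0
    exact smul_ne_zero ha0 (hs.ne_zero _ hwU) h3

/-- In charts this is the set where the Bergman weight is `-∞`. If the weights are plurisubharmonic,
that set is a neighbourhood of each point in the closure of its interior, and connectedness
concludes; the identically `-∞` case contradicts the section given by `hsec`. -/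
theorem interior_not_hasFibreSection [T1Space Y] [PreconnectedSpace X]
    (hp_proper : IsProperMap p)
    (hp : Manifold.IsSubmersion 𝓘(ℂ, (Fin m → ℂ) × (Fin n → ℂ)) 𝓘(ℂ, Fin m → ℂ) ω p)
    (hL : HermitianMetric ((Fin m → ℂ) × (Fin n → ℂ)) L)
    (hE : HermitianMetric ((Fin m → ℂ) × (Fin n → ℂ)) E) {t : ∀ x, E x}
    (ht : IsHolFrame ((Fin m → ℂ) × (Fin n → ℂ)) E Set.univ t)
    (ht1 : ∀ x, hE.normSq x (t x) = 1)
    (hsec : ∃ x, HasFibreSection (m := m) (n := n) p L x)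
    (h : BergmanSemipositive m n p (IsTensorFrame ((Fin m → ℂ) × (Fin n → ℂ)) L E)
          (tensorNormSq hL hE) ∨
        BergmanIdenticallyTop m n p (IsTensorFrame ((Fin m → ℂ) × (Fin n → ℂ)) L E)
          (tensorNormSq hL hE)) :
    interior {x | ¬ HasFibreSection (m := m) (n := n) p L x} = ∅ := by
  have hframe : ∀ x, IsTensorFrame ((Fin m → ℂ) × (Fin n → ℂ)) L E
      (trivializationAt ℂ L x).baseSet (fun x' => lineFrame L x x' ⊗ₜ[ℂ] t x') := fun x =>
    ⟨_, t, isHolFrame_lineFrame _ L x, ⟨(trivializationAt ℂ L x).open_baseSet,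
      ContMDiffOn.mono ht.hol (Set.subset_univ _), fun x _ => ht.ne_zero x trivial⟩, fun _ => rfl⟩
  rcases h with h | h
  · refine interior_eq_empty_of_closure_subset (fun x hx => ?_)
      (hsec.imp fun x hx => not_not.2 hx)
    obtain ⟨c, hc⟩ := exists_adaptedChart hp x
    have hs := isHolFrame_lineFrame ((Fin m → ℂ) × (Fin n → ℂ)) L x
    have hpsh := h c _ _ (hframe x)
    set O := c.top.target ∩ c.top.symm ⁻¹' (trivializationAt ℂ L x).baseSet
    have hO : IsOpen O := isOpen_chart_preimage hs.isOpen c.top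
    have hxO : c.top x ∈ O := ⟨c.top.map_source hc, by
      rw [Set.mem_preimage, c.top.left_inv hc]; exact mem_baseSet_self x⟩
    have hiff := fun w (hw : w ∈ O) =>
      bergmanWeight_eq_bot_iff hp_proper hp hL hE ht ht1 hs c hw.1 hw.2
    have hbot := hpsh.eventually_eq_bot (hO.mem_nhds hxO) (by
      rw [mem_closure_iff_nhds]
      intro N hN
      obtain ⟨x', ⟨hx's, hx'N, hx'O⟩, hx'Z⟩ := mem_closure_iff_nhds.1 hx
        (c.top.source ∩ c.top ⁻¹' (N ∩ O)) (Filter.inter_mem (c.top.open_source.mem_nhds hc)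
          ((c.top.continuousAt hc).preimage_mem_nhds (Filter.inter_mem hN (hO.mem_nhds hxO))))
      refine ⟨c.top x', hx'N, mem_interior_iff_mem_nhds.2 ?_⟩
      have hcont : Filter.Tendsto c.top.symm (𝓝 (c.top x')) (𝓝 x') := by
        have := c.top.continuousAt_symm (c.top.map_source hx's)
        rwa [ContinuousAt, c.top.left_inv hx's] at this
      filter_upwards [hO.mem_nhds hx'O, hcont (mem_interior_iff_mem_nhds.1 hx'Z)] with w hw hw'
      exact (hiff w hw).2 hw')
    filter_upwards [c.top.open_source.mem_nhds hc,
      (c.top.continuousAt hc).eventually (hbot.and (hO.mem_nhds hxO))] with x' hx's hx'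
    have := (hiff _ hx'.2).1 hx'.1
    rwa [c.top.left_inv hx's] at this
  · obtain ⟨x, hx⟩ := hsec
    obtain ⟨c, hc⟩ := exists_adaptedChart hp x
    have hxO : c.top.symm (c.top x) ∈ (trivializationAt ℂ L x).baseSet := by
      rw [c.top.left_inv hc]
      exact mem_baseSet_self x
    have h1 := (bergmanWeight_eq_bot_iff hp_proper hp hL hE ht ht1
      (isHolFrame_lineFrame _ L x) c (c.top.map_source hc) hxO).1
      (h c _ _ (hframe x) _ ⟨c.top.map_source hc, hxO⟩)
    rw [c.top.left_inv hc] at h1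
    exact absurd hx h1

end FibreSections

/-! ### Prescribing a weight near a point, in a chart -/

section LocalModification

variable {V : Type*} [NormedAddCommGroup V] [NormedSpace ℂ V]

theorem leviForm_real_smul (f : V → ℝ) (a v : V) (r : ℝ) :
    leviForm f a (r • v) = r ^ 2 * leviForm f a v := by
  unfold leviForm
  rw [smul_comm Complex.I r v]
  simp only [map_smul, smul_apply, smul_eq_mul]
  ring

theorem continuousOn_leviForm {f : V → ℝ} {O : Set V} (hO : IsOpen O) (hf : ContDiffOn ℝ 2 f O) :
    ContinuousOn (fun q : V × V => leviForm f q.1 q.2) (O ×ˢ Set.univ) := by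
  have h1 : ContDiffOn ℝ 1 (fderiv ℝ f) O := hf.fderiv_of_isOpen hO (by norm_num)
  have h2 : ContinuousOn (fderiv ℝ (fderiv ℝ f)) O := h1.continuousOn_fderiv_of_isOpen hO le_rfl
  have h3 : ContinuousOn (fun q : V × V => fderiv ℝ (fderiv ℝ f) q.1) (O ×ˢ Set.univ) :=
    h2.comp continuousOn_fst fun q hq => hq.1
  have h4 : ContinuousOn (fun q : V × V => Complex.I • q.2) (O ×ˢ Set.univ) :=
    (continuous_snd.const_smul Complex.I).continuousOn
  exact (((h3.clm_apply continuousOn_snd).clm_apply continuousOn_snd).add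
    ((h3.clm_apply h4).clm_apply h4)).div_const 4

/-- The Levi form is continuous and positive on the compact set `K × {‖v‖ = 1}`, and quadratic in
`v`. -/
theorem exists_mul_norm_sq_le_leviForm [ProperSpace V] {f : V → ℝ} {O K : Set V} (hO : IsOpen O)
    (hf : ContDiffOn ℝ 2 f O) (hK : IsCompact K) (hKO : K ⊆ O)
    (hpos : ∀ w ∈ K, ∀ v, v ≠ 0 → 0 < leviForm f w v) :
    ∃ κ : ℝ, 0 < κ ∧ ∀ w ∈ K, ∀ v, κ * ‖v‖ ^ 2 ≤ leviForm f w v := by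
  have hKS : IsCompact (K ×ˢ Metric.sphere (0 : V) 1) := hK.prod (isCompact_sphere _ _)
  have hcont := (continuousOn_leviForm hO hf).mono
    (Set.prod_mono hKO (Set.subset_univ (Metric.sphere (0 : V) 1)))
  obtain ⟨κ, hκ, hle⟩ : ∃ κ : ℝ, 0 < κ ∧ ∀ w ∈ K, ∀ v : V, ‖v‖ = 1 → κ ≤ leviForm f w v := by
    rcases (K ×ˢ Metric.sphere (0 : V) 1).eq_empty_or_nonempty with h | h
    · refine ⟨1, one_pos, fun w hw v hv => ?_⟩
      have : (w, v) ∈ K ×ˢ Metric.sphere (0 : V) 1 := ⟨hw, by simpa using hv⟩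
      rw [h] at this
      exact this.elim
    · obtain ⟨⟨w₀, v₀⟩, hq, hmin⟩ := hKS.exists_isMinOn h hcont
      refine ⟨leviForm f w₀ v₀, hpos _ hq.1 _ ?_, fun w hw v hv => ?_⟩
      · have := hq.2
        rintro rfl
        simp at this
      · exact hmin (show (w, v) ∈ K ×ˢ Metric.sphere (0 : V) 1 from ⟨hw, by simpa using hv⟩)
  refine ⟨κ, hκ, fun w hw v => ?_⟩
  rcases eq_or_ne v 0 with rfl | hv
  · simp [leviForm]
  · have hv' : ‖v‖ ≠ 0 := norm_ne_zero_iff.2 hv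
    have h1 := hle w hw (‖v‖⁻¹ • v) (by rw [norm_smul, norm_inv, norm_norm, inv_mul_cancel₀ hv'])
    have h2 : leviForm f w v = ‖v‖ ^ 2 * leviForm f w (‖v‖⁻¹ • v) := by
      rw [← leviForm_real_smul, smul_inv_smul₀ hv']
    rw [h2, mul_comm]
    gcongr

variable {E : Type*} [NormedAddCommGroup E] [InnerProductSpace ℂ E]

/-- A multiple of a strictly plurisubharmonic function `φ` can be modified on a small ball so that
it equals `m₀ + Q` near the centre, and is at least `m₀ + Q` on the ball. -/
theorem exists_local_modification [ProperSpace V] (T : V →L[ℂ] E) {κ : ℝ} (hκ : 0 < κ)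
    (hT : ∀ v, κ * ‖v‖ ≤ ‖T v‖) {φ Q : V → ℝ} {O : Set V} (hO : IsOpen O)
    (hφ : ContDiffOn ℝ ∞ φ O) (hpos : ∀ w ∈ O, ∀ v, v ≠ 0 → 0 < leviForm φ w v)
    (hQ : ContDiff ℝ ∞ Q) (hQpos : ∀ w v, 0 ≤ leviForm Q w v) {a : V} (hQa : Q a = 0)
    {R : ℝ} (hR : 0 < R) (hball : Metric.closedBall a R ⊆ O) :
    ∃ k₀ : ℕ, ∀ c₀ : ℝ, ∃ (χ : V → ℝ) (m₀ : ℝ), m₀ ≤ c₀ ∧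
      (∀ w ∈ Metric.ball a R, ContDiffAt ℝ ∞ χ w) ∧
      (∀ w ∈ Metric.ball a R, R / 2 ≤ ‖w - a‖ → χ w = 0) ∧
      (∀ w ∈ Metric.ball a R, ∀ v, 0 ≤ leviForm (fun z => k₀ * φ z + χ z) w v) ∧
      (∀ w ∈ Metric.ball a R, m₀ + Q w ≤ k₀ * φ w + χ w) ∧
      ∀ᶠ w in 𝓝 a, k₀ * φ w + χ w = m₀ + Q w := by
  obtain ⟨C, hC0, hC⟩ := exists_neg_le_leviForm_logWell (V := V) (E := E)
  have hK : IsCompact (Metric.closedBall a R) := isCompact_closedBall a R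
  have hφ2 : ContDiffOn ℝ 2 φ O := contDiffOn_infty.1 hφ 2
  have hφat : ∀ w ∈ Metric.closedBall a R, ContDiffAt ℝ ∞ φ w := fun w hw =>
    hφ.contDiffAt (hO.mem_nhds (hball hw))
  obtain ⟨μ, hμ, hlevi⟩ := exists_mul_norm_sq_le_leviForm hO hφ2 hK hball
    fun w hw => hpos w (hball hw)
  -- At distance at least `R / 2` from `a` one has `‖T(w - a)‖² ≥ σ`, so the well vanishes there.
  set σ : ℝ := (κ * (R / 2)) ^ 2
  have hσ : 0 < σ := by positivity
  -- With this `k₀` the curvature of `k₀ φ` absorbs the loss due to the well. As the loss is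
  -- independent of the depth, `k₀` can be fixed before `c₀`.
  obtain ⟨k₀, hk₀⟩ := exists_nat_ge (C / σ * ‖T‖ ^ 2 / μ)
  refine ⟨k₀, fun c₀ => ?_⟩
  obtain ⟨B, hB⟩ := hK.bddBelow_image (f := fun w => k₀ * φ w - Q w)
    ((continuousOn_const.mul (hφ.continuousOn.mono hball)).sub hQ.continuous.continuousOn)
  -- Then `c + Q ≤ k₀ φ` on the ball, so outside the well the regularized maximum is `k₀ φ` and the
  -- modification vanishes.
  set c : ℝ := min c₀ B
  have hcB : ∀ w ∈ Metric.closedBall a R, c + Q w ≤ k₀ * φ w := fun w hw => by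
    have h1 : B ≤ k₀ * φ w - Q w := hB ⟨w, hw, rfl⟩
    linarith [min_le_right c₀ B]
  -- The well is made so deep that at `a` the function `c + Q` exceeds `k₀ φ + ℓ` by more than `1`,
  -- in the range where `softPlus` is affine.
  obtain ⟨ε, hε, hεc⟩ : ∃ ε : ℝ, 0 < ε ∧ k₀ * φ a + (Real.log (ε / σ) + 1) < c - 1 := by
    refine ⟨σ * Real.exp (c - 3 - k₀ * φ a), by positivity, ?_⟩
    rw [mul_div_cancel_left₀ _ hσ.ne', Real.log_exp]
    linarith
  set ℓ : V → ℝ := logWell T a σ ε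
  have hℓ : ContDiff ℝ ∞ ℓ := contDiff_logWell T a hσ hε
  have hφ1 : ∀ w ∈ Metric.closedBall a R, ContDiffAt ℝ ∞ (fun z => k₀ * φ z + ℓ z) w :=
    fun w hw => (contDiffAt_const.mul (hφat w hw)).add hℓ.contDiffAt
  have hg : ContDiff ℝ ∞ fun z => c + Q z := contDiff_const.add hQ
  have hsub : Metric.ball a R ⊆ Metric.closedBall a R := Metric.ball_subset_closedBall
  have heq : ∀ w, k₀ * φ w + (ℓ w + softPlus (c + Q w - (k₀ * φ w + ℓ w))) =
      k₀ * φ w + ℓ w + softPlus (c + Q w - (k₀ * φ w + ℓ w)) := fun w => by ring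
  -- Adding this to `k₀ φ` gives the regularized maximum of `k₀ φ + ℓ` and `c + Q`; where the second
  -- one dominates by at least `1`, it equals `c + Q - softPlusGap`.
  refine ⟨fun w => ℓ w + softPlus (c + Q w - (k₀ * φ w + ℓ w)), c - softPlusGap, ?_, ?_, ?_, ?_,
    ?_, ?_⟩
  · linarith [min_le_left c₀ B, softPlusGap_nonneg]
  · exact fun w hw => hℓ.contDiffAt.add
      (contDiff_softPlus.contDiffAt.comp w (hg.contDiffAt.sub (hφ1 w (hsub hw))))
  · intro w hw hw'
    have h0 : ℓ w = 0 := by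
      refine logWell_eq_zero hσ hε ?_
      exact pow_le_pow_left₀ (by positivity) ((mul_le_mul_of_nonneg_left hw' hκ.le).trans (hT _)) 2
    simp only [h0, add_zero, zero_add]
    exact softPlus_of_nonpos (by linarith [hcB w (hsub hw)])
  · intro w hw v
    simp only [heq]
    refine leviForm_softPlus_max_nonneg (contDiffAt_infty.1 (hφ1 w (hsub hw)) 2)
      (contDiff_infty.1 hg 2).contDiffAt ?_ ?_
    · have hφw := contDiffAt_infty.1 (hφat w (hsub hw)) 2
      rw [leviForm_add (contDiffAt_const.mul hφw) (contDiff_infty.1 hℓ 2).contDiffAt,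
        leviForm_const_mul hφw]
      have h1 := hC T a σ ε hσ hε w v
      have h2 : C / σ * ‖T v‖ ^ 2 ≤ k₀ * leviForm φ w v := by
        calc C / σ * ‖T v‖ ^ 2 ≤ C / σ * (‖T‖ * ‖v‖) ^ 2 := by
              gcongr
              exact T.le_opNorm v
          _ = C / σ * ‖T‖ ^ 2 / μ * (μ * ‖v‖ ^ 2) := by field_simp
          _ ≤ k₀ * leviForm φ w v := by
              gcongr
              exact hlevi w (hsub hw) v
      linarith
    · rw [leviForm_add contDiffAt_const (contDiff_infty.1 hQ 2).contDiffAt, leviForm_const,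
        zero_add]
      exact hQpos w v
  · intro w _
    rw [heq]
    linarith [sub_gap_le_softPlus (c + Q w - (k₀ * φ w + ℓ w))]
  · have ha : a ∈ Metric.closedBall a R := Metric.mem_closedBall_self hR.le
    have hca : ContinuousAt (fun w => c + Q w - (k₀ * φ w + ℓ w)) a :=
      (hg.continuous.continuousAt).sub (hφ1 a ha).continuousAt
    have h1 : 1 < c + Q a - (k₀ * φ a + ℓ a) := by
      have := logWell_center_le T a σ ε
      rw [hQa]
      linarith
    filter_upwards [hca.eventually (lt_mem_nhds h1)] with w hw
    rw [heq, softPlus_of_one_le hw.le]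
    ring

end LocalModification

/-! ### Prescribing the weight of a power of `A` -/

section GlobalModification

variable {V : Type*} [NormedAddCommGroup V] [NormedSpace ℂ V]
  {X : Type*} [TopologicalSpace X] [ChartedSpace V X] [IsManifold 𝓘(ℂ, V) ω X]
  {A : X → Type*} [TopologicalSpace (TotalSpace ℂ A)]
  [∀ x, AddCommGroup (A x)] [∀ x, Module ℂ (A x)] [∀ x, TopologicalSpace (A x)]
  [FiberBundle ℂ A] [VectorBundle ℂ ℂ A] [ContMDiffVectorBundle ω ℂ A 𝓘(ℂ, V)]
  {E : Type*} [NormedAddCommGroup E] [InnerProductSpace ℂ E]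

theorem HermitianMetric.isHolFrame_ne_zero (hA : HermitianMetric V A) {s : ∀ x, A x}
    (hs : IsHolSectionOn V A Set.univ s) : IsHolFrame V A {x | s x ≠ 0} s where
  isOpen := by
    have hcont : Continuous fun x => hA.normSq x (s x) :=
      continuousOn_univ.1 (hA.continuousOn_normSq isOpen_univ hs)
    convert isOpen_ne_fun hcont (continuous_const (y := (0 : ℝ))) using 1
    ext x
    refine ⟨fun h => (hA.normSq_pos x _ h).ne', fun h h0 => h ?_⟩
    rw [h0, hA.normSq_zero]
  hol := ContMDiffOn.mono hs (Set.subset_univ _)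
  ne_zero _ hx := hx

/-- The local modification is applied to the weight of `hA` in the frame `s` and extended by zero.
Outside the ball the curvature is a nonnegative multiple of that of `hA`, whether or not `s`
vanishes there. On `K` the norm of the power of `s` is controlled by `Q` inside the ball, and
outside it because `m₀` is chosen very negative. -/
theorem HermitianMetric.exists_powMetric_modification [ProperSpace V] [T2Space X]
    {hA : HermitianMetric V A} (hpos : hA.IsPositive) {s : ∀ x, A x}
    (hs : IsHolSectionOn V A Set.univ s) {e : OpenPartialHomeomorph X V}
    (he : e ∈ IsManifold.maximalAtlas 𝓘(ℂ, V) ω X) {x₀ : X} (hx₀ : x₀ ∈ e.source)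
    (hsx₀ : s x₀ ≠ 0) (T : V →L[ℂ] E) {κ : ℝ} (hκ : 0 < κ) (hT : ∀ v, κ * ‖v‖ ≤ ‖T v‖)
    {Q : V → ℝ} (hQ : ContDiff ℝ ∞ Q) (hQpos : ∀ w v, 0 ≤ leviForm Q w v) (hQ0 : Q (e x₀) = 0)
    {K : Set X} (hK : IsCompact K) :
    ∃ (k₀ : ℕ) (χ : X → ℝ) (hχ : IsChartSmooth V χ) (m₀ : ℝ),
      (∀ k : ℕ, (hA.powMetric (k₀ * k) (hχ.const_mul k)).IsSemipositive) ∧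
      (∀ᶠ w in 𝓝 (e x₀), hA.normSq (e.symm w) (s (e.symm w)) ^ k₀ * Real.exp (-χ (e.symm w)) =
        Real.exp (-(m₀ + Q w))) ∧
      ∀ x ∈ K, (x ∈ e.source ∧
          hA.normSq x (s x) ^ k₀ * Real.exp (-χ x) ≤ Real.exp (-(m₀ + Q (e x)))) ∨
        hA.normSq x (s x) ^ k₀ * Real.exp (-χ x) ≤ Real.exp (-(m₀ + 1)) := by
  classical
  have hfr := hA.isHolFrame_ne_zero hs
  set W : Set X := {x | s x ≠ 0}
  set O : Set V := e.target ∩ e.symm ⁻¹' W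
  have hO : IsOpen O := isOpen_chart_preimage hfr.isOpen e
  set a := e x₀
  have ha : a ∈ O := ⟨e.map_source hx₀, by rw [Set.mem_preimage, e.left_inv hx₀]; exact hsx₀⟩
  obtain ⟨R, hR, hball⟩ := Metric.nhds_basis_closedBall.mem_iff.1 (hO.mem_nhds ha)
  have hsub : Metric.ball a R ⊆ O := Metric.ball_subset_closedBall.trans hball
  set φ : V → ℝ := fun w => hA.weight s (e.symm w) with hφdef
  have hφ : ContDiffOn ℝ ∞ φ O := fun w hw =>
    (hA.contDiffAt_weight hfr he hw.1 hw.2).contDiffWithinAt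
  obtain ⟨k₀, hk₀⟩ := exists_local_modification T hκ hT hO hφ
    (fun w hw v hv => hpos W s hfr e he w hw v hv) hQ hQpos hQ0 hR hball
  have hcont : Continuous fun x => hA.normSq x (s x) ^ k₀ :=
    (continuousOn_univ.1 (hA.continuousOn_normSq isOpen_univ hs)).pow k₀
  obtain ⟨C, hC⟩ := hK.bddAbove_image hcont.continuousOn
  -- The bound `C` on `|s|^(2 k₀)` depends on `k₀`, and `m₀` must be small in terms of `C`; the
  -- extra `-1` produces the factor `e^(-(m₀ + 1))` outside the ball.
  obtain ⟨χ₀, m₀, hm₀, hsm, hzero, hpsh, hlow, hnear⟩ := hk₀ (-Real.log (max C 1) - 1)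
  set N : Set X := e.source ∩ e ⁻¹' Metric.ball a R
  have hN : IsOpen N := e.isOpen_inter_preimage Metric.isOpen_ball
  set K₀ : Set X := e.symm '' Metric.closedBall a (R / 2)
  have hK₀N : K₀ ⊆ N := by
    rintro _ ⟨w, hw, rfl⟩
    have hwt : w ∈ e.target :=
      (hball (Metric.closedBall_subset_closedBall (by linarith) hw)).1
    refine ⟨e.map_target hwt, ?_⟩
    rw [Set.mem_preimage, e.right_inv hwt]
    exact Metric.closedBall_subset_ball (by linarith) hw
  -- A compact set in a Hausdorff space: its complement is an open set on which `χ` is zero, so the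
  -- extension is smooth.
  have hK₀ : IsClosed K₀ := by
    refine IsCompact.isClosed ((isCompact_closedBall a (R / 2)).image_of_continuousOn ?_)
    exact e.continuousOn_symm.mono fun w hw =>
      (hball (Metric.closedBall_subset_closedBall (by linarith) hw)).1
  set χ : X → ℝ := fun x => if x ∈ N then χ₀ (e x) else 0 with hχdef
  have hχN : ∀ w ∈ Metric.ball a R, χ (e.symm w) = χ₀ w := fun w hw => by
    have hwt : w ∈ e.target := (hsub hw).1
    have : e.symm w ∈ N := ⟨e.map_target hwt, by rwa [Set.mem_preimage, e.right_inv hwt]⟩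
    simp only [hχdef, if_pos this, e.right_inv hwt]
  have hχ0 : ∀ x ∉ K₀, χ x = 0 := fun x hx => by
    by_cases hxN : x ∈ N
    · simp only [hχdef, if_pos hxN]
      refine hzero _ hxN.2 (le_of_not_gt fun hlt => hx ⟨e x, ?_, e.left_inv hxN.1⟩)
      rw [Metric.mem_closedBall, dist_eq_norm]
      exact hlt.le
    · simp only [hχdef, if_neg hxN]
  have hχ : IsChartSmooth V χ := by
    refine isChartSmooth_of_forall_exists fun x => ?_
    by_cases hxN : x ∈ N
    · refine ⟨e, he, hxN.1, (hsm _ hxN.2).congr_of_eventuallyEq ?_⟩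
      filter_upwards [Metric.isOpen_ball.mem_nhds hxN.2] with w hw
      exact hχN w hw
    · refine ⟨chartAt V x, IsManifold.chart_mem_maximalAtlas x, mem_chart_source V x, ?_⟩
      refine (contDiffAt_const (c := (0 : ℝ))).congr_of_eventuallyEq ?_
      have hxs := mem_chart_source V x
      have hc := (chartAt V x).continuousAt_symm ((chartAt V x).map_source hxs)
      rw [ContinuousAt, (chartAt V x).left_inv hxs] at hc
      filter_upwards [hc (hK₀.isOpen_compl.mem_nhds fun h => hxN (hK₀N h))] with w hw
      exact hχ0 _ hw
  have hexp : ∀ w ∈ Metric.ball a R, hA.normSq (e.symm w) (s (e.symm w)) ^ k₀ *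
      Real.exp (-χ (e.symm w)) = Real.exp (-(k₀ * φ w + χ₀ w)) := fun w hw => by
    rw [hχN w hw, hA.normSq_eq_exp_weight (hsub hw).2, ← Real.exp_nat_mul, ← Real.exp_add]
    congr 1
    ring
  refine ⟨k₀, χ, hχ, m₀, fun k => ?_, ?_, fun x hx => ?_⟩
  · refine hA.isSemipositive_powMetric _ _ fun e' he' w hw => ?_
    by_cases hxN : e'.symm w ∈ N
    · have hxa : e (e'.symm w) ∈ Metric.ball a R := hxN.2
      have hxW : e'.symm w ∈ W := by
        have := (hsub hxa).2
        rwa [Set.mem_preimage, e.left_inv hxN.1] at this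
      refine ⟨W, s, hfr, hxW, fun v => ?_⟩
      have h0 : ∀ z ∈ Metric.ball a R, ContDiffAt ℝ 2 (fun z => k₀ * φ z + χ₀ z) z := fun z hz =>
        contDiffAt_infty.1 ((contDiffAt_const.mul
          (hφ.contDiffAt (hO.mem_nhds (hsub hz)))).add (hsm z hz)) 2
      have heq : (fun z => ((k₀ * k : ℕ) : ℝ) * hA.weight s (e.symm z) + k * χ (e.symm z))
          =ᶠ[𝓝 (e (e'.symm w))] fun z => k * (k₀ * φ z + χ₀ z) := by
        filter_upwards [Metric.isOpen_ball.mem_nhds hxa] with z hz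
        rw [hχN z hz]
        push_cast
        ring
      rw [leviForm_comp_chart_symm (F := fun x => ((k₀ * k : ℕ) : ℝ) * hA.weight s x + k * χ x)
        he' he hw hxN.1 ((contDiffAt_const.mul (h0 _ hxa)).congr_of_eventuallyEq heq),
        heq.leviForm_eq, leviForm_const_mul (h0 _ hxa)]
      exact mul_nonneg k.cast_nonneg (hpsh _ hxa _)
    · have hf := isHolFrame_lineFrame V A (e'.symm w)
      have hxB := mem_baseSet_self (L := A) (e'.symm w)
      refine ⟨_, _, hf, hxB, fun v => ?_⟩
      have heq : (fun z => ((k₀ * k : ℕ) : ℝ) * hA.weight (lineFrame A (e'.symm w)) (e'.symm z) +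
          k * χ (e'.symm z)) =ᶠ[𝓝 w]
          fun z => ((k₀ * k : ℕ) : ℝ) * hA.weight (lineFrame A (e'.symm w)) (e'.symm z) := by
        filter_upwards [e'.continuousAt_symm hw
          (hK₀.isOpen_compl.mem_nhds fun h => hxN (hK₀N h))] with z hz
        rw [hχ0 _ hz, mul_zero, add_zero]
      rw [heq.leviForm_eq, leviForm_const_mul
        (contDiffAt_infty.1 (hA.contDiffAt_weight hf he' hw hxB) 2)]
      refine mul_nonneg (Nat.cast_nonneg _) ?_
      rcases eq_or_ne v 0 with rfl | hv
      · simp [leviForm]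
      · exact (hpos _ _ hf e' he' w ⟨hw, hxB⟩ v hv).le
  · filter_upwards [hnear, Metric.ball_mem_nhds a hR] with w hw hwR
    rw [hexp w hwR, hw]
  · by_cases hxN : x ∈ N
    · refine Or.inl ⟨hxN.1, ?_⟩
      have h1 := hexp (e x) hxN.2
      rw [e.left_inv hxN.1] at h1
      rw [h1, Real.exp_le_exp, neg_le_neg_iff]
      exact hlow _ hxN.2
    · refine Or.inr ?_
      have h1 : hA.normSq x (s x) ^ k₀ ≤ max C 1 := (hC ⟨x, hx, rfl⟩).trans (le_max_left _ _)
      rw [hχ0 x fun h => hxN (hK₀N h), neg_zero, Real.exp_zero, mul_one]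
      refine h1.trans ?_
      rw [← Real.exp_log (show 0 < max C 1 by positivity), Real.exp_le_exp]
      linarith

end GlobalModification

/-! ### Upper and lower bounds for Bergman kernels -/

section BergmanBounds

open MeasureTheory

variable {m n : ℕ}
  {X : Type*} [TopologicalSpace X] [ChartedSpace ((Fin m → ℂ) × (Fin n → ℂ)) X]
  [IsManifold 𝓘(ℂ, (Fin m → ℂ) × (Fin n → ℂ)) ω X]
  {Y : Type*} [TopologicalSpace Y] [ChartedSpace (Fin m → ℂ) Y]
  {p : X → Y}
  {F : Type*} [NormedAddCommGroup F] [InnerProductSpace ℂ F]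

theorem gaussMass_pos (T : (Fin n → ℂ) →L[ℂ] F) {δ k : ℝ} (hδ : 0 < δ) (hk : 0 ≤ k) :
    0 < gaussMass T δ k := by
  obtain ⟨c, hc, h⟩ := exists_le_gaussMass T hδ one_pos
  exact (ENNReal.ofReal_pos.2 (by positivity)).trans_le (h k hk)

theorem measurable_ofReal_exp_neg_norm_sq (T : (Fin n → ℂ) →L[ℂ] F) (k : ℝ) :
    Measurable fun z => ENNReal.ofReal (Real.exp (-(k * ‖T z‖ ^ 2))) :=
  (ENNReal.continuous_ofReal.comp (by fun_prop)).measurable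

/-- Upper bound for the Bergman kernel, from the mean value inequality for a rotation-invariant
weight. -/
theorem bergmanWeight_le {M : X → Type*} [∀ x, AddCommGroup (M x)] [∀ x, Module ℂ (M x)]
    {Fr : Set X → (∀ x, M x) → Prop} {q : ∀ x, M x → ℝ}
    (hq : ∀ x (r : ℂ) (v : M x), q x (r • v) = ‖r‖ ^ 2 * q x v)
    (T : (Fin n → ℂ) →L[ℂ] F) (c : AdaptedChart m n p) {U : Set X} {s : ∀ x, M x} (hs : Fr U s)
    {w : (Fin m → ℂ) × (Fin n → ℂ)} {δ k Φ : ℝ} (hδ : 0 < δ) (hk : 0 ≤ k)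
    (hball : ∀ z ∈ Metric.ball w.2 δ, (w.1, z) ∈ c.top.target ∧ c.top.symm (w.1, z) ∈ U ∧
      Real.exp (-Φ) * Real.exp (-(k * ‖T (z - w.2)‖ ^ 2)) ≤
        q (c.top.symm (w.1, z)) (s (c.top.symm (w.1, z)))) :
    bergmanWeight Fr q c s w ≤ ((Φ - Real.log (gaussMass T δ k).toReal : ℝ) : EReal) := by
  have hI0 := gaussMass_pos T hδ hk
  have hIt := gaussMass_lt_top T δ hk
  have hIr : 0 < (gaussMass T δ k).toReal := ENNReal.toReal_pos hI0.ne' hIt.ne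
  have hval : ((Φ - Real.log (gaussMass T δ k).toReal : ℝ) : EReal) =
      ENNReal.log (ENNReal.ofReal (Real.exp Φ) / gaussMass T δ k) := by
    have h1 : ENNReal.ofReal (Real.exp Φ) / gaussMass T δ k =
        ENNReal.ofReal (Real.exp Φ / (gaussMass T δ k).toReal) := by
      rw [ENNReal.ofReal_div_of_pos hIr, ENNReal.ofReal_toReal hIt.ne]
    rw [h1, ENNReal.log_ofReal_of_pos (by positivity), Real.log_div (by positivity) hIr.ne',
      Real.log_exp]
  rw [hval]
  refine ENNReal.log_monotone (sSup_le ?_)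
  rintro _ ⟨u, hu, hnorm, a, ha, rfl⟩
  rw [ENNReal.le_div_iff_mul_le (Or.inl hI0.ne') (Or.inl hIt.ne)]
  obtain ⟨f, hf, hfu⟩ := hu (c.slice w.1) U s hs
  have hsub : Metric.ball w.2 δ ⊆ (c.slice w.1).dom ∩ (c.slice w.1).toFun ⁻¹' U :=
    fun z hz => ⟨(hball z hz).1, (hball z hz).2.1⟩
  have hw := Metric.mem_ball_self (x := w.2) hδ
  have hpos : 0 < q (c.top.symm w) (s (c.top.symm w)) :=
    (by positivity : 0 < Real.exp (-Φ) * Real.exp (-(k * ‖T (w.2 - w.2)‖ ^ 2))).trans_le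
      (hball w.2 hw).2.2
  -- The lines `M x` carry no bundle structure here; positivity of `q` on the frame vector replaces
  -- its being nonzero.
  have hnorm_eq : ‖a‖ = ‖f w.2‖ := by
    have h1 : a • s (c.top.symm w) = f w.2 • s (c.top.symm w) := ha.symm.trans (hfu _ (hsub hw))
    have h2 := congrArg (q (c.top.symm w)) h1
    rw [hq, hq, mul_left_inj' hpos.ne'] at h2
    exact (pow_left_inj₀ (norm_nonneg _) (norm_nonneg _) two_ne_zero).1 h2
  have henorm : ‖a‖ₑ = ‖f w.2‖ₑ := by
    rw [← ofReal_norm, ← ofReal_norm, hnorm_eq]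
  have hmean := enorm_sq_mul_lintegral_le (hf.mono hsub)
    (W := fun x => ENNReal.ofReal (Real.exp (-(k * ‖T x‖ ^ 2))))
    (measurable_ofReal_exp_neg_norm_sq T k)
    (fun r x hr => by simp only [map_smul, norm_smul, hr, one_mul])
  rw [henorm]
  refine hmean.trans ?_
  calc ∫⁻ z in Metric.ball w.2 δ,
        ‖f z‖ₑ ^ 2 * ENNReal.ofReal (Real.exp (-(k * ‖T (z - w.2)‖ ^ 2)))
      ≤ ∫⁻ z in Metric.ball w.2 δ, ENNReal.ofReal (Real.exp Φ) *
          ENNReal.ofReal (q ((c.slice w.1).toFun z) ((c.slice w.1).coeff u z)) := by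
        refine setLIntegral_mono' measurableSet_ball fun z hz => ?_
        rw [hfu z (hsub hz), hq, ← ofReal_norm, ← ENNReal.ofReal_pow (norm_nonneg _),
          ← ENNReal.ofReal_mul (by positivity), ← ENNReal.ofReal_mul (by positivity)]
        refine ENNReal.ofReal_le_ofReal ?_
        have h1 := (hball z hz).2.2
        have h2 : Real.exp (-(k * ‖T (z - w.2)‖ ^ 2)) ≤
            Real.exp Φ * q (c.top.symm (w.1, z)) (s (c.top.symm (w.1, z))) := by
          calc Real.exp (-(k * ‖T (z - w.2)‖ ^ 2))
              = Real.exp Φ * (Real.exp (-Φ) * Real.exp (-(k * ‖T (z - w.2)‖ ^ 2))) := by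
                rw [← mul_assoc, ← Real.exp_add, add_neg_cancel, Real.exp_zero, one_mul]
            _ ≤ _ := by gcongr
        calc ‖f z‖ ^ 2 * Real.exp (-(k * ‖T (z - w.2)‖ ^ 2)) ≤ ‖f z‖ ^ 2 *
              (Real.exp Φ * q (c.top.symm (w.1, z)) (s (c.top.symm (w.1, z)))) := by gcongr
          _ = Real.exp Φ * (‖f z‖ ^ 2 * q (c.top.symm (w.1, z)) (s (c.top.symm (w.1, z)))) := by
              ring
    _ = ENNReal.ofReal (Real.exp Φ) * ∫⁻ z in Metric.ball w.2 δ,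
          ENNReal.ofReal (q ((c.slice w.1).toFun z) ((c.slice w.1).coeff u z)) :=
        lintegral_const_mul' _ _ ENNReal.ofReal_ne_top
    _ ≤ ENNReal.ofReal (Real.exp Φ) * fibreNormSq q u := by
        gcongr
        exact (lintegral_mono_set fun z hz => (hsub hz).1).trans
          (lintegral_le_fibreNormSq q u (c.slice w.1))
    _ ≤ ENNReal.ofReal (Real.exp Φ) := by
        refine (mul_le_mul_right hnorm _).trans_eq ?_
        rw [mul_one]

variable
  {L : X → Type*} [TopologicalSpace (TotalSpace ℂ L)]
  [∀ x, AddCommGroup (L x)] [∀ x, Module ℂ (L x)] [∀ x, TopologicalSpace (L x)]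
  [FiberBundle ℂ L] [VectorBundle ℂ ℂ L]
  {E : X → Type*} [TopologicalSpace (TotalSpace ℂ E)]
  [∀ x, AddCommGroup (E x)] [∀ x, Module ℂ (E x)] [∀ x, TopologicalSpace (E x)]
  [FiberBundle ℂ E] [VectorBundle ℂ ℂ E]

/-- The norm of `u ⊗ S` when the weight of `S` is concentrated near a point of the fibre. -/
theorem fibreNormSq_tensor_le (hL : HermitianMetric ((Fin m → ℂ) × (Fin n → ℂ)) L)
    (hE : HermitianMetric ((Fin m → ℂ) × (Fin n → ℂ)) E)
    (T : (Fin n → ℂ) →L[ℂ] F) (c : AdaptedChart m n p)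
    {w : (Fin m → ℂ) × (Fin n → ℂ)} (hw : w ∈ c.top.target)
    (u : FibreForm (m := m) (n := n) p (c.base.symm w.1) L)
    (hfin : fibreNormSq hL.normSq u < ⊤) (S : ∀ x, E x) {δ k G μ τ : ℝ} (hk : 0 ≤ k) (hG : 0 ≤ G)
    (hball : ∀ z ∈ Metric.ball w.2 δ,
      hL.normSq ((c.slice w.1).toFun z) ((c.slice w.1).coeff u z) ≤ G ∧
      hE.normSq (c.top.symm (w.1, z)) (S (c.top.symm (w.1, z))) ≤
        Real.exp (-μ) * Real.exp (-(k * ‖T (z - w.2)‖ ^ 2)))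
    (hout : ∀ x, p x = c.base.symm w.1 →
      ¬ (x ∈ c.top.source ∧ (c.top x).2 ∈ Metric.ball w.2 δ) →
      hE.normSq x (S x) ≤ Real.exp (-μ) * Real.exp (-(k * τ))) :
    fibreNormSq (tensorNormSq hL hE) (u.tensor S) ≤ ENNReal.ofReal (Real.exp (-μ) *
      (G * (gaussMass T δ k).toReal + Real.exp (-(k * τ)) * (fibreNormSq hL.normSq u).toReal)) := by
  have ht := c.fst_mem_target hw
  have hIt := gaussMass_lt_top T δ hk
  have h := fibreNormSq_le_add (q := tensorNormSq hL hE) (tensorNormSq_smul hL hE) (u.tensor S)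
    hL.normSq u c (c.base.map_target ht) (S := Metric.ball w.2 δ) Metric.isOpen_ball
    (C := ENNReal.ofReal (Real.exp (-μ) * Real.exp (-(k * τ)))) (fun γ z hz hzS => by
      rw [FibrePatch.coeff_tensor, tensorNormSq_tmul, ← ENNReal.ofReal_mul (by positivity),
        mul_comm (hL.normSq _ _)]
      refine ENNReal.ofReal_le_ofReal (mul_le_mul_of_nonneg_right ?_ (hL.normSq_nonneg _ _))
      exact hout _ (γ.mem_fibre z hz) fun hin => hzS ⟨hz, hin⟩) ENNReal.ofReal_ne_top
  rw [← c.slice_eq_patch ht] at h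
  refine h.trans ?_
  have h1 : ∫⁻ z in Metric.ball w.2 δ, ENNReal.ofReal (tensorNormSq hL hE
      ((c.slice w.1).toFun z) ((c.slice w.1).coeff (u.tensor S) z)) ≤
      ENNReal.ofReal (G * Real.exp (-μ)) * gaussMass T δ k := by
    have htrans : gaussMass T δ k = ∫⁻ z in Metric.ball w.2 δ,
        ENNReal.ofReal (Real.exp (-(k * ‖T (z - w.2)‖ ^ 2))) := by
      have hpre : (fun z => z - w.2) ⁻¹' Metric.ball 0 δ = Metric.ball w.2 δ := by
        ext z
        simp [dist_eq_norm]
      have := (measurePreserving_sub_right (volume : Measure (Fin n → ℂ)) w.2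
        ).setLIntegral_comp_preimage measurableSet_ball
        (f := fun z => ENNReal.ofReal (Real.exp (-(k * ‖T z‖ ^ 2)))) (s := Metric.ball 0 δ)
        (measurable_ofReal_exp_neg_norm_sq T k)
      rw [hpre] at this
      exact this.symm
    rw [htrans, ← lintegral_const_mul' _ _ ENNReal.ofReal_ne_top]
    refine setLIntegral_mono' measurableSet_ball fun z hz => ?_
    rw [FibrePatch.coeff_tensor, tensorNormSq_tmul, ← ENNReal.ofReal_mul (by positivity), mul_assoc]
    exact ENNReal.ofReal_le_ofReal
      (mul_le_mul (hball z hz).1 (hball z hz).2 (hE.normSq_nonneg _ _) hG)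
  refine (add_le_add h1 le_rfl).trans_eq ?_
  conv_lhs => rw [← ENNReal.ofReal_toReal hIt.ne, ← ENNReal.ofReal_toReal hfin.ne]
  rw [← ENNReal.ofReal_mul (by positivity), ← ENNReal.ofReal_mul (by positivity),
    ← ENNReal.ofReal_add (by positivity) (by positivity)]
  congr 1
  ring

/-- The exponentially small remainder is eventually negligible against a Gaussian integral. -/
theorem exists_exp_mul_le_gaussMass (T : (Fin n → ℂ) →L[ℂ] F) {δ τ ε : ℝ} (hδ : 0 < δ)
    (hτ : 0 < τ) (hε : 0 < ε) (N : ℝ) :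
    ∃ k : ℕ, Real.exp (-(k * τ)) * N ≤ ε * (gaussMass T δ k).toReal := by
  -- With rate `τ / 2` in the lower bound for the mass, a factor `e^(-kτ/2)` is left over to beat
  -- the constants.
  obtain ⟨c, hc, hle⟩ := exists_le_gaussMass T hδ (half_pos hτ)
  have hlim : Filter.Tendsto (fun k : ℕ => Real.exp (-(k * (τ / 2))) * N) Filter.atTop (𝓝 0) := by
    have h1 : Filter.Tendsto (fun k : ℕ => (k : ℝ) * (τ / 2)) Filter.atTop Filter.atTop :=
      tendsto_natCast_atTop_atTop.atTop_mul_const (half_pos hτ)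
    simpa using (Real.tendsto_exp_neg_atTop_nhds_zero.comp h1).mul_const N
  obtain ⟨k, hk⟩ := (hlim.eventually (gt_mem_nhds (mul_pos hε hc))).exists
  refine ⟨k, ?_⟩
  have h1 := hle k k.cast_nonneg
  rw [ENNReal.ofReal_le_iff_le_toReal (gaussMass_lt_top T δ k.cast_nonneg).ne] at h1
  have h2 : Real.exp (-(k * τ)) = Real.exp (-(k * (τ / 2))) * Real.exp (-(k * (τ / 2))) := by
    rw [← Real.exp_add]
    congr 1
    ring
  calc Real.exp (-(k * τ)) * N = Real.exp (-(k * (τ / 2))) * (Real.exp (-(k * (τ / 2))) * N) := by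
        rw [h2, mul_assoc]
    _ ≤ Real.exp (-(k * (τ / 2))) * (ε * c) := by gcongr
    _ = ε * (c * Real.exp (-(k * (τ / 2)))) := by ring
    _ ≤ _ := by gcongr

end BergmanBounds

/-! ### Auxiliary linear maps -/

section LinearAlgebra

/-- Transports to a Hilbert norm, whose square is smooth with an explicit Levi form, unlike the
given norm on `V`. -/
theorem exists_clm_euclidean (V : Type*) [NormedAddCommGroup V] [NormedSpace ℂ V]
    [FiniteDimensional ℂ V] :
    ∃ (d : ℕ) (T : V →L[ℂ] EuclideanSpace ℂ (Fin d)) (κ : ℝ), 0 < κ ∧ ∀ v, κ * ‖v‖ ≤ ‖T v‖ := by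
  have h : Module.finrank ℂ V =
      Module.finrank ℂ (EuclideanSpace ℂ (Fin (Module.finrank ℂ V))) := by simp
  let T : V ≃L[ℂ] EuclideanSpace ℂ (Fin (Module.finrank ℂ V)) := ContinuousLinearEquiv.ofFinrankEq h
  refine ⟨_, T.toContinuousLinearMap, (‖T.symm.toContinuousLinearMap‖ + 1)⁻¹, by positivity,
    fun v => ?_⟩
  rw [inv_mul_le_iff₀ (by positivity)]
  calc ‖v‖ = ‖T.symm.toContinuousLinearMap (T v)‖ := by simp
    _ ≤ ‖T.symm.toContinuousLinearMap‖ * ‖T v‖ := ContinuousLinearMap.le_opNorm _ _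
    _ ≤ (‖T.symm.toContinuousLinearMap‖ + 1) * ‖T v‖ := by
        gcongr
        linarith

/-- Applied to `b.1 ≠ 0` and `b.2`, it gives a linear graph over the base that contains the
direction `b`. -/
theorem exists_clm_apply_eq {m : ℕ} {W : Type*} [NormedAddCommGroup W] [NormedSpace ℂ W]
    {v : Fin m → ℂ} (hv : v ≠ 0) (w : W) : ∃ M : (Fin m → ℂ) →L[ℂ] W, M v = w := by
  obtain ⟨i, hi⟩ := Function.ne_iff.1 hv
  refine ⟨(ContinuousLinearMap.proj (R := ℂ) (φ := fun _ : Fin m => ℂ) i).smulRight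
    ((v i)⁻¹ • w), ?_⟩
  simpa using smul_inv_smul₀ hi w

end LinearAlgebra

/-! ### A generic point of negative curvature -/

section NegativePoint

variable {m n : ℕ}
  {X : Type*} [TopologicalSpace X] [ChartedSpace ((Fin m → ℂ) × (Fin n → ℂ)) X]
  [IsManifold 𝓘(ℂ, (Fin m → ℂ) × (Fin n → ℂ)) ω X]
  {Y : Type*} [TopologicalSpace Y] [ChartedSpace (Fin m → ℂ) Y]
  {p : X → Y}
  {L : X → Type*} [TopologicalSpace (TotalSpace ℂ L)]
  [∀ x, AddCommGroup (L x)] [∀ x, Module ℂ (L x)] [∀ x, TopologicalSpace (L x)]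
  [FiberBundle ℂ L] [VectorBundle ℂ ℂ L]

/-- If a metric is not semi-positive, its Levi form is negative at a generic point, in an adapted
chart and a non-vertical direction. -/
theorem HermitianMetric.exists_leviForm_neg (hm : 1 ≤ m)
    (hp : Manifold.IsSubmersion 𝓘(ℂ, (Fin m → ℂ) × (Fin n → ℂ)) 𝓘(ℂ, Fin m → ℂ) ω p)
    (hL : HermitianMetric ((Fin m → ℂ) × (Fin n → ℂ)) L) (hneg : ¬ hL.IsSemipositive)
    {Z Z' : Set X} (hZ : IsClosed Z) (hZ0 : interior Z = ∅) (hZ0' : interior Z' = ∅) :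
    ∃ (c : AdaptedChart m n p) (x₀ : X) (U : Set X) (s : ∀ x, L x)
      (b : (Fin m → ℂ) × (Fin n → ℂ)), x₀ ∈ c.top.source ∧ x₀ ∈ U ∧
      IsHolFrame ((Fin m → ℂ) × (Fin n → ℂ)) L U s ∧ b.1 ≠ 0 ∧ x₀ ∉ Z ∧ x₀ ∉ Z' ∧
      leviForm (fun w => hL.weight s (c.top.symm w)) (c.top x₀) b < 0 := by
  simp only [IsSemipositive, not_forall, not_le] at hneg
  obtain ⟨U, s, hs, e, he, w, hw, v, hv⟩ := hneg
  set x := e.symm w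
  obtain ⟨c, hc⟩ := exists_adaptedChart hp x
  set G : (Fin m → ℂ) × (Fin n → ℂ) → ℝ := fun w => hL.weight s (c.top.symm w)
  set O := c.top.target ∩ c.top.symm ⁻¹' U
  have hO : IsOpen O := isOpen_chart_preimage hs.isOpen c.top
  have hG : ContDiffOn ℝ 2 G O := fun z hz =>
    (contDiffAt_infty.1 (hL.contDiffAt_weight hs c.top_mem hz.1 hz.2) 2).contDiffWithinAt
  have hxO : c.top x ∈ O := ⟨c.top.map_source hc, by
    rw [Set.mem_preimage, c.top.left_inv hc]; exact hw.2⟩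
  rw [leviForm_comp_chart_symm (F := hL.weight s) he c.top_mem hw.1 hc
    (hG.contDiffAt (hO.mem_nhds hxO))] at hv
  set v' := fderiv ℂ (fun w => c.top (e.symm w)) w v
  have hcont := continuousOn_leviForm hO hG
  obtain ⟨b, hb1, hb⟩ : ∃ b : (Fin m → ℂ) × (Fin n → ℂ), b.1 ≠ 0 ∧
      leviForm G (c.top x) b < 0 := by
    -- A vertical direction is tilted by a small horizontal vector, which exists as `m ≥ 1`; the
    -- Levi form stays negative by continuity.
    by_cases h0 : v'.1 = 0
    · have hline : Continuous fun t : ℝ =>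
          (c.top x, v' + t • ((fun _ => 1, 0) : (Fin m → ℂ) × (Fin n → ℂ))) := by fun_prop
      have hcl : Continuous fun t : ℝ => leviForm G (c.top x)
          (v' + t • ((fun _ => 1, 0) : (Fin m → ℂ) × (Fin n → ℂ))) :=
        hcont.comp_continuous hline fun t => ⟨hxO, trivial⟩
      have hev := hcl.continuousAt (x := 0) |>.eventually
        (gt_mem_nhds (show _ < (0 : ℝ) by simpa using hv))
      obtain ⟨t, ht, ht0⟩ := ((hev.filter_mono nhdsWithin_le_nhds).and
        (self_mem_nhdsWithin (s := Set.Ioi (0 : ℝ)))).exists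
      refine ⟨_, fun h => ?_, ht⟩
      have h1 := congrFun h ⟨0, hm⟩
      rw [Prod.fst_add, h0] at h1
      simp at h1
      exact (ne_of_gt ht0) h1
    · exact ⟨v', h0, hv⟩
  have hcw : ContinuousOn (fun w => leviForm G w b) O :=
    hcont.comp (f := fun w => (w, b)) (by fun_prop) fun w hw => ⟨hw, trivial⟩
  have hO' : IsOpen (O ∩ (fun w => leviForm G w b) ⁻¹' Set.Iio 0) :=
    hcw.isOpen_inter_preimage hO isOpen_Iio
  set N := c.top.source ∩ c.top ⁻¹' (O ∩ (fun w => leviForm G w b) ⁻¹' Set.Iio 0)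
  have hN : IsOpen N := c.top.isOpen_inter_preimage hO'
  have hxN : x ∈ N := ⟨hc, hxO, hb⟩
  -- The closed set `Z` is removed first, which leaves an open set; so `Z'` need not be closed.
  have h1 : (N ∩ Zᶜ).Nonempty := by
    rw [Set.inter_compl_nonempty_iff]
    intro hsub
    have := interior_maximal hsub hN hxN
    rw [hZ0] at this
    exact this
  obtain ⟨x', hx'⟩ := h1
  have h2 : ((N ∩ Zᶜ) ∩ Z'ᶜ).Nonempty := by
    rw [Set.inter_compl_nonempty_iff]
    intro hsub
    have := interior_maximal hsub (hN.inter hZ.isOpen_compl) hx'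
    rw [hZ0'] at this
    exact this
  obtain ⟨x₀, ⟨hx₀, hx₀Z⟩, hx₀Z'⟩ := h2
  refine ⟨c, x₀, U, s, b, hx₀.1, ?_, hs, hb1, hx₀Z, hx₀Z', hx₀.2.2⟩
  have := hx₀.2.1.2
  rwa [Set.mem_preimage, c.top.left_inv hx₀.1] at this

end NegativePoint

/-! ### Comparison of the two bounds on a small disc -/

section Contradiction

open MeasureTheory

variable {m n : ℕ}
  {X : Type*} [TopologicalSpace X] [ChartedSpace ((Fin m → ℂ) × (Fin n → ℂ)) X]
  [IsManifold 𝓘(ℂ, (Fin m → ℂ) × (Fin n → ℂ)) ω X]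
  {Y : Type*} [TopologicalSpace Y] [ChartedSpace (Fin m → ℂ) Y]
  {p : X → Y}
  {L : X → Type*} [TopologicalSpace (TotalSpace ℂ L)]
  [∀ x, AddCommGroup (L x)] [∀ x, Module ℂ (L x)] [∀ x, TopologicalSpace (L x)]
  [FiberBundle ℂ L] [VectorBundle ℂ ℂ L]
  {A : X → Type*} [TopologicalSpace (TotalSpace ℂ A)]
  [∀ x, AddCommGroup (A x)] [∀ x, Module ℂ (A x)] [∀ x, TopologicalSpace (A x)]
  [FiberBundle ℂ A] [VectorBundle ℂ ℂ A]

/-- Lower bound for the Bergman kernel by one section, in terms of local weights. -/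
theorem le_bergmanWeight_tensor {E : X → Type*} [TopologicalSpace (TotalSpace ℂ E)]
    [∀ x, AddCommGroup (E x)] [∀ x, Module ℂ (E x)] [∀ x, TopologicalSpace (E x)]
    [FiberBundle ℂ E] [VectorBundle ℂ ℂ E]
    [ContMDiffVectorBundle ω ℂ E 𝓘(ℂ, (Fin m → ℂ) × (Fin n → ℂ))]
    (hL : HermitianMetric ((Fin m → ℂ) × (Fin n → ℂ)) L)
    (hE : HermitianMetric ((Fin m → ℂ) × (Fin n → ℂ)) E)
    (c : AdaptedChart m n p) {w : (Fin m → ℂ) × (Fin n → ℂ)}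
    {u : FibreForm (m := m) (n := n) p (c.base.symm w.1) L}
    (hu : IsHolFibreForm (IsHolFrame ((Fin m → ℂ) × (Fin n → ℂ)) L) u)
    (huw : (c.slice w.1).coeff u w.2 ≠ 0)
    {S : ∀ x, E x} (hS : IsHolSectionOn ((Fin m → ℂ) × (Fin n → ℂ)) E Set.univ S)
    {s : ∀ x, L x} (hs : s (c.top.symm w) ≠ 0) {R : ℝ}
    (hR : fibreNormSq (tensorNormSq hL hE) (u.tensor S) ≤ ENNReal.ofReal
      (Real.exp (-R) * hL.normSq ((c.slice w.1).toFun w.2) ((c.slice w.1).coeff u w.2))) :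
    ((hL.weight s (c.top.symm w) + R : ℝ) : EReal) ≤
      bergmanWeight (IsTensorFrame ((Fin m → ℂ) × (Fin n → ℂ)) L E) (tensorNormSq hL hE) c
        (fun x => s x ⊗ₜ[ℂ] S x) w := by
  set g : ℂ := lineRatio (L := L) (x := c.top.symm w) ((c.slice w.1).coeff u w.2)
    (s (c.top.symm w))
  have hg : (c.slice w.1).coeff u w.2 = g • s (c.top.symm w) :=
    (lineRatio_smul (L := L) (x := c.top.symm w) _ hs).symm
  have hg0 : g ≠ 0 := lineRatio_ne_zero (L := L) huw hs
  have hG : hL.normSq ((c.slice w.1).toFun w.2) ((c.slice w.1).coeff u w.2) =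
      ‖g‖ ^ 2 * Real.exp (-hL.weight s (c.top.symm w)) := by
    rw [hg, ← hL.normSq_eq_exp_weight hs]
    exact hL.normSq_smul (c.top.symm w) g _
  have hgn : 0 < ‖g‖ := norm_pos_iff.2 hg0
  have hpos : 0 < Real.exp (-R) * (‖g‖ ^ 2 * Real.exp (-hL.weight s (c.top.symm w))) := by
    positivity
  rw [hG] at hR
  refine le_trans (le_of_eq ?_) (log_le_bergmanWeight (tensorNormSq_smul hL hE) c
    (fun x => s x ⊗ₜ[ℂ] S x) w (hu.tensor hS) hpos hR (c.coeff_slice_tensor u S s hg))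
  rw [← ofReal_norm, ← ENNReal.ofReal_pow hgn.le, ← ENNReal.ofReal_div_of_pos hpos,
    ENNReal.log_ofReal_of_pos (by positivity)]
  congr 1
  rw [Real.log_div (by positivity) hpos.ne', Real.log_mul (by positivity) (by positivity),
    Real.log_mul (by positivity) (by positivity), Real.log_exp, Real.log_exp]
  ring

variable [ContMDiffVectorBundle ω ℂ L 𝓘(ℂ, (Fin m → ℂ) × (Fin n → ℂ))]
  [ContMDiffVectorBundle ω ℂ A 𝓘(ℂ, (Fin m → ℂ) × (Fin n → ℂ))]

/-- For a non-vertical direction `b`, the powers of `A` are given weights `k (m₀ + Q)` with `Q` zero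
along `a + ℂ b`. The Bergman weight is then close to `φ` plus a constant: from below at `a`, from
above on the circle. Its sub-mean value inequality is incompatible with a negative Levi form of `φ`.
-/
theorem leviForm_weight_nonneg_of_bergman [T2Space X] [T1Space Y]
    (hp_proper : IsProperMap p)
    (hp : Manifold.IsSubmersion 𝓘(ℂ, (Fin m → ℂ) × (Fin n → ℂ)) 𝓘(ℂ, Fin m → ℂ) ω p)
    (hL : HermitianMetric ((Fin m → ℂ) × (Fin n → ℂ)) L)
    (hA : HermitianMetric ((Fin m → ℂ) × (Fin n → ℂ)) A) (hA_pos : hA.IsPositive)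
    {sA : ∀ x, A x} (hsA : IsHolSectionOn ((Fin m → ℂ) × (Fin n → ℂ)) A Set.univ sA)
    (hB : ∀ (k : ℕ) (hE : HermitianMetric ((Fin m → ℂ) × (Fin n → ℂ)) (LinePower A k)),
      hE.IsSemipositive →
      BergmanSemipositive m n p (IsTensorFrame ((Fin m → ℂ) × (Fin n → ℂ)) L (LinePower A k))
          (tensorNormSq hL hE) ∨
        BergmanIdenticallyTop m n p
          (IsTensorFrame ((Fin m → ℂ) × (Fin n → ℂ)) L (LinePower A k)) (tensorNormSq hL hE))
    (c : AdaptedChart m n p) {a : (Fin m → ℂ) × (Fin n → ℂ)} (ha : a ∈ c.top.target)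
    (hsA0 : sA (c.top.symm a) ≠ 0) (hsec : HasFibreSection (m := m) (n := n) p L (c.top.symm a))
    {U : Set X} {s : ∀ x, L x} (hs : IsHolFrame ((Fin m → ℂ) × (Fin n → ℂ)) L U s)
    (haU : c.top.symm a ∈ U) {b : (Fin m → ℂ) × (Fin n → ℂ)} (hb : b.1 ≠ 0) :
    0 ≤ leviForm (fun w => hL.weight s (c.top.symm w)) a b := by
  by_contra! hneg
  obtain ⟨y, hy, u, hu, hua⟩ := hsec
  obtain rfl : y = c.base.symm a.1 := hy.symm.trans (c.proj_symm ha)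
  have hcoeff := c.coeff_slice_ne_zero hp.contMDiff ha u hua
  have hfin := fibreNormSq_lt_top hp_proper hp hL hu
  set φ : (Fin m → ℂ) × (Fin n → ℂ) → ℝ := fun w => hL.weight s (c.top.symm w) with hφdef
  -- the quadratic function which vanishes on the line through `a` in the direction `b`
  obtain ⟨d, T, κ, hκ, hT⟩ := exists_clm_euclidean ((Fin m → ℂ) × (Fin n → ℂ))
  obtain ⟨d₂, T₂, κ₂, hκ₂, hT₂⟩ := exists_clm_euclidean (Fin n → ℂ)
  obtain ⟨M, hM⟩ := exists_clm_apply_eq hb b.2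
  -- `P` measures the vertical distance to the graph of `M`: it kills `b` and restricts to the
  -- injective `T₂` on vertical vectors.
  set P : ((Fin m → ℂ) × (Fin n → ℂ)) →L[ℂ] EuclideanSpace ℂ (Fin d₂) :=
    T₂ ∘L (ContinuousLinearMap.snd ℂ (Fin m → ℂ) (Fin n → ℂ) -
      M ∘L ContinuousLinearMap.fst ℂ (Fin m → ℂ) (Fin n → ℂ)) with hP
  have hPb : P b = 0 := by
    simp [hP, hM]
  have hPsnd : ∀ z : Fin n → ℂ, P (0, z) = T₂ z := fun z => by simp [hP]
  set Q : (Fin m → ℂ) × (Fin n → ℂ) → ℝ := fun w => ‖P (w - a)‖ ^ 2 with hQdef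
  have hra := c.top.right_inv ha
  obtain ⟨k₀, χ, hχ, m₀, hsemi, hnear, hfib⟩ := hA.exists_powMetric_modification hA_pos hsA
    c.top_mem (c.top.map_target ha) hsA0 T hκ hT (Q := Q) (contDiff_norm_sq_clm P a)
    (fun w v => by rw [leviForm_norm_sq_clm]; positivity) (by simp [hQdef, hra])
    (hp_proper.isCompact_preimage (isCompact_singleton (x := c.base.symm a.1)))
  rw [hra] at hnear
  -- a polydisc on which all local data are defined
  have hfrA := hA.isHolFrame_ne_zero hsA
  set W : Set X := U ∩ {x | sA x ≠ 0}
  have hW : IsOpen W := hs.isOpen.inter hfrA.isOpen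
  set O := c.top.target ∩ c.top.symm ⁻¹' W
  have hO : IsOpen O := isOpen_chart_preimage hW c.top
  have haO : a ∈ O := ⟨ha, haU, hsA0⟩
  obtain ⟨ρ, hρ, hball⟩ := Metric.nhds_basis_closedBall.mem_iff.1
    (Filter.inter_mem (hO.mem_nhds haO) hnear)
  have hφat : ∀ w ∈ O, ContDiffAt ℝ ∞ φ w := fun w hw =>
    hL.contDiffAt_weight hs c.top_mem hw.1 hw.2.1
  have hφc : ContinuousOn φ (Metric.closedBall a ρ) := fun w hw =>
    (hφat w (hball hw).1).continuousAt.continuousWithinAt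
  obtain ⟨r, ⟨havg, hrb⟩, hr⟩ := (((eventually_circleAverage_lt
    (contDiffAt_infty.1 (hφat a haO) 2) hneg).and
      (((continuous_id.mul continuous_const).continuousAt (x := (0 : ℝ)).eventually
        (gt_mem_nhds (show (0 : ℝ) * ‖b‖ < ρ / 2 by rw [zero_mul]; positivity))).filter_mono
          nhdsWithin_le_nhds)).and (self_mem_nhdsWithin (s := Set.Ioi (0 : ℝ)))).exists
  -- The defect of the mean value inequality is `4η`; the lower bound will lose `2η` and the upper
  -- bound `η`.
  set η := (φ a - Real.circleAverage (fun ζ : ℂ => φ (a + ζ • (r : ℂ) • b)) 0 1) / 4 with hηdef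
  have hη : 0 < η := by
    rw [hηdef]
    linarith
  have hdisc : ∀ ζ : ℂ, ‖ζ‖ ≤ 1 → dist (a + ζ • (r : ℂ) • b) a < ρ / 2 := fun ζ hζ => by
    rw [dist_eq_norm, add_sub_cancel_left, norm_smul, norm_smul, Complex.norm_real,
      Real.norm_of_nonneg (le_of_lt hr)]
    refine lt_of_le_of_lt ?_ hrb
    exact mul_le_of_le_one_left (mul_nonneg (le_of_lt hr) (norm_nonneg b)) hζ
  obtain ⟨δ₁, hδ₁, hunif⟩ := Metric.uniformContinuousOn_iff.1
    ((isCompact_closedBall a ρ).uniformContinuousOn_of_continuous hφc) η hη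
  -- the section `u` is almost constant near the centre
  set G := hL.normSq ((c.slice a.1).toFun a.2) ((c.slice a.1).coeff u a.2)
  have hG : 0 < G := hL.normSq_pos _ _ hcoeff
  have hadom : a.2 ∈ (c.slice a.1).dom := ha
  obtain ⟨δ₂, hδ₂, hcoeff_le⟩ := Metric.eventually_nhds_iff_ball.1
    (((hu.continuousOn_normSq_coeff hL (c.slice a.1)).continuousAt
      ((c.slice a.1).isOpen_dom.mem_nhds hadom)).eventually
        (gt_mem_nhds (show G < Real.exp η * G from
          lt_mul_of_one_lt_left hG (Real.one_lt_exp_iff.2 hη))))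
  set δ := min δ₁ (min (ρ / 2) δ₂)
  have hδ : 0 < δ := lt_min hδ₁ (lt_min (half_pos hρ) hδ₂)
  have hδδ₁ : δ ≤ δ₁ := min_le_left _ _
  have hδρ : δ ≤ ρ / 2 := (min_le_right _ _).trans (min_le_left _ _)
  have hδδ₂ : δ ≤ δ₂ := (min_le_right _ _).trans (min_le_right _ _)
  -- On the fibre through `a` and off the ball of radius `δ`, the weight exceeds `k m₀` by at least
  -- `k τ`: either `Q ≥ (κ₂ δ)²` there, or the bound with `m₀ + 1` holds.
  set τ := min ((κ₂ * δ) ^ 2) 1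
  have hτ : 0 < τ := lt_min (by positivity) one_pos
  -- The part of the norm of the competitor away from `a` raises the factor `exp η` only to `exp
  -- (2η)`.
  obtain ⟨k, hk⟩ := exists_exp_mul_le_gaussMass T₂ hδ hτ
    (show 0 < (Real.exp (2 * η) - Real.exp η) * G from
      mul_pos (sub_pos.2 (Real.exp_lt_exp.2 (by linarith))) hG) (fibreNormSq hL.normSq u).toReal
  set I := (gaussMass T₂ δ k).toReal
  have hI : 0 < I := ENNReal.toReal_pos (gaussMass_pos T₂ hδ k.cast_nonneg).ne'
    (gaussMass_lt_top T₂ δ k.cast_nonneg).ne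
  set hE := hA.powMetric (k₀ * k) (hχ.const_mul k)
  set S : ∀ x, LinePower A (k₀ * k) x := fun x => linePow (k₀ * k) (sA x)
  have hSnorm : ∀ x, hE.normSq x (S x) =
      (hA.normSq x (sA x) ^ k₀ * Real.exp (-χ x)) ^ k := fun x => by
    rw [hA.powMetric_normSq_linePow, mul_pow, ← pow_mul, ← Real.exp_nat_mul, mul_neg]
  have hSnear : ∀ w ∈ Metric.closedBall a ρ, hE.normSq (c.top.symm w) (S (c.top.symm w)) =
      Real.exp (-(k * m₀)) * Real.exp (-(k * Q w)) := fun w hw => by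
    rw [hSnorm, (hball hw).2, ← Real.exp_nat_mul, ← Real.exp_add]
    congr 1
    ring
  have hShol : IsHolSectionOn ((Fin m → ℂ) × (Fin n → ℂ)) (LinePower A (k₀ * k)) Set.univ S :=
    hsA.linePow isOpen_univ _
  have hframe : IsTensorFrame ((Fin m → ℂ) × (Fin n → ℂ)) L (LinePower A (k₀ * k)) W
      (fun x => s x ⊗ₜ[ℂ] S x) :=
    ⟨s, S, hs.mono hW Set.inter_subset_left, (hfrA.linePow _).mono hW Set.inter_subset_right,
      fun _ => rfl⟩
  have hslice : ∀ w ∈ Metric.ball a (ρ / 2), ∀ z ∈ Metric.ball w.2 δ,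
      (w.1, z) ∈ Metric.closedBall a ρ := fun w hw z hz => by
    have h1 : dist (w.1, z) w < δ := by
      rw [Prod.dist_eq, dist_self]
      exact max_lt hδ hz
    exact ((dist_triangle _ w _).trans (add_lt_add (h1.trans_le hδρ) hw).le).trans
      (add_halves ρ).le
  -- lower bound at the centre
  have hlower : ((φ a + (k * m₀ - 2 * η - Real.log I) : ℝ) : EReal) ≤
      bergmanWeight (IsTensorFrame ((Fin m → ℂ) × (Fin n → ℂ)) L (LinePower A (k₀ * k)))
        (tensorNormSq hL hE) c (fun x => s x ⊗ₜ[ℂ] S x) a := by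
    refine le_bergmanWeight_tensor hL hE c hu hcoeff hShol (hs.ne_zero _ haU) ?_
    refine (fibreNormSq_tensor_le hL hE T₂ c ha u hfin S (δ := δ) (k := k)
      (G := Real.exp η * G) (μ := k * m₀) (τ := τ) k.cast_nonneg (by positivity)
      (fun z hz => ⟨(hcoeff_le z (Metric.ball_subset_ball hδδ₂ hz)).le, ?_⟩) ?_).trans ?_
    · rw [hSnear _ (hslice a (Metric.mem_ball_self (half_pos hρ)) z hz)]
      refine le_of_eq ?_
      congr 4
      simp only [hQdef]
      rw [show ((a.1, z) : (Fin m → ℂ) × (Fin n → ℂ)) - a = (0, z - a.2) from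
        Prod.ext (sub_self _) rfl, hPsnd]
    · intro x hx hxout
      rw [hSnorm, ← Real.exp_add]
      have hkey : hA.normSq x (sA x) ^ k₀ * Real.exp (-χ x) ≤ Real.exp (-(m₀ + τ)) := by
        rcases hfib x hx with ⟨hxs, hle⟩ | hle
        · refine hle.trans (Real.exp_le_exp.2 (neg_le_neg (add_le_add le_rfl ?_)))
          have h1 : c.top x - a = (0, (c.top x).2 - a.2) := by
            refine Prod.ext ?_ rfl
            change (c.top x).1 - a.1 = 0
            rw [← c.base_apply x hxs, hx, c.base.right_inv (c.fst_mem_target ha), sub_self]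
          have h2 : δ ≤ ‖(c.top x).2 - a.2‖ := by
            rw [← dist_eq_norm]
            exact not_lt.1 fun h => hxout ⟨hxs, h⟩
          simp only [hQdef]
          rw [h1, hPsnd]
          exact (min_le_left _ _).trans (pow_le_pow_left₀ (by positivity)
            ((mul_le_mul_of_nonneg_left h2 hκ₂.le).trans (hT₂ _)) 2)
        · exact hle.trans (Real.exp_le_exp.2 (neg_le_neg (add_le_add le_rfl (min_le_right _ _))))
      refine (pow_le_pow_left₀ (mul_nonneg (pow_nonneg (hA.normSq_nonneg _ _) _)
        (Real.exp_pos _).le) hkey k).trans_eq ?_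
      rw [← Real.exp_nat_mul]
      congr 1
      ring
    · refine ENNReal.ofReal_le_ofReal ?_
      have h1 : Real.exp (-(k * m₀ - 2 * η - Real.log I)) =
          Real.exp (-(k * m₀)) * (Real.exp (2 * η) * I) := by
        rw [show -(k * m₀ - 2 * η - Real.log I) = -(k * m₀) + (2 * η + Real.log I) by ring,
          Real.exp_add, Real.exp_add, Real.exp_log hI]
      rw [h1, mul_assoc (Real.exp (-(k * m₀)))]
      refine mul_le_mul_of_nonneg_left ?_ (Real.exp_pos _).le
      calc _ ≤ Real.exp η * G * I + (Real.exp (2 * η) - Real.exp η) * G * I := by gcongr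
        _ = Real.exp (2 * η) * I * G := by ring
  -- upper bound on the disc
  have hupper : ∀ ζ : ℂ, ‖ζ‖ = 1 →
      bergmanWeight (IsTensorFrame ((Fin m → ℂ) × (Fin n → ℂ)) L (LinePower A (k₀ * k)))
        (tensorNormSq hL hE) c (fun x => s x ⊗ₜ[ℂ] S x) (a + ζ • (r : ℂ) • b) ≤
      ((φ (a + ζ • (r : ℂ) • b) + (η + k * m₀ - Real.log I) : ℝ) : EReal) := fun ζ hζ => by
    set w := a + ζ • (r : ℂ) • b with hw
    have hwball : w ∈ Metric.ball a (ρ / 2) := hdisc ζ hζ.le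
    have hwc : w ∈ Metric.closedBall a ρ :=
      (show dist w a < ρ / 2 from hwball).le.trans (by linarith)
    rw [show φ w + (η + k * m₀ - Real.log I) = (φ w + η + k * m₀) - Real.log I by ring]
    refine bergmanWeight_le (tensorNormSq_smul hL hE) T₂ c hframe hδ k.cast_nonneg fun z hz => ?_
    have hzc := hslice w hwball z hz
    have hzO := (hball hzc).1
    refine ⟨hzO.1, hzO.2, ?_⟩
    rw [tensorNormSq_tmul, hSnear _ hzc, hL.normSq_eq_exp_weight (hs.ne_zero _ hzO.2.1)]
    -- As `w - a` is a multiple of `b`, on the slice through `w` the weight is the Gaussian centred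
    -- at `w.2`; the mass `I` is thus the same at all points of the disc.
    have hQz : Q (w.1, z) = ‖T₂ (z - w.2)‖ ^ 2 := by
      have h1 : ((w.1, z) : (Fin m → ℂ) × (Fin n → ℂ)) - a =
          (0, z - w.2) + ζ • (r : ℂ) • b := by
        rw [show ζ • (r : ℂ) • b = w - a by rw [hw, add_sub_cancel_left]]
        refine Prod.ext ?_ ?_ <;> simp
      simp only [hQdef]
      rw [h1, map_add, map_smul, map_smul, hPb, smul_zero, smul_zero, add_zero, hPsnd]
    have hφz : φ (w.1, z) ≤ φ w + η := by
      have h1 : dist ((w.1, z) : (Fin m → ℂ) × (Fin n → ℂ)) w < δ₁ := by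
        rw [Prod.dist_eq, dist_self]
        exact max_lt hδ₁ (lt_of_lt_of_le hz hδδ₁)
      have h2 := hunif _ hzc _ hwc h1
      rw [Real.dist_eq] at h2
      linarith [(abs_lt.1 h2).2]
    rw [hQz, ← mul_assoc]
    refine mul_le_mul_of_nonneg_right ?_ (Real.exp_pos _).le
    rw [← Real.exp_add, Real.exp_le_exp]
    change -(φ w + η + k * m₀) ≤ -φ (w.1, z) + -(k * m₀)
    linarith
  -- The constants `k m₀` and `log I` cancel in the sub-mean value inequality, which leaves `4η ≤
  -- 3η`. In the other case the finite lower bound at `a` is contradicted.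
  rcases hB (k₀ * k) hE (hsemi k) with hpsh | htop
  · have hdO : ∀ ζ : ℂ, ‖ζ‖ ≤ 1 → a + ζ • (r : ℂ) • b ∈ O := fun ζ hζ =>
      (hball ((hdisc ζ hζ).le.trans (by linarith))).1
    have hφζ : ContinuousOn (fun ζ : ℂ => φ (a + ζ • (r : ℂ) • b)) (Metric.sphere 0 1) :=
      hφc.comp (by fun_prop) fun ζ hζ =>
        (hdisc ζ (mem_sphere_zero_iff_norm.1 hζ).le).le.trans (by linarith)
    have hmean := (hpsh c W _ hframe).le_circleAverage (a := a) (b := (r : ℂ) • b) hdO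
      (h := fun ζ => φ (a + ζ • (r : ℂ) • b) + (η + k * m₀ - Real.log I))
      (hφζ.add continuousOn_const) hupper
    have hreal := EReal.coe_le_coe_iff.1 (hlower.trans hmean)
    rw [Real.circleAverage_fun_add (hφζ.circleIntegrable zero_le_one)
      (circleIntegrable_const _ _ _), Real.circleAverage_const] at hreal
    have : 4 * η = φ a - Real.circleAverage (fun ζ : ℂ => φ (a + ζ • (r : ℂ) • b)) 0 1 := by
      rw [hηdef]
      ring
    linarith
  · rw [htop c W _ hframe a haO, le_bot_iff] at hlower
    exact EReal.coe_ne_bot _ hlower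

end Contradiction

end

/-! ### Conclusion -/

theorem theorem3p1 (m n : ℕ) (hm : 1 ≤ m)
    -- the connected complex manifold `X` of dimension `m + n`
    (X : Type*) [TopologicalSpace X] [T2Space X] [SecondCountableTopology X] [ConnectedSpace X]
    [ChartedSpace ((Fin m → ℂ) × (Fin n → ℂ)) X]
    [IsManifold 𝓘(ℂ, (Fin m → ℂ) × (Fin n → ℂ)) ω X]
    -- the connected complex manifold `Y` of dimension `m`
    (Y : Type*) [TopologicalSpace Y] [T2Space Y] [SecondCountableTopology Y] [ConnectedSpace Y]
    [ChartedSpace (Fin m → ℂ) Y] [IsManifold 𝓘(ℂ, Fin m → ℂ) ω Y]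
    -- the proper holomorphic submersion `p`
    (p : X → Y) (hp_proper : IsProperMap p)
    (hp : Manifold.IsSubmersion 𝓘(ℂ, (Fin m → ℂ) × (Fin n → ℂ)) 𝓘(ℂ, Fin m → ℂ) ω p)
    -- the Hermitian holomorphic line bundle `(L, h_L)`
    (L : X → Type*) [TopologicalSpace (TotalSpace ℂ L)]
    [∀ x, AddCommGroup (L x)] [∀ x, Module ℂ (L x)] [∀ x, TopologicalSpace (L x)]
    [FiberBundle ℂ L] [VectorBundle ℂ ℂ L]
    [ContMDiffVectorBundle ω ℂ L 𝓘(ℂ, (Fin m → ℂ) × (Fin n → ℂ))]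
    (hL : HermitianMetric ((Fin m → ℂ) × (Fin n → ℂ)) L)
    -- some fibre carries a nonzero section of `K_{X_y} ⊗ L`
    (h1 : ∃ (y : Y) (u : FibreForm (m := m) (n := n) p y L),
      IsHolFibreForm (IsHolFrame ((Fin m → ℂ) × (Fin n → ℂ)) L) u ∧ u ≠ 0)
    -- a positive Hermitian holomorphic line bundle `(A, h_A)` with a nonzero section
    (A : X → Type*) [TopologicalSpace (TotalSpace ℂ A)]
    [∀ x, AddCommGroup (A x)] [∀ x, Module ℂ (A x)] [∀ x, TopologicalSpace (A x)]
    [FiberBundle ℂ A] [VectorBundle ℂ ℂ A]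
    [ContMDiffVectorBundle ω ℂ A 𝓘(ℂ, (Fin m → ℂ) × (Fin n → ℂ))]
    (hA : HermitianMetric ((Fin m → ℂ) × (Fin n → ℂ)) A) (hA_pos : hA.IsPositive)
    (h2 : ∃ s : ∀ x, A x,
      IsHolSectionOn ((Fin m → ℂ) × (Fin n → ℂ)) A Set.univ s ∧ ∃ x, s x ≠ 0)
    -- the relative Bergman kernel metrics on `K_{X/Y} ⊗ L ⊗ E`, for semi-positive `(E, h_E)`
    (h3 : ∀ (E : X → Type) [TopologicalSpace (TotalSpace ℂ E)]
      [∀ x, AddCommGroup (E x)] [∀ x, Module ℂ (E x)] [∀ x, TopologicalSpace (E x)]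
      [FiberBundle ℂ E] [VectorBundle ℂ ℂ E]
      [ContMDiffVectorBundle ω ℂ E 𝓘(ℂ, (Fin m → ℂ) × (Fin n → ℂ))]
      (hE : HermitianMetric ((Fin m → ℂ) × (Fin n → ℂ)) E), hE.IsSemipositive →
      BergmanSemipositive m n p (IsTensorFrame ((Fin m → ℂ) × (Fin n → ℂ)) L E)
          (tensorNormSq hL hE) ∨
        BergmanIdenticallyTop m n p (IsTensorFrame ((Fin m → ℂ) × (Fin n → ℂ)) L E)
          (tensorNormSq hL hE)) :
    hL.IsSemipositive := by
  by_contra hneg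
  obtain ⟨s, hs, hs0⟩ := h2
  obtain ⟨y, u, hu, hu0⟩ := h1
  obtain ⟨x, hx⟩ := Function.ne_iff.1 hu0
  have hfr := hA.isHolFrame_ne_zero hs
  -- The zeroth power trivializes `A^0` globally, also at the zeros of `s`.
  have ht_ne : ∀ x, linePow 0 (s x) ≠ 0 := fun x h => by
    have h1 := lineCoord_linePow (k := 0) (mem_baseSet_self x) (s x)
    rw [h, map_zero, pow_zero] at h1
    exact zero_ne_one h1
  -- This is the trivial bundle with the flat metric in which `s^0` has norm `1`; it stands for `K ⊗
  -- L` without a twist.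
  have hE0 : (hA.powMetric 0 (isChartSmooth_const 0)).IsSemipositive := by
    refine hA.isSemipositive_powMetric 0 _ fun e he w hw => ?_
    refine ⟨_, _, isHolFrame_lineFrame _ A (e.symm w), mem_baseSet_self _, fun v => ?_⟩
    simp only [Nat.cast_zero, zero_mul, add_zero]
    exact (leviForm_const 0 w v).ge
  have hsec := interior_not_hasFibreSection hp_proper hp hL
    (hA.powMetric 0 (isChartSmooth_const 0)) (t := fun x => linePow 0 (s x))
    ⟨isOpen_univ, hs.linePow isOpen_univ 0, fun x _ => ht_ne x⟩
    (fun x => by rw [hA.powMetric_normSq_linePow]; simp) ⟨x, y, x.2, u, hu, hx⟩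
    (h3 (LinePower A 0) _ hE0)
  have hZ : IsClosed {x | s x = 0} := ⟨hfr.isOpen⟩
  obtain ⟨c, x₀, U, f, b, hx₀, hx₀U, hf, hb, hsx₀, hsec₀, hlevi⟩ :=
    hL.exists_leviForm_neg hm hp hneg hZ (hs.interior_zeros_eq_empty hs0) hsec
  have hx₀' := c.top.left_inv hx₀
  refine absurd hlevi (not_lt.2 (leviForm_weight_nonneg_of_bergman hp_proper hp hL hA hA_pos hs
    (fun k hE => h3 (LinePower A k) hE) c (c.top.map_source hx₀) ?_ ?_ hf ?_ hb))
  · rw [hx₀']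
    exact hsx₀
  · rw [hx₀']
    exact not_not.1 hsec₀
  · rwa [hx₀']
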